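/- **Setting.** Write $n=(\tilde n,n_4)\in\mathbb Z^4$ with $\tilde n=(n_1,n_2,n_3)$, $\tilde n^2=n_1^2+n_2^2+n_3^2$, $\mathbb Z^4_*=\mathbb Z^4\setminus\{0\}$. Let $\eta>1$ and $\nu>0$. Let $\ell^1_\eta$ be the space of $a\in\mathbb C^{\mathbb Z^4_*}$ with $\|a\|_{\ell^1_\eta}=\sum_n|a_n|\eta^{|n|_1}<\infty$, and $\ell^1_{\eta,-2,-1}$ the analogous space with weight $\eta^{|n|_1}/\max(|\tilde n|_\infty^2,|n_4|)$. Put $\mathcal X=\mathbb C\times(\ell^1_\eta)^3$ and $\mathcal X_{-2,-1}=\mathbb C\times(\ell^1_{\eta,-2,-1})^3$, with norm $|\Omega|+\sum_{l=1}^3\|\omega^{(l)}\|$ for $W=(\Omega,\omega)$; sequences on $\mathbb Z^4_*$ are extended by $\omega_0=0$. Let $(M\omega)_n=\frac{i}{\tilde n^2}\,\tilde n\times\omega_n$ if $\tilde n\ne0$ and $(M\omega)_n=0$ if $\tilde n=0$; $(D_ma)_n=n_ma_n$; $(a*b)_n=\sum_k a_kb_{n-k}$; $[(a\star\tilde D)b]^{(l)}=\sum_{m=1}^3a^{(m)}*(D_mb^{(l)})$.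 Let $f$ be a real-valued analytic forcing on $\mathbb T^3=(\mathbb R/2\pi\mathbb Z)^3$ with Fourier coefficients $f_n$, and $f^\omega=\nabla\times f$, with $f^\omega\in(\ell^1_{\eta,-2,-1})^3$. Let $\hat\omega\in(\mathbb C^3)^{\mathbb Z^4_*}$ be a sequence for which $|n_4||\hat\omega_n|\eta^{-|n|_1}$ is bounded. Define $\mathcal F=(F_{\mathrm{ph}},(F_n)_{n\in\mathbb Z^4_*}):\mathcal X\to\mathcal X_{-2,-1}$ by $$F_{\mathrm{ph}}(W)=i\sum_{l=1}^3\sum_{n\in\mathbb Z^4_*}\omega^{(l)}_n n_4\overline{\hat\omega^{(l)}_n},\qquad F_n(W)=i\Omega n_4\omega_n+i[(M\omega\star\tilde D)\omega]_n-i[(\omega\star\tilde D)M\omega]_n+\nu\tilde n^2\omega_n-f^\omega_n .$$ Let $\gamma_*$ denote the conjugation symmetry $(\gamma_*\omega)_n=\overline{\omega_{-n}}$, $\gamma_*(\Omega,\omega)=(\overline\Omega,\gamma_*\omega)$, and let $\mathcal X^{\mathrm{div}}$ be the set of $W\in\mathcal X$ with $\sum_mD_m\omega^{(m)}=0$. Let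 $\bar W=(\bar\Omega,\bar\omega)\in\mathcal X$ with $\operatorname{Re}\bar\Omega\neq0$, let $N^\dagger\ge1$ be an integer, $\mathcal E^\dagger=\{n\in\mathbb Z^4_*:|\nu\tilde n^2+i\bar\Omega n_4|\le N^\dagger\}$ (a finite set), and let $\Pi^\dagger$ be the projection $(\Omega,\omega)\mapsto(\Omega,(\omega_n)_{n\in\mathcal E^\dagger})$. Let $\widehat A:\mathcal X\to\mathcal X_{-2,-1}$ be equal to $\Pi^\dagger D\mathcal F(\bar W)\Pi^\dagger$ on $\Pi^\dagger\mathcal X$ and to multiplication of $\omega_n$ by $\nu\tilde n^2+i\bar\Omega n_4$ on the modes $n\notin\mathcal E^\dagger$. Let $A:\mathcal X_{-2,-1}\to\mathcal X$ be equal to an arbitrary given matrix $A^{(N^\dagger)}$ on the finite-dimensional space $\Pi^\dagger\mathcal X_{-2,-1}$ and to multiplication of $\omega_n$ by $(\nu\tilde n^2+i\bar\Omega n_4)^{-1}$ on the modes $n\notin\mathcal E^\dagger$. **Theorem.** Assume that there are non-negative constants $Y_0,Z_0,Z_1,Z_2$ with $$\|A\mathcal F(\bar W)\|_{\mathcal X}\le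 Y_0,\quad \|I-A\widehat A\|_{B(\mathcal X,\mathcal X)}\le Z_0,\quad \|A(D\mathcal F(\bar W)-\widehat A)\|_{B(\mathcal X,\mathcal X)}\le Z_1,$$ $$\|A(D\mathcal F(W)-D\mathcal F(\bar W))\|_{B(\mathcal X,\mathcal X)}\le Z_2\|W-\bar W\|_{\mathcal X}\quad\text{for all }W\in\mathcal X .$$ Assume also that $f$ is time independent with space average zero, that $\bar W\in\mathcal X^{\mathrm{div}}$, and that $\gamma_*\hat\omega=\hat\omega$ and $\gamma_*\bar W=\bar W$. If $$Z_0+Z_1<1\quad\text{and}\quad 2Y_0Z_2<\bigl(1-(Z_0+Z_1)\bigr)^2,$$ then for all $r\in[r_{\min},r_{\max})$, where $$r_{\min}=\frac{1-(Z_0+Z_1)-\sqrt{(1-(Z_0+Z_1))^2-2Y_0Z_2}}{Z_2},\qquad r_{\max}=\frac{1-(Z_0+Z_1)}{Z_2},$$ there is a unique $\tilde W=(\tilde\Omega,\tilde\omega)$ in the closed ball of $\mathcal X$ of center $\bar W$ and radius $r$ with $\mathcal F(\tilde W)=0$. Moreover $\tilde W\in\mathcal X^{\mathrm{div}}$, $\gamma_*\tilde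 W=\tilde W$ (in particular $\tilde\Omega\in\mathbb R$) and $\tilde\Omega\ne0$. Finally, the function $u(x,t)=\sum_n(M\tilde\omega)_ne^{i(\tilde n\cdot x+n_4\tilde\Omega t)}$ is real valued, and there is a real-valued function $p$ on $\mathbb T^3\times\mathbb R$ such that $u$ and $p$ are real analytic and $\frac{2\pi}{\tilde\Omega}$-periodic in $t$, and $$\partial_tu+(u\cdot\nabla)u-\nu\Delta u+\nabla p=f,\qquad\nabla\cdot u=0\quad\text{on }\mathbb T^3\times\mathbb R .$$ -/

import Mathlib

open Complex Filter Topology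

noncomputable section

namespace NSPeriodic

/-! ## Index sets and weights -/

/-- Space-time Fourier indices `n = (n₁, n₂, n₃, n₄)`; `n 3` is the index of the time variable. -/
abbrev Z4 := Fin 4 → ℤ

/-- The nonzero indices. -/
abbrev Z4s := {n : Z4 // n ≠ 0}

/-- `n ↦ -n` on nonzero indices. -/
def negIdx (n : Z4s) : Z4s := ⟨-n.1, neg_ne_zero.2 n.2⟩

/-- The spatial part `ñ = (n₁, n₂, n₃)`. -/
def til (n : Z4) : Fin 3 → ℤ := fun j => n j.castSucc

/-- `ñ² = n₁² + n₂² + n₃²`. -/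
def tilSq (n : Z4) : ℤ := ∑ j, til n j ^ 2

/-- `|ñ|_∞`. -/
def tilInf (n : Z4) : ℕ := Finset.univ.sup fun j => (til n j).natAbs

/-- `|n|₁ = |n₁| + |n₂| + |n₃| + |n₄|`. -/
def norm1 (n : Z4) : ℕ := ∑ j, (n j).natAbs

/-- The weight `η^{|n|₁}` of `ℓ¹_η`. -/
def wt (η : ℝ) (n : Z4s) : ℝ := η ^ norm1 n.1

/-- The weight `η^{|n|₁} / max(|ñ|_∞², |n₄|)` of `ℓ¹_{η,-2,-1}`. -/
def wtNeg (η : ℝ) (n : Z4s) : ℝ :=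
  η ^ norm1 n.1 / (max (tilInf n.1 ^ 2) (n.1 3).natAbs : ℕ)

/-- A weight all of whose values are positive. -/
class PosWeight (w : Z4s → ℝ) : Prop where
  pos : ∀ n, 0 < w n

theorem natAbs_til_le (n : Z4) (j : Fin 3) : (til n j).natAbs ≤ tilInf n :=
  Finset.le_sup (f := fun j => (til n j).natAbs) (Finset.mem_univ j)

theorem one_le_max (n : Z4s) : 1 ≤ max (tilInf n.1 ^ 2) (n.1 3).natAbs := by
  by_contra h
  push Not at h
  have h1 : max (tilInf n.1 ^ 2) (n.1 3).natAbs = 0 := by omega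
  have h2 : tilInf n.1 ^ 2 = 0 := by omega
  have h3 : (n.1 3).natAbs = 0 := by omega
  have h4 : tilInf n.1 = 0 := by simpa using h2
  apply n.2
  funext j
  have key : ∀ i : Fin 3, n.1 i.castSucc = 0 := fun i => by
    have := natAbs_til_le n.1 i
    simp only [til] at this
    omega
  refine Fin.lastCases ?_ (fun i => key i) j
  have : n.1 3 = 0 := by omega
  exact this

instance (η : ℝ) [Fact (1 < η)] : PosWeight (wt η) where
  pos n := pow_pos (by linarith [(Fact.out : 1 < η)]) _

instance (η : ℝ) [Fact (1 < η)] : PosWeight (wtNeg η) where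
  pos n := div_pos (pow_pos (by linarith [(Fact.out : 1 < η)]) _)
    (by exact_mod_cast one_le_max n)

/-! ## Weighted `ℓ¹` spaces -/

/-- Sequences `a` on the nonzero indices with `∑ |aₙ| wₙ < ∞`. -/
def l1Submodule (w : Z4s → ℝ) [PosWeight w] : Submodule ℂ (Z4s → ℂ) where
  carrier := {a | Summable fun n => ‖a n‖ * w n}
  zero_mem' := by simp
  add_mem' {a b} ha hb := by
    refine Summable.of_nonneg_of_le
      (fun n => mul_nonneg (norm_nonneg _) (PosWeight.pos n).le) (fun n => ?_) (ha.add hb)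
    rw [← add_mul]
    exact mul_le_mul_of_nonneg_right (norm_add_le _ _) (PosWeight.pos n).le
  smul_mem' c a ha := by
    refine (Summable.mul_left ‖c‖ ha).congr fun n => ?_
    simp [mul_assoc]

/-- The weighted space `ℓ¹_w` with its norm `∑ |aₙ| wₙ`. -/
def L1w (w : Z4s → ℝ) [PosWeight w] : Type := l1Submodule w

namespace L1w

variable {w : Z4s → ℝ} [PosWeight w]

instance : AddCommGroup (L1w w) := inferInstanceAs (AddCommGroup (l1Submodule w))
instance : Module ℂ (L1w w) := inferInstanceAs (Module ℂ (l1Submodule w))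
instance : CoeFun (L1w w) (fun _ => Z4s → ℂ) := ⟨fun a => a.1⟩

/-- The element of `ℓ¹_w` with given coefficients. -/
def mk (a : Z4s → ℂ) (h : Summable fun n => ‖a n‖ * w n) : L1w w := ⟨a, h⟩

theorem summable (a : L1w w) : Summable fun n => ‖a n‖ * w n := a.2

theorem ext {a b : L1w w} (h : ∀ n, a n = b n) : a = b := Subtype.ext (funext h)

@[simp] theorem mk_apply (a : Z4s → ℂ) (h : Summable fun n => ‖a n‖ * w n) (n : Z4s) :
    (mk a h : L1w w) n = a n := rfl
@[simp] theorem zero_apply (n : Z4s) : (0 : L1w w) n = 0 := rfl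
@[simp] theorem add_apply (a b : L1w w) (n : Z4s) : (a + b) n = a n + b n := rfl
@[simp] theorem smul_apply (c : ℂ) (a : L1w w) (n : Z4s) : (c • a) n = c * a n := rfl

instance : Norm (L1w w) := ⟨fun a => ∑' n, ‖a n‖ * w n⟩

theorem norm_def (a : L1w w) : ‖a‖ = ∑' n, ‖a n‖ * w n := rfl

theorem le_norm (a : L1w w) (n : Z4s) : ‖a n‖ * w n ≤ ‖a‖ :=
  a.summable.le_tsum n fun m _ => mul_nonneg (norm_nonneg _) (PosWeight.pos m).le

theorem normedCore : NormedSpace.Core ℂ (L1w w) where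
  norm_nonneg a := tsum_nonneg fun n => mul_nonneg (norm_nonneg _) (PosWeight.pos n).le
  norm_smul c a := by
    simp only [norm_def, smul_apply, norm_mul, mul_assoc, tsum_mul_left]
  norm_triangle a b := by
    simp only [norm_def]
    rw [← a.summable.tsum_add b.summable]
    refine (a + b).summable.tsum_le_tsum (fun n => ?_) (a.summable.add b.summable)
    rw [← add_mul]
    exact mul_le_mul_of_nonneg_right (norm_add_le _ _) (PosWeight.pos n).le
  norm_eq_zero_iff a := by
    constructor
    · intro h
      refine ext fun n => ?_
      have h1 := a.le_norm n
      rw [h] at h1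
      have h2 : ‖a n‖ ≤ 0 := nonpos_of_mul_nonpos_left h1 (PosWeight.pos n)
      simpa using h2
    · rintro rfl
      simp [norm_def]

instance : NormedAddCommGroup (L1w w) := NormedAddCommGroup.ofCore normedCore
instance : NormedSpace ℂ (L1w w) := NormedSpace.ofCore normedCore

/-- The coefficient functional `a ↦ aₙ`. -/
def eval (n : Z4s) : L1w w →L[ℂ] ℂ :=
  LinearMap.mkContinuousOfExistsBound
    { toFun := fun a => a n
      map_add' := fun _ _ => rfl
      map_smul' := fun _ _ => rfl }
    ⟨(w n)⁻¹, fun a => by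
      have h := a.le_norm n
      have hp : 0 < w n := PosWeight.pos n
      rw [inv_mul_eq_div, le_div_iff₀ hp]
      exact h⟩

end L1w

/-- The space `ℂ × (ℓ¹_w)³` of pairs `W = (Ω, ω)`, with norm `|Ω| + ∑ₗ ‖ω⁽ˡ⁾‖`. -/
abbrev XW (w : Z4s → ℝ) [PosWeight w] := WithLp 1 (ℂ × PiLp 1 (fun _ : Fin 3 => L1w w))

/-- `𝒳 = ℂ × (ℓ¹_η)³`. -/
abbrev XSpace (η : ℝ) [Fact (1 < η)] := XW (wt η)

/-- `𝒳_{-2,-1} = ℂ × (ℓ¹_{η,-2,-1})³`. -/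
abbrev YSpace (η : ℝ) [Fact (1 < η)] := XW (wtNeg η)

section

variable {w : Z4s → ℝ} [PosWeight w]

/-- The pair `(Ω, ω)`. -/
def mkX (Ω : ℂ) (ω : Fin 3 → L1w w) : XW w := WithLp.toLp 1 (Ω, WithLp.toLp 1 ω)

@[simp] theorem mkX_fst (Ω : ℂ) (ω : Fin 3 → L1w w) : (mkX Ω ω).fst = Ω := rfl
@[simp] theorem mkX_snd (Ω : ℂ) (ω : Fin 3 → L1w w) (l : Fin 3) : (mkX Ω ω).snd l = ω l := rfl

theorem normX (W : XW w) : ‖W‖ = ‖W.fst‖ + ∑ l, ‖W.snd l‖ := by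
  rw [WithLp.prod_norm_eq_of_L1, PiLp.norm_eq_of_L1]

/-- The frequency and the Fourier coefficients of an element of `ℂ × (ℓ¹_w)³`. -/
def coeffs (W : XW w) : ℂ × (Fin 3 → Z4s → ℂ) := (W.fst, fun l n => W.snd l n)

/-- `∑ₘ Dₘ ω⁽ᵐ⁾ = 0`. -/
def IsDivFree (W : XW w) : Prop := ∀ n : Z4s, ∑ m : Fin 3, (til n.1 m : ℂ) * W.snd m n = 0

end

/-- The conjugation symmetry `γ_*` on `(ℂ³)^{ℤ⁴∖{0}}`. -/
def gammaSeq (ω : Fin 3 → Z4s → ℂ) : Fin 3 → Z4s → ℂ :=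
  fun l n => (starRingEnd ℂ) (ω l (negIdx n))

/-- The conjugation symmetry `γ_*` on `ℂ × (ℂ³)^{ℤ⁴∖{0}}`. -/
def gammaStar (Q : ℂ × (Fin 3 → Z4s → ℂ)) : ℂ × (Fin 3 → Z4s → ℂ) :=
  ((starRingEnd ℂ) Q.1, gammaSeq Q.2)

/-! ## The zero finding problem in Fourier space -/

/-- Extension of a sequence on the nonzero indices by `a₀ = 0`. -/
def ext0 (a : Z4s → ℂ) : Z4 → ℂ := fun n => if h : n ≠ 0 then a ⟨n, h⟩ else 0

/-- Componentwise extension by zero. -/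
def extV (ω : Fin 3 → Z4s → ℂ) : Fin 3 → Z4 → ℂ := fun l => ext0 (ω l)

/-- The matrix of `v ↦ ñ × v`. -/
def crossMat (n : Z4) : Matrix (Fin 3) (Fin 3) ℂ :=
  !![0, -(n 2 : ℂ), (n 1 : ℂ);
     (n 2 : ℂ), 0, -(n 0 : ℂ);
     -(n 1 : ℂ), (n 0 : ℂ), 0]

/-- The matrices `Mₙ`. -/
def Mmat (n : Z4) : Matrix (Fin 3) (Fin 3) ℂ :=
  if til n = 0 then 0 else (I / (tilSq n : ℂ)) • crossMat n

/-- `Mω = (Mₙ ωₙ)ₙ`, the Fourier coefficients of the velocity with vorticity `ω`. -/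
def Mop (ω : Fin 3 → Z4 → ℂ) : Fin 3 → Z4 → ℂ :=
  fun l n => (Mmat n).mulVec (fun m => ω m n) l

/-- Fourier coefficients `i ñ × fₙ` of `f^ω = ∇ × f`. -/
def curlSeq (f : Fin 3 → Z4 → ℂ) : Fin 3 → Z4 → ℂ :=
  fun l n => I * (crossMat n).mulVec (fun m => f m n) l

/-- `(D_m a)ₙ = n_m aₙ`. -/
def Dop (m : Fin 3) (a : Z4 → ℂ) : Z4 → ℂ := fun n => (til n m : ℂ) * a n

/-- Convolution `(a ∗ b)ₙ = ∑ₖ aₖ bₙ₋ₖ`. -/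
def conv (a b : Z4 → ℂ) : Z4 → ℂ := fun n => ∑' k, a k * b (n - k)

/-- `[(a ⋆ D̃) b]⁽ˡ⁾ = ∑ₘ a⁽ᵐ⁾ ∗ (D_m b⁽ˡ⁾)`. -/
def advect (a b : Fin 3 → Z4 → ℂ) : Fin 3 → Z4 → ℂ :=
  fun l n => ∑ m, conv (a m) (Dop m (b l)) n

/-- The nonlinear terms `Ψ(ω) = i (Mω ⋆ D̃) ω - i (ω ⋆ D̃) Mω`. -/
def Psi (ω : Fin 3 → Z4 → ℂ) : Fin 3 → Z4 → ℂ :=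
  fun l n => I * advect (Mop ω) ω l n - I * advect ω (Mop ω) l n

/-- `F_n(W) = iΩ n₄ ωₙ + Ψₙ(ω) + ν ñ² ωₙ - f^ωₙ`. -/
def Fseq (ν : ℝ) (f : Fin 3 → Z4 → ℂ) (Ω : ℂ) (ω : Fin 3 → Z4s → ℂ) : Fin 3 → Z4s → ℂ :=
  fun l n => I * Ω * (n.1 3 : ℂ) * ω l n + Psi (extV ω) l n.1
    + (ν : ℂ) * (tilSq n.1 : ℂ) * ω l n - curlSeq f l n.1

/-- The phase condition `F_☾(W) = i ∑ₗ ∑ₙ ωₙ⁽ˡ⁾ n₄ (ω̂ₙ⁽ˡ⁾)^*`. -/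
def phase (ωhat : Fin 3 → Z4s → ℂ) (ω : Fin 3 → Z4s → ℂ) : ℂ :=
  I * ∑ l, ∑' n : Z4s, ω l n * (n.1 3 : ℂ) * (starRingEnd ℂ) (ωhat l n)

/-! ### The map takes `𝒳` into `𝒳_{-2,-1}` -/

section Mapping

variable {η : ℝ} [hη : Fact (1 < η)]

theorem norm1_add_le (k j : Z4) : norm1 (k + j) ≤ norm1 k + norm1 j := by
  simp only [norm1, ← Finset.sum_add_distrib]
  exact Finset.sum_le_sum fun i _ => Int.natAbs_add_le _ _

/-- `∑ |aₙ| η^{|n|₁} < ∞` over all indices. A sequence with this property for some `η > 1` is the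
sequence of Fourier coefficients of a real-analytic periodic function, and conversely. -/
def ExpSum (η : ℝ) (a : Z4 → ℂ) : Prop := Summable fun n => ‖a n‖ * η ^ norm1 n

theorem eta_pow_pos (n : ℕ) : 0 < η ^ n := pow_pos (by linarith [hη.out]) _

theorem one_le_eta_pow (n : ℕ) : 1 ≤ η ^ n := one_le_pow₀ hη.out.le

theorem S_ext0 (a : L1w (wt η)) : ExpSum η (ext0 a) := by
  unfold ExpSum
  rw [← summable_subtype_iff_indicator (s := {n : Z4 | n ≠ 0}) |>.trans
    (Iff.of_eq (congrArg Summable (Set.indicator_eq_self.2 ?_)))]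
  · refine a.summable.congr fun n => ?_
    simp only [Function.comp, ext0, wt]
    rw [dif_pos n.2]
  · intro n hn
    by_contra h
    apply hn
    simp only [Set.mem_ofPred_eq, not_not] at h
    simp [ext0, h]

theorem S_mul {a : Z4 → ℂ} (ha : ExpSum η a) (c : Z4 → ℂ) (C : ℝ) (hc : ∀ n, ‖c n‖ ≤ C) :
    ExpSum η (fun n => c n * a n) := by
  refine Summable.of_nonneg_of_le (fun n => mul_nonneg (norm_nonneg _) (eta_pow_pos _).le)
    (fun n => ?_) (Summable.mul_left C ha)
  rw [norm_mul, mul_assoc]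
  exact mul_le_mul_of_nonneg_right (hc n) (mul_nonneg (norm_nonneg _) (eta_pow_pos _).le)

theorem S_sum {a : Fin 3 → Z4 → ℂ} (ha : ∀ m, ExpSum η (a m)) : ExpSum η (fun n => ∑ m, a m n) := by
  refine Summable.of_nonneg_of_le (fun n => mul_nonneg (norm_nonneg _) (eta_pow_pos _).le)
    (fun n => ?_) (summable_sum (s := Finset.univ) fun m _ => ha m)
  rw [← Finset.sum_mul]
  exact mul_le_mul_of_nonneg_right (norm_sum_le _ _) (eta_pow_pos _).le

theorem S_norm {a : Z4 → ℂ} (ha : ExpSum η a) : Summable fun n => ‖a n‖ :=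
  Summable.of_nonneg_of_le (fun _ => norm_nonneg _)
    (fun _ => le_mul_of_one_le_right (norm_nonneg _) (one_le_eta_pow _)) ha

theorem summable_conv {a b : Z4 → ℂ} (ha : ExpSum η a) (hb : ExpSum η b) (n : Z4) :
    Summable fun k => a k * b (n - k) := by
  have hb1 := S_norm hb
  refine Summable.of_norm_bounded (g := fun k => ‖a k‖ * ∑' j, ‖b j‖)
    ((S_norm ha).mul_right _) fun k => ?_
  rw [norm_mul]
  exact mul_le_mul_of_nonneg_left (hb1.le_tsum (n - k) fun _ _ => norm_nonneg _) (norm_nonneg _)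

/-- The change of indices `(n, k) ↦ (k, n - k)`. -/
def shiftEquiv : Z4 × Z4 ≃ Z4 × Z4 where
  toFun q := (q.2, q.1 - q.2)
  invFun q := (q.1 + q.2, q.1)
  left_inv q := by simp
  right_inv q := by simp

theorem summable_shift {α β : Z4 → ℝ} (hα : Summable α) (hβ : Summable β) (h0 : 0 ≤ α)
    (h1 : 0 ≤ β) : Summable fun q : Z4 × Z4 => α q.2 * β (q.1 - q.2) :=
  (shiftEquiv.summable_iff (f := fun q : Z4 × Z4 => α q.1 * β q.2)).2
    (Summable.mul_of_nonneg hα hβ h0 h1)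

theorem S_conv {a b : Z4 → ℂ} (ha : ExpSum η a) (hb : ExpSum η b) : ExpSum η (conv a b) := by
  have hpos : ∀ c : Z4 → ℂ, 0 ≤ fun n => ‖c n‖ * η ^ norm1 n := fun c n =>
    mul_nonneg (norm_nonneg _) (eta_pow_pos _).le
  have hg := summable_shift ha hb (hpos a) (hpos b)
  refine Summable.of_nonneg_of_le (hpos (conv a b)) (fun n => ?_) hg.prod
  have hfib := hg.prod_factor n
  have hnorm : Summable fun k => ‖a k * b (n - k)‖ := (summable_conv ha hb n).norm
  calc ‖conv a b n‖ * η ^ norm1 n ≤ (∑' k, ‖a k * b (n - k)‖) * η ^ norm1 n :=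
        mul_le_mul_of_nonneg_right (norm_tsum_le_tsum_norm hnorm) (eta_pow_pos _).le
    _ = ∑' k, ‖a k * b (n - k)‖ * η ^ norm1 n := tsum_mul_right.symm
    _ ≤ ∑' k, (‖a k‖ * η ^ norm1 k) * (‖b (n - k)‖ * η ^ norm1 (n - k)) := by
        refine (hnorm.mul_right _).tsum_le_tsum (fun k => ?_) hfib
        have h1 : η ^ norm1 n ≤ η ^ norm1 k * η ^ norm1 (n - k) := by
          rw [← pow_add]
          refine pow_le_pow_right₀ hη.out.le ?_
          have := norm1_add_le k (n - k)
          rwa [add_sub_cancel] at this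
        rw [norm_mul]
        calc ‖a k‖ * ‖b (n - k)‖ * η ^ norm1 n
            ≤ ‖a k‖ * ‖b (n - k)‖ * (η ^ norm1 k * η ^ norm1 (n - k)) :=
              mul_le_mul_of_nonneg_left h1 (mul_nonneg (norm_nonneg _) (norm_nonneg _))
          _ = _ := by ring

theorem abs_til_mul_le (n : Z4) (i j : Fin 3) : |til n i * til n j| ≤ tilSq n := by
  have key : ∀ x y : ℤ, |x * y| ≤ x ^ 2 ∨ |x * y| ≤ y ^ 2 := fun x y => by
    rw [abs_mul, ← sq_abs x, ← sq_abs y]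
    rcases le_total |x| |y| with h | h
    · right; nlinarith [abs_nonneg x, abs_nonneg y]
    · left; nlinarith [abs_nonneg x, abs_nonneg y]
  have hle : ∀ i, til n i ^ 2 ≤ tilSq n := fun i =>
    Finset.single_le_sum (f := fun j => til n j ^ 2) (fun _ _ => sq_nonneg _) (Finset.mem_univ i)
  rcases key (til n i) (til n j) with h | h
  · exact h.trans (hle i)
  · exact h.trans (hle j)

theorem crossMat_entry (n : Z4) (l m : Fin 3) :
    ∃ j : Fin 3, ∃ s : ℤ, |s| ≤ 1 ∧ crossMat n l m = ((s * til n j : ℤ) : ℂ) := by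
  fin_cases l <;> fin_cases m
  · exact ⟨0, 0, by simp, by simp [crossMat]⟩
  · exact ⟨2, -1, by simp, by simp [crossMat, til]⟩
  · exact ⟨1, 1, by simp, by simp [crossMat, til]⟩
  · exact ⟨2, 1, by simp, by simp [crossMat, til]⟩
  · exact ⟨0, 0, by simp, by simp [crossMat]⟩
  · exact ⟨0, -1, by simp, by simp [crossMat, til]⟩
  · exact ⟨1, -1, by simp, by simp [crossMat, til]⟩
  · exact ⟨0, 1, by simp, by simp [crossMat, til]⟩
  · exact ⟨0, 0, by simp, by simp [crossMat]⟩

theorem tilSq_pos {n : Z4} (h : til n ≠ 0) : 0 < tilSq n := by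
  obtain ⟨j, hj⟩ := Function.ne_iff.1 h
  refine lt_of_lt_of_le (b := til n j ^ 2) (by simp only [Pi.zero_apply] at hj; positivity) ?_
  exact Finset.single_le_sum (f := fun j => til n j ^ 2) (fun _ _ => sq_nonneg _)
    (Finset.mem_univ j)

theorem norm_til_Mmat_le (n : Z4) (p l m : Fin 3) : ‖(til n p : ℂ) * Mmat n l m‖ ≤ 1 := by
  by_cases h : til n = 0
  · simp [Mmat, h]
  · obtain ⟨j, s, hs, he⟩ := crossMat_entry n l m
    have hp := tilSq_pos h
    have hpR : (0 : ℝ) < (tilSq n : ℝ) := by exact_mod_cast hp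
    simp only [Mmat, h, if_false, Matrix.smul_apply, smul_eq_mul, he]
    have h1 : |s * (til n p * til n j)| ≤ tilSq n := by
      rw [abs_mul]
      have := abs_til_mul_le n p j
      nlinarith [abs_nonneg s, abs_nonneg (til n p * til n j)]
    have h2 : (til n p : ℂ) * (I / (tilSq n : ℂ) * ((s * til n j : ℤ) : ℂ))
        = I * (((s * (til n p * til n j) : ℤ) : ℂ) / (tilSq n : ℂ)) := by
      push_cast; ring
    rw [h2, norm_mul, norm_I, one_mul, norm_div, Complex.norm_intCast, Complex.norm_intCast,
      abs_of_pos hpR, div_le_one hpR]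
    exact_mod_cast h1

theorem norm_Mmat_le (n : Z4) (l m : Fin 3) : ‖Mmat n l m‖ ≤ 1 := by
  by_cases h : til n = 0
  · simp [Mmat, h]
  · obtain ⟨p, hp⟩ := Function.ne_iff.1 h
    have h1 := norm_til_Mmat_le n p l m
    rw [norm_mul, Complex.norm_intCast] at h1
    have h2 : (1 : ℝ) ≤ |(til n p : ℝ)| := by exact_mod_cast Int.one_le_abs hp
    nlinarith [norm_nonneg (Mmat n l m)]

theorem S_Mop {ω : Fin 3 → Z4 → ℂ} (h : ∀ l, ExpSum η (ω l)) (l : Fin 3) : ExpSum η (Mop ω l) := by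
  have : Mop ω l = fun n => ∑ m, Mmat n l m * ω m n := rfl
  rw [this]
  exact S_sum fun m => S_mul (h m) _ 1 fun n => norm_Mmat_le n l m

theorem S_Dop_Mop {ω : Fin 3 → Z4 → ℂ} (h : ∀ l, ExpSum η (ω l)) (p l : Fin 3) :
    ExpSum η (Dop p (Mop ω l)) := by
  have : Dop p (Mop ω l) = fun n => ∑ m, ((til n p : ℂ) * Mmat n l m) * ω m n := by
    funext n
    show (til n p : ℂ) * ∑ m, Mmat n l m * ω m n = _
    rw [Finset.mul_sum]
    simp [mul_assoc]
  rw [this]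
  exact S_sum fun m => S_mul (h m) _ 1 fun n => norm_til_Mmat_le n p l m

/-- `∇ · Mω = 0`. -/
theorem div_Mop (ω : Fin 3 → Z4 → ℂ) (n : Z4) : ∑ m, (til n m : ℂ) * Mop ω m n = 0 := by
  by_cases h : til n = 0
  · simp [h]
  · simp only [Mop, Mmat, h, if_false, Matrix.smul_mulVec, Pi.smul_apply, smul_eq_mul]
    simp [Fin.sum_univ_three, crossMat, Matrix.mulVec, dotProduct, til]
    ring

/-- The derivative can be taken out of the convolution, as `Mω` is divergence free. -/
theorem advect_Mop {ω : Fin 3 → Z4 → ℂ} (h : ∀ l, ExpSum η (ω l)) (l : Fin 3) (n : Z4) :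
    advect (Mop ω) ω l n = ∑ m, (til n m : ℂ) * conv (Mop ω m) (ω l) n := by
  have s1 : ∀ m, Summable fun k => (til n m : ℂ) * (Mop ω m k * ω l (n - k)) := fun m =>
    (summable_conv (S_Mop h m) (h l) n).mul_left _
  have s2 : ∀ m, Summable fun k => Dop m (Mop ω m) k * ω l (n - k) := fun m =>
    summable_conv (S_Dop_Mop h m m) (h l) n
  have e1 : ∀ m, conv (Mop ω m) (Dop m (ω l)) n
      = (til n m : ℂ) * conv (Mop ω m) (ω l) n - ∑' k, Dop m (Mop ω m) k * ω l (n - k) := by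
    intro m
    unfold conv
    rw [← tsum_mul_left, ← (s1 m).tsum_sub (s2 m)]
    refine tsum_congr fun k => ?_
    simp only [Dop, til, Pi.sub_apply]
    push_cast
    ring
  have e2 : ∑ m, ∑' k, Dop m (Mop ω m) k * ω l (n - k) = 0 := by
    rw [← Summable.tsum_finsetSum fun m _ => s2 m]
    have : ∀ k, ∑ m, Dop m (Mop ω m) k * ω l (n - k) = 0 := fun k => by
      rw [← Finset.sum_mul]
      simp only [Dop]
      rw [div_Mop, zero_mul]
    simp [this]
  unfold advect
  rw [Finset.sum_congr rfl fun m _ => e1 m, Finset.sum_sub_distrib, e2, sub_zero]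

theorem natAbs_til_le_max (n : Z4) (j : Fin 3) :
    (til n j).natAbs ≤ max (tilInf n ^ 2) (n 3).natAbs := by
  refine ((natAbs_til_le n j).trans ?_).trans (le_max_left _ _)
  exact Nat.le_self_pow two_ne_zero _

theorem tilSq_le_max (n : Z4) : (tilSq n : ℝ) ≤ 3 * (max (tilInf n ^ 2) (n 3).natAbs : ℕ) := by
  have h : ∀ j, til n j ^ 2 ≤ ((max (tilInf n ^ 2) (n 3).natAbs : ℕ) : ℤ) := fun j => by
    have h1 : (til n j).natAbs ^ 2 ≤ max (tilInf n ^ 2) (n 3).natAbs :=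
      (Nat.pow_le_pow_left (natAbs_til_le n j) 2).trans (le_max_left _ _)
    have h2 : til n j ^ 2 = (((til n j).natAbs ^ 2 : ℕ) : ℤ) := by
      push_cast; rw [sq_abs]
    rw [h2]
    exact_mod_cast h1
  have : tilSq n ≤ 3 * ((max (tilInf n ^ 2) (n 3).natAbs : ℕ) : ℤ) := by
    simp only [tilSq, Fin.sum_univ_three]
    linarith [h 0, h 1, h 2]
  have h3 : ((tilSq n : ℤ) : ℝ) ≤ ((3 * ((max (tilInf n ^ 2) (n 3).natAbs : ℕ) : ℤ) : ℤ) : ℝ) :=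
    Int.cast_le.2 this
  rwa [Int.cast_mul, Int.cast_natCast] at h3

/-- A multiplier of size at most `C max(|ñ|_∞², |n₄|)` maps `ℓ¹_η` to `ℓ¹_{η,-2,-1}`. -/
theorem mul_wtNeg_le {c : ℂ} {C : ℝ} (n : Z4s)
    (hc : ‖c‖ ≤ C * (max (tilInf n.1 ^ 2) (n.1 3).natAbs : ℕ)) :
    ‖c‖ * wtNeg η n ≤ C * wt η n := by
  have hp : (0 : ℝ) < (max (tilInf n.1 ^ 2) (n.1 3).natAbs : ℕ) := by
    exact_mod_cast one_le_max n
  unfold wtNeg wt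
  rw [mul_div_assoc', div_le_iff₀ hp]
  calc _ ≤ (C * (max (tilInf n.1 ^ 2) (n.1 3).natAbs : ℕ)) * η ^ norm1 n.1 :=
        mul_le_mul_of_nonneg_right hc (eta_pow_pos _).le
    _ = _ := by ring

theorem memNeg_mul {a : Z4s → ℂ} (ha : Summable fun n => ‖a n‖ * wt η n) (c : Z4s → ℂ) (C : ℝ)
    (hc : ∀ n, ‖c n‖ ≤ C * (max (tilInf n.1 ^ 2) (n.1 3).natAbs : ℕ)) :
    Summable fun n => ‖c n * a n‖ * wtNeg η n := by
  refine Summable.of_nonneg_of_le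
    (fun n => mul_nonneg (norm_nonneg _) (PosWeight.pos n).le) (fun n => ?_)
    (Summable.mul_left C ha)
  rw [norm_mul]
  calc ‖c n‖ * ‖a n‖ * wtNeg η n = ‖a n‖ * (‖c n‖ * wtNeg η n) := by ring
    _ ≤ ‖a n‖ * (C * wt η n) :=
      mul_le_mul_of_nonneg_left (mul_wtNeg_le n (hc n)) (norm_nonneg _)
    _ = _ := by ring

theorem S_restrict {a : Z4 → ℂ} (ha : ExpSum η a) : Summable fun n : Z4s => ‖a n.1‖ * wt η n :=
  ha.comp_injective Subtype.val_injective

theorem norm_n4_le (n : Z4s) :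
    ‖((n.1 3 : ℤ) : ℂ)‖ ≤ 1 * (max (tilInf n.1 ^ 2) (n.1 3).natAbs : ℕ) := by
  rw [Complex.norm_intCast, one_mul, ← Int.cast_abs, Int.abs_eq_natAbs, Int.cast_natCast]
  exact_mod_cast le_max_right _ _

theorem norm_symbol_le (ν : ℝ) (Ω : ℂ) (n : Z4s) :
    ‖(ν : ℂ) * (tilSq n.1 : ℂ) + I * Ω * (n.1 3 : ℂ)‖
      ≤ (3 * |ν| + ‖Ω‖) * (max (tilInf n.1 ^ 2) (n.1 3).natAbs : ℕ) := by
  have h0 : (0 : ℤ) ≤ tilSq n.1 := Finset.sum_nonneg fun _ _ => sq_nonneg _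
  have h1 : ‖(ν : ℂ) * (tilSq n.1 : ℂ)‖
      ≤ 3 * |ν| * (max (tilInf n.1 ^ 2) (n.1 3).natAbs : ℕ) := by
    rw [norm_mul, Complex.norm_real, Complex.norm_intCast, Real.norm_eq_abs,
      abs_of_nonneg (show (0 : ℝ) ≤ (tilSq n.1 : ℝ) by exact_mod_cast h0)]
    calc |ν| * (tilSq n.1 : ℝ) ≤ |ν| * (3 * (max (tilInf n.1 ^ 2) (n.1 3).natAbs : ℕ)) :=
          mul_le_mul_of_nonneg_left (tilSq_le_max n.1) (abs_nonneg _)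
      _ = _ := by ring
  have h2 : ‖I * Ω * (n.1 3 : ℂ)‖ ≤ ‖Ω‖ * (max (tilInf n.1 ^ 2) (n.1 3).natAbs : ℕ) := by
    rw [norm_mul, norm_mul, norm_I, one_mul]
    refine mul_le_mul_of_nonneg_left ?_ (norm_nonneg _)
    simpa only [one_mul] using norm_n4_le n
  calc _ ≤ _ := norm_add_le _ _
    _ ≤ _ := add_le_add h1 h2
    _ = _ := by ring

theorem memNeg_add {a b : Z4s → ℂ} (ha : Summable fun n => ‖a n‖ * wtNeg η n)
    (hb : Summable fun n => ‖b n‖ * wtNeg η n) : Summable fun n => ‖a n + b n‖ * wtNeg η n :=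
  (l1Submodule (wtNeg η)).add_mem ha hb

theorem memNeg_sub {a b : Z4s → ℂ} (ha : Summable fun n => ‖a n‖ * wtNeg η n)
    (hb : Summable fun n => ‖b n‖ * wtNeg η n) : Summable fun n => ‖a n - b n‖ * wtNeg η n :=
  (l1Submodule (wtNeg η)).sub_mem ha hb

theorem memNeg_Psi (ω : Fin 3 → L1w (wt η)) (l : Fin 3) :
    Summable fun n : Z4s => ‖Psi (extV fun m => ω m) l n.1‖ * wtNeg η n := by
  set v : Fin 3 → Z4 → ℂ := extV fun m => ω m with hv
  have hS : ∀ m, ExpSum η (v m) := fun m => S_ext0 (ω m)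
  refine memNeg_sub (a := fun n : Z4s => I * advect (Mop v) v l n.1)
    (b := fun n : Z4s => I * advect v (Mop v) l n.1) ?_ ?_
  · have : ∀ m : Fin 3, Summable fun n : Z4s =>
        ‖(I * (til n.1 m : ℂ)) * conv (Mop v m) (v l) n.1‖ * wtNeg η n := fun m =>
      memNeg_mul (S_restrict (S_conv (S_Mop hS m) (hS l))) (fun n => I * (til n.1 m : ℂ)) 1
        fun n => by
          rw [norm_mul, norm_I, one_mul, one_mul, Complex.norm_intCast, ← Int.cast_abs,
            Int.abs_eq_natAbs, Int.cast_natCast]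
          exact_mod_cast natAbs_til_le_max n.1 m
    have h3 := (l1Submodule (wtNeg η)).sum_mem (t := Finset.univ)
      (f := fun m : Fin 3 => fun n : Z4s => (I * (til n.1 m : ℂ)) * conv (Mop v m) (v l) n.1)
      fun m _ => this m
    refine Summable.congr h3 fun n => ?_
    rw [advect_Mop hS, Finset.sum_apply, Finset.mul_sum]
    simp [mul_assoc]
  · refine memNeg_mul (S_restrict (a := advect v (Mop v) l) ?_) (fun _ => I) 1 fun n => ?_
    · exact S_sum fun m => S_conv (hS m) (S_Dop_Mop hS m l)
    · rw [norm_I, one_mul]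
      exact_mod_cast one_le_max n

/-- `f^ω ∈ (ℓ¹_{η,-2,-1})³`. -/
def CurlMem (η : ℝ) (f : Fin 3 → Z4 → ℂ) : Prop :=
  ∀ l, Summable fun n : Z4s => ‖curlSeq f l n.1‖ * wtNeg η n

theorem memNeg_Fseq (ν : ℝ) {f : Fin 3 → Z4 → ℂ} (hf : CurlMem η f) (Ω : ℂ)
    (ω : Fin 3 → L1w (wt η)) (l : Fin 3) :
    Summable fun n : Z4s => ‖Fseq ν f Ω (fun m => ω m) l n‖ * wtNeg η n := by
  have h1 := memNeg_mul (ω l).summable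
    (fun n => (ν : ℂ) * (tilSq n.1 : ℂ) + I * Ω * (n.1 3 : ℂ)) _ (norm_symbol_le ν Ω)
  refine (memNeg_sub (memNeg_add h1 (memNeg_Psi ω l)) (hf l)).congr fun n => ?_
  congr 2
  simp only [Fseq]
  ring

end Mapping

/-- The data of the zero finding problem: viscosity, Fourier coefficients of the forcing and of the
reference orbit `ω̂` of the phase condition. The last two fields say exactly that the
resulting map is defined on `𝒳` with values in `𝒳_{-2,-1}`: `f^ω` lies in
`(ℓ¹_{η,-2,-1})³`, and the phase condition is a bounded functional on `(ℓ¹_η)³`. -/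
structure Problem (η : ℝ) where
  ν : ℝ
  ν_pos : 0 < ν
  f : Fin 3 → Z4 → ℂ
  ωhat : Fin 3 → Z4s → ℂ
  curl_mem : CurlMem η f
  phase_bdd : ∃ C : ℝ, ∀ l n, |(n.1 3 : ℝ)| * ‖ωhat l n‖ ≤ C * wt η n

/-- The map `𝓕 = (F_☾, (F_n)) : 𝒳 → 𝒳_{-2,-1}`. -/
def calF {η : ℝ} [Fact (1 < η)] (P : Problem η) (W : XSpace η) : YSpace η :=
  mkX (phase P.ωhat fun l => W.snd l) fun l =>
    L1w.mk (Fseq P.ν P.f W.fst (fun m => W.snd m) l)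
      (memNeg_Fseq P.ν P.curl_mem W.fst (fun m => W.snd m) l)

/-! ## The operators `Â` and `A` -/

/-- The operator `(Ω, ω) ↦ (c Ω, (dₙ ωₙ)ₙ)` between weighted spaces. -/
def diagOp {w w' : Z4s → ℝ} [PosWeight w] [PosWeight w'] (c : ℂ) (d : Z4s → ℂ)
    (h : ∃ C : ℝ, ∀ n, ‖d n‖ * w' n ≤ C * w n) : XW w →L[ℂ] XW w' :=
  have hmem : ∀ a : L1w w, Summable fun n => ‖d n * a n‖ * w' n := fun a => by
    obtain ⟨C, hC⟩ := h
    refine Summable.of_nonneg_of_le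
      (fun n => mul_nonneg (norm_nonneg _) (PosWeight.pos n).le) (fun n => ?_)
      (Summable.mul_left C a.summable)
    rw [norm_mul]
    nlinarith [mul_le_mul_of_nonneg_left (hC n) (norm_nonneg (a n))]
  LinearMap.mkContinuousOfExistsBound
    { toFun := fun W => mkX (c * W.fst) fun l => L1w.mk (fun n => d n * W.snd l n) (hmem (W.snd l))
      map_add' := fun W V => by
        refine WithLp.ofLp_injective _ (Prod.ext (mul_add _ _ _) (PiLp.ext fun l => ?_))
        exact L1w.ext fun n => mul_add _ _ _
      map_smul' := fun s W => by
        refine WithLp.ofLp_injective _ (Prod.ext (mul_left_comm _ _ _) (PiLp.ext fun l => ?_))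
        exact L1w.ext fun n => mul_left_comm _ _ _ }
    (by
      obtain ⟨C, hC⟩ := h
      refine ⟨max ‖c‖ C, fun W => ?_⟩
      show ‖mkX (c * W.fst) fun l => L1w.mk (fun n => d n * W.snd l n) (hmem (W.snd l))‖ ≤ _
      rw [normX, normX, mul_add, Finset.mul_sum]
      refine add_le_add ?_ (Finset.sum_le_sum fun l _ => ?_)
      · rw [mkX_fst, norm_mul]
        exact mul_le_mul_of_nonneg_right (le_max_left _ _) (norm_nonneg _)
      · rw [mkX_snd, L1w.norm_def, L1w.norm_def, ← tsum_mul_left]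
        refine (hmem (W.snd l)).tsum_le_tsum (fun n => ?_)
          ((W.snd l).summable.mul_left _)
        rw [L1w.mk_apply, norm_mul]
        have h1 : ‖d n‖ * w' n ≤ max ‖c‖ C * w n := (hC n).trans
          (mul_le_mul_of_nonneg_right (le_max_right _ _) (PosWeight.pos n).le)
        nlinarith [mul_le_mul_of_nonneg_left h1 (norm_nonneg (W.snd l n))])

/-- The symbol `ν ñ² + i Ω̄ n₄`. -/
def symbol (ν : ℝ) (Ω : ℂ) (n : Z4s) : ℂ := (ν : ℂ) * (tilSq n.1 : ℂ) + I * Ω * (n.1 3 : ℂ)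

/-- `𝓔(N) = {n ≠ 0 : μ(n) ≤ N}` with `μ(n) = |ν ñ² + i Ω̄ n₄|`. -/
def calE (ν : ℝ) (Ω : ℂ) (N : ℕ) : Set Z4s := {n | ‖symbol ν Ω n‖ ≤ N}

open Classical in
/-- The projection `Π†` onto the modes in a set `E` of indices (it keeps `Ω`). -/
def proj {w : Z4s → ℝ} [PosWeight w] (E : Set Z4s) : XW w →L[ℂ] XW w :=
  diagOp 1 (fun n => if n ∈ E then 1 else 0) ⟨1, fun n => by
    have := (PosWeight.pos n : 0 < w n).le
    split_ifs <;> simp [this]⟩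

open Classical in
/-- The tail of `Â`: `(Ω, ω) ↦ (0, ((ν ñ² + i Ω̄ n₄) ωₙ)_{n ∉ 𝓔(N)})`. -/
def tailHat (η : ℝ) [Fact (1 < η)] (ν : ℝ) (Ω : ℂ) (N : ℕ) : XSpace η →L[ℂ] YSpace η :=
  diagOp 0 (fun n => if n ∈ calE ν Ω N then 0 else symbol ν Ω n)
    ⟨3 * |ν| + ‖Ω‖, fun n => by
      split_ifs
      · have h1 : 0 < wt η n := PosWeight.pos n
        rw [norm_zero, zero_mul]
        positivity
      · exact mul_wtNeg_le n (norm_symbol_le ν Ω n)⟩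

/-- `Â Π†W = Π† D𝓕(W̄) Π†W`, and `Â` is diagonal with entries `ν ñ² + i Ω̄ n₄` on the other
modes. -/
def Ahat {η : ℝ} [Fact (1 < η)] (P : Problem η) (Wbar : XSpace η) (N : ℕ) :
    XSpace η →L[ℂ] YSpace η :=
  proj (calE P.ν Wbar.fst N) ∘L fderiv ℂ (calF P) Wbar ∘L proj (calE P.ν Wbar.fst N)
    + tailHat η P.ν Wbar.fst N

theorem max_le_symbol {ν : ℝ} (hν : 0 < ν) {Ω : ℂ} (hΩ : Ω.re ≠ 0) :
    ∃ C : ℝ, 0 < C ∧ ∀ n : Z4s,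
      ((max (tilInf n.1 ^ 2) (n.1 3).natAbs : ℕ) : ℝ) ≤ C * ‖symbol ν Ω n‖ := by
  have hr : 0 < |Ω.re| := abs_pos.2 hΩ
  refine ⟨1 / |Ω.re| + (1 + |Ω.im| / |Ω.re|) / ν, by positivity, fun n => ?_⟩
  set s := ‖symbol ν Ω n‖ with hs
  have hs0 : 0 ≤ s := norm_nonneg _
  have him : |Ω.re| * |(n.1 3 : ℝ)| ≤ s := by
    have := Complex.abs_im_le_norm (symbol ν Ω n)
    rw [← abs_mul]
    simpa [hs, symbol] using this
  have hre : |ν * (tilSq n.1 : ℝ) - Ω.im * (n.1 3 : ℝ)| ≤ s := by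
    have := Complex.abs_re_le_norm (symbol ν Ω n)
    simpa [hs, symbol, sub_eq_add_neg] using this
  have h4 : |(n.1 3 : ℝ)| ≤ s / |Ω.re| := by
    rw [le_div_iff₀ hr]; linarith
  have ht : (tilSq n.1 : ℝ) ≤ (1 + |Ω.im| / |Ω.re|) / ν * s := by
    have h1 : ν * (tilSq n.1 : ℝ) ≤ s + |Ω.im| * |(n.1 3 : ℝ)| := by
      have := le_abs_self (Ω.im * (n.1 3 : ℝ))
      rw [abs_mul] at this
      linarith [le_abs_self (ν * (tilSq n.1 : ℝ) - Ω.im * (n.1 3 : ℝ))]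
    have h2 : |Ω.im| * |(n.1 3 : ℝ)| ≤ |Ω.im| * (s / |Ω.re|) :=
      mul_le_mul_of_nonneg_left h4 (abs_nonneg _)
    rw [div_mul_eq_mul_div, le_div_iff₀ hν]
    calc (tilSq n.1 : ℝ) * ν ≤ s + |Ω.im| * (s / |Ω.re|) := by linarith
      _ = _ := by ring
  have hinf : ((tilInf n.1 ^ 2 : ℕ) : ℝ) ≤ (tilSq n.1 : ℝ) := by
    obtain ⟨j, _, hj⟩ := Finset.exists_mem_eq_sup Finset.univ Finset.univ_nonempty
      fun j => (til n.1 j).natAbs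
    have h1 : tilInf n.1 = (til n.1 j).natAbs := hj
    have h2 : til n.1 j ^ 2 ≤ tilSq n.1 :=
      Finset.single_le_sum (f := fun j => til n.1 j ^ 2) (fun _ _ => sq_nonneg _)
        (Finset.mem_univ j)
    have h3 : ((tilInf n.1 ^ 2 : ℕ) : ℤ) = til n.1 j ^ 2 := by
      rw [h1]; push_cast; rw [sq_abs]
    have h5 : ((tilInf n.1 ^ 2 : ℕ) : ℤ) ≤ tilSq n.1 := h3 ▸ h2
    exact_mod_cast h5
  have hA : 0 ≤ (1 + |Ω.im| / |Ω.re|) / ν * s := by positivity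
  have hB : 0 ≤ s / |Ω.re| := by positivity
  have h4n : (((n.1 3).natAbs : ℕ) : ℝ) = |(n.1 3 : ℝ)| := by
    rw [Nat.cast_natAbs, Int.cast_abs]
  have e : (1 / |Ω.re| + (1 + |Ω.im| / |Ω.re|) / ν) * s
      = s / |Ω.re| + (1 + |Ω.im| / |Ω.re|) / ν * s := by ring
  rw [Nat.cast_max, e]
  refine max_le ?_ ?_
  · linarith
  · rw [h4n]; linarith

theorem calE_finite {ν : ℝ} (hν : 0 < ν) {Ω : ℂ} (hΩ : Ω.re ≠ 0) (N : ℕ) :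
    (calE ν Ω N).Finite := by
  obtain ⟨C, hC, h⟩ := max_le_symbol hν hΩ
  obtain ⟨K, hK⟩ := exists_nat_ge (C * N)
  refine Set.Finite.of_finite_image (f := Subtype.val) ?_ Subtype.val_injective.injOn
  refine (Set.finite_Icc (fun _ : Fin 4 => -(K : ℤ)) (fun _ => (K : ℤ))).subset ?_
  rintro _ ⟨n, hn, rfl⟩
  have h1 : max (tilInf n.1 ^ 2) (n.1 3).natAbs ≤ K := by
    have : ((max (tilInf n.1 ^ 2) (n.1 3).natAbs : ℕ) : ℝ) ≤ K :=
      ((h n).trans (mul_le_mul_of_nonneg_left hn hC.le)).trans hK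
    exact_mod_cast this
  have h2 : ∀ j, (n.1 j).natAbs ≤ K := fun j => by
    refine Fin.lastCases ?_ (fun i => ?_) j
    · exact (le_max_right _ _).trans h1
    · exact (natAbs_til_le_max n.1 i).trans h1
  constructor <;> intro j <;> have := h2 j <;> simp only <;> omega

open Classical in
/-- The tail of `A`: `(Ω, ω) ↦ (0, (λₙ ωₙ)_{n ∉ 𝓔(N)})` with `λₙ = 1 / (ν ñ² + i Ω̄ n₄)`. -/
def tailA (η : ℝ) [Fact (1 < η)] {ν : ℝ} (hν : 0 < ν) {Ω : ℂ} (hΩ : Ω.re ≠ 0) (N : ℕ) :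
    YSpace η →L[ℂ] XSpace η :=
  diagOp 0 (fun n => if n ∈ calE ν Ω N then 0 else 1 / symbol ν Ω n) (by
    obtain ⟨C, hC, h⟩ := max_le_symbol hν hΩ
    refine ⟨C, fun n => ?_⟩
    have hw : 0 < wtNeg η n := PosWeight.pos n
    split_ifs with hn
    · rw [norm_zero, zero_mul]; positivity
    · have hp : (0 : ℝ) < (max (tilInf n.1 ^ 2) (n.1 3).natAbs : ℕ) := by
        exact_mod_cast one_le_max n
      have hs : 0 < ‖symbol ν Ω n‖ := by
        by_contra h0
        have h1 := h n
        have h2 : ‖symbol ν Ω n‖ = 0 := le_antisymm (not_lt.1 h0) (norm_nonneg _)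
        rw [h2, mul_zero] at h1
        linarith
      have e : (0 : ℝ) ≤ η ^ norm1 n.1 := (eta_pow_pos _).le
      rw [norm_div, norm_one, wt, wtNeg, one_div, inv_mul_eq_div, mul_div_assoc',
        div_le_div_iff₀ hs hp]
      nlinarith [mul_le_mul_of_nonneg_left (h n) e])

/-- Coordinates of the finite dimensional space `Π†𝒳`: the frequency and the modes in `E`. -/
abbrev Coord (E : Set Z4s) := ℂ × (E → Fin 3 → ℂ)

/-- The coordinates of `Π†W`. -/
def restr {w : Z4s → ℝ} [PosWeight w] (E : Set Z4s) : XW w →L[ℂ] Coord E :=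
  ContinuousLinearMap.prod (WithLp.fstL 1 ℂ ℂ (PiLp 1 fun _ : Fin 3 => L1w w))
    (ContinuousLinearMap.pi fun n : E => ContinuousLinearMap.pi fun l : Fin 3 =>
      L1w.eval n.1 ∘L PiLp.proj 1 (𝕜 := ℂ) (fun _ : Fin 3 => L1w w) l ∘L
        WithLp.sndL 1 ℂ ℂ (PiLp 1 fun _ : Fin 3 => L1w w))

open Classical in
/-- Extension by zero: the element of `Π†𝒳` with given coordinates. -/
def inj {w : Z4s → ℝ} [PosWeight w] {E : Set Z4s} (hE : E.Finite) : Coord E →ₗ[ℂ] XW w where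
  toFun v := mkX v.1 fun l => L1w.mk (fun n => if h : n ∈ E then v.2 ⟨n, h⟩ l else 0) (by
    refine summable_of_ne_finset_zero (s := hE.toFinset) fun n hn => ?_
    have : n ∉ E := by simpa using hn
    simp [this])
  map_add' v v' := by
    refine WithLp.ofLp_injective _ (Prod.ext rfl (PiLp.ext fun l => L1w.ext fun n => ?_))
    show (dite _ _ _ : ℂ) = (dite _ _ _ : ℂ) + (dite _ _ _ : ℂ)
    split_ifs <;> simp
  map_smul' c v := by
    refine WithLp.ofLp_injective _ (Prod.ext rfl (PiLp.ext fun l => L1w.ext fun n => ?_))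
    show (dite _ _ _ : ℂ) = c * (dite _ _ _ : ℂ)
    split_ifs <;> simp

/-- The operator `A`: a matrix `B = A^{(N†)}` on the finitely many coordinates of `Π†W`, and
diagonal with entries `λₙ` on the other modes. -/
def Aop {η : ℝ} [Fact (1 < η)] {ν : ℝ} (hν : 0 < ν) {Ω : ℂ} (hΩ : Ω.re ≠ 0) (N : ℕ)
    (B : Coord (calE ν Ω N) →ₗ[ℂ] Coord (calE ν Ω N)) : YSpace η →L[ℂ] XSpace η :=
  have hE : (calE ν Ω N).Finite := calE_finite hν hΩ N
  haveI : Finite (calE ν Ω N) := hE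
  LinearMap.toContinuousLinearMap (inj hE ∘ₗ B) ∘L restr (calE ν Ω N) + tailA η hν hΩ N

/-! ## Navier–Stokes equations in physical space -/

/-- The Fourier mode `e^{i(ñ·x + n₄ Ω t)}`. -/
def mode (Ω : ℝ) (n : Z4) (x : Fin 3 → ℝ) (t : ℝ) : ℂ :=
  exp (I * (((∑ j, (til n j : ℝ) * x j) + (n 3 : ℝ) * Ω * t : ℝ) : ℂ))

/-- The real vector field `v` is the sum of the Fourier series with coefficients `a`. -/
def HasFourier (Ω : ℝ) (a : Fin 3 → Z4 → ℂ) (v : (Fin 3 → ℝ) → ℝ → Fin 3 → ℝ) : Prop :=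
  ∀ x t l, HasSum (fun n => a l n * mode Ω n x t) ((v x t l : ℝ) : ℂ)

/-- The partial derivative in the direction `x_j`. -/
def pd (j : Fin 3) (g : (Fin 3 → ℝ) → ℝ) (x : Fin 3 → ℝ) : ℝ := fderiv ℝ g x (Pi.single j 1)

/-- `(u, p)` satisfies
`∂ₜu + (u·∇)u - νΔu + ∇p = f`, `∇·u = 0` at every point of `ℝ³ × ℝ`. -/
def SolvesNS (ν : ℝ) (f u : (Fin 3 → ℝ) → ℝ → Fin 3 → ℝ) (p : (Fin 3 → ℝ) → ℝ → ℝ) : Prop :=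
  ∀ x t,
    (∀ l, deriv (fun s => u x s l) t + ∑ m, u x t m * pd m (fun y => u y t l) x
        - ν * ∑ m, pd m (pd m fun y => u y t l) x + pd l (fun y => p y t) x = f x t l) ∧
    ∑ m, pd m (fun y => u y t m) x = 0

/-- `g` is a function on the torus `(ℝ/2πℤ)³` in space and has period `τ` in time. -/
def IsPeriodic {α : Type*} (τ : ℝ) (g : (Fin 3 → ℝ) → ℝ → α) : Prop :=
  (∀ x t (j : Fin 3), g (x + Pi.single j (2 * Real.pi)) t = g x t) ∧ ∀ x t, g x (t + τ) = g x t

end NSPeriodic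

end

open NSPeriodic

noncomputable section

namespace NSPeriodic

/-! ## Completeness and bounded operators on the weighted spaces -/

section Operators

variable {w w' : Z4s → ℝ} [PosWeight w] [PosWeight w']

/-! The map `calF` is a constant plus a bounded linear plus a bounded quadratic map, so its
increments are given exactly by the derivative at the midpoint (`calF_sub_calF`). The Newton map `W
↦ W - A (calF P W)` therefore has Lipschitz constant at most `Z₀ + Z₁ + Z₂ r < 1` on the closed
ball, and it preserves the ball because the quadratic inequality `Y₀ + (Z₀ + Z₁ + Z₂ r / 2) r ≤ r`
holds for `r_min ≤ r < r_max`. Its unique fixed point is a zero of `calF` since `A` is injective: `A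
∘ Â` is close to the identity, hence `A` is onto, and `A` is a finite block plus an invertible
diagonal (`injective_Aop`).

The symmetry `γ_*` is an isometry that fixes the centre and preserves zeros, so uniqueness makes the
zero symmetric and its frequency real. The frequency does not vanish: on a high mode `(0,0,0,k)` the
operator `A (D𝓕(W) - D𝓕(W̄))` produces the ratio `(Ω - Ω̄)/Ω̄` (`norm_fst_sub_le`), while its norm
is at most `Z₂ r < 1`.

It remains to return from vorticity to velocity. The divergence of the vorticity equation is an
advection-diffusion equation for `d = ∇·ω` with the real, divergence-free drift `u = Mω`. Pairing it
with `d` and taking real parts leaves `∑ ν ñ² |dₙ|² = 0`, so `d = 0`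
(`eq_zero_of_advection_diffusion`, `divSeq_eq_zero`). On the modes with `ñ = 0` the equation then
reduces to `iΩ n₄ ωₙ = 0`, and `Ω ≠ 0` gives `ωₙ = 0`. Hence `ω = ∇ × u`, the vorticity equation
says that the momentum residual is curl free, and a curl-free field without spatially constant modes
is a gradient (`residual_add_pressure`).

All these sequences decay exponentially, so the series are real analytic, can be differentiated
termwise, and multiply by convolution; the identities in Fourier space become the Navier–Stokes
equations. -/

@[simp] theorem L1w.neg_apply (a : L1w w) (n : Z4s) : (-a) n = -a n := rfl
@[simp] theorem L1w.sub_apply (a b : L1w w) (n : Z4s) : (a - b) n = a n - b n := rfl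

theorem L1w.sum_apply {ι : Type*} (s : Finset ι) (a : ι → L1w w) (n : Z4s) :
    (∑ i ∈ s, a i) n = ∑ i ∈ s, a i n :=
  map_sum (L1w.eval n) a s

theorem L1w.memℓp (a : L1w w) : Memℓp (fun n => a n * (w n : ℂ)) 1 := by
  refine memℓp_gen (a.summable.congr fun n => ?_)
  have : 0 < w n := PosWeight.pos n
  simp [abs_of_pos this]

/-- The isometry `a ↦ (aₙ wₙ)ₙ` onto the unweighted space. -/
def L1w.toLp1 (a : L1w w) : lp (fun _ : Z4s => ℂ) 1 := ⟨fun n => a n * (w n : ℂ), a.memℓp⟩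

theorem L1w.isometry_toLp1 : Isometry (L1w.toLp1 (w := w)) := by
  refine Isometry.of_dist_eq fun a b => ?_
  rw [dist_eq_norm, dist_eq_norm, lp.norm_eq_tsum_rpow (by simp), L1w.norm_def]
  simp only [ENNReal.toReal_one, Real.rpow_one, div_one]
  refine tsum_congr fun n => ?_
  have : 0 < w n := PosWeight.pos n
  have h : (a.toLp1 - b.toLp1 : lp (fun _ : Z4s => ℂ) 1) n = (a n - b n) * (w n : ℂ) :=
    (sub_mul _ _ _).symm
  rw [h]
  simp [abs_of_pos this]

theorem L1w.surjective_toLp1 : Function.Surjective (L1w.toLp1 (w := w)) := fun b => by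
  have hb := (memℓp_gen_iff (by simp)).1 b.2
  have hw : ∀ n, 0 < w n := fun n => PosWeight.pos n
  refine ⟨L1w.mk (fun n => b n / (w n : ℂ)) (hb.congr fun n => ?_), Subtype.ext (funext fun n => ?_)⟩
  · have := hw n
    simp [abs_of_pos this, this.ne']
  · have := (hw n).ne'
    simp [L1w.toLp1, this]

/-- Completeness is transported from the unweighted `lp` along the surjective isometry `L1w.toLp1`;
the contraction principle depends on it. -/
instance : CompleteSpace (L1w w) :=
  (L1w.isometry_toLp1.isUniformInducing.completeSpace_congr L1w.surjective_toLp1).2 inferInstance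

/-- Multiplication by a sequence, as a bounded operator between weighted spaces. -/
def multOp (d : Z4s → ℂ) (C : ℝ) (h : ∀ n, ‖d n‖ * w' n ≤ C * w n) : L1w w →L[ℂ] L1w w' :=
  have hle : ∀ (a : L1w w) n, ‖d n * a n‖ * w' n ≤ C * (‖a n‖ * w n) := fun a n => by
    rw [norm_mul]
    nlinarith [mul_le_mul_of_nonneg_left (h n) (norm_nonneg (a n))]
  have hmem : ∀ a : L1w w, Summable fun n => ‖d n * a n‖ * w' n := fun a =>
    Summable.of_nonneg_of_le (fun n => mul_nonneg (norm_nonneg _) (PosWeight.pos n).le) (hle a)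
      (a.summable.mul_left C)
  LinearMap.mkContinuous
    { toFun := fun a => L1w.mk (fun n => d n * a n) (hmem a)
      map_add' := fun a b => L1w.ext fun n => mul_add _ _ _
      map_smul' := fun s a => L1w.ext fun n => mul_left_comm _ _ _ } C fun a => by
    rw [L1w.norm_def a, ← tsum_mul_left]
    exact (hmem a).tsum_le_tsum (hle a) (a.summable.mul_left C)

@[simp] theorem multOp_apply (d : Z4s → ℂ) (C : ℝ) (h : ∀ n, ‖d n‖ * w' n ≤ C * w n) (a : L1w w)
    (n : Z4s) : multOp d C h a n = d n * a n := rfl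

/-- The component `ω⁽ˡ⁾`. -/
def compL (l : Fin 3) : XW w →L[ℂ] L1w w :=
  PiLp.proj 1 (𝕜 := ℂ) (fun _ : Fin 3 => L1w w) l ∘L
    WithLp.sndL 1 ℂ ℂ (PiLp 1 fun _ : Fin 3 => L1w w)

@[simp] theorem compL_apply (l : Fin 3) (W : XW w) : compL l W = W.snd l := rfl

/-- The frequency `Ω`. -/
def fstL : XW w →L[ℂ] ℂ := WithLp.fstL 1 ℂ ℂ (PiLp 1 fun _ : Fin 3 => L1w w)

@[simp] theorem fstL_apply (W : XW w) : fstL W = W.fst := rfl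

theorem XW.ext {U V : XW w} (h : U.fst = V.fst) (h' : ∀ l n, U.snd l n = V.snd l n) : U = V :=
  WithLp.ofLp_injective _ (Prod.ext h (PiLp.ext fun l => L1w.ext fun n => h' l n))

variable {E F : Type*} [NormedAddCommGroup E] [NormedSpace ℂ E] [NormedAddCommGroup F]
  [NormedSpace ℂ F]

/-- The bounded operator with given components. -/
def mkXL (φ : E →L[ℂ] ℂ) (ψ : Fin 3 → E →L[ℂ] L1w w) : E →L[ℂ] XW w :=
  LinearMap.mkContinuous
    { toFun := fun v => mkX (φ v) fun l => ψ l v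
      map_add' := fun u v => XW.ext (map_add φ u v) fun l n => by simp
      map_smul' := fun c v => XW.ext (map_smul φ c v) fun l n => by simp }
    (‖φ‖ + ∑ l, ‖ψ l‖) fun v => by
    show ‖mkX (φ v) fun l => ψ l v‖ ≤ _
    rw [normX, add_mul, Finset.sum_mul]
    exact add_le_add (φ.le_opNorm v) (Finset.sum_le_sum fun l _ => (ψ l).le_opNorm v)

@[simp] theorem mkXL_apply (φ : E →L[ℂ] ℂ) (ψ : Fin 3 → E →L[ℂ] L1w w) (v : E) :
    mkXL φ ψ v = mkX (φ v) fun l => ψ l v := rfl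

/-- The bounded bilinear map with zero frequency and given components. -/
def mkXBil (ψ : Fin 3 → E →L[ℂ] F →L[ℂ] L1w w) : E →L[ℂ] F →L[ℂ] XW w :=
  LinearMap.mkContinuous₂
    (LinearMap.mk₂ ℂ (fun u v => mkX 0 fun l => ψ l u v)
      (fun u u' v => XW.ext (by simp) fun l n => by simp)
      (fun c u v => XW.ext (by simp) fun l n => by simp)
      (fun u v v' => XW.ext (by simp) fun l n => by simp)
      (fun c u v => XW.ext (by simp) fun l n => by simp))
    (∑ l, ‖ψ l‖) fun u v => by
    show ‖mkX 0 fun l => ψ l u v‖ ≤ _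
    rw [normX, Finset.sum_mul, Finset.sum_mul]
    simpa using Finset.sum_le_sum fun l _ => (ψ l).le_opNorm₂ u v

@[simp] theorem mkXBil_apply (ψ : Fin 3 → E →L[ℂ] F →L[ℂ] L1w w) (u : E) (v : F) :
    mkXBil ψ u v = mkX 0 fun l => ψ l u v := rfl

theorem hasFDerivAt_diagonal (B : E →L[ℂ] E →L[ℂ] F) (x : E) :
    HasFDerivAt (fun v => B v v) (B x + B.flip x) x := by
  refine (B.hasFDerivAt_of_bilinear (hasFDerivAt_id x) (hasFDerivAt_id x)).congr_fderiv ?_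
  ext v
  simp

end Operators

/-! ## Convolution as a bounded bilinear map -/

section Convolution

variable {η : ℝ} [hη : Fact (1 < η)]

theorem ext0_coe (a : Z4s → ℂ) (n : Z4s) : ext0 a n.1 = a n := dif_pos n.2

theorem ext0_zero (a : Z4s → ℂ) : ext0 a 0 = 0 := dif_neg (not_not.2 rfl)

theorem tsum_ext0 (a : L1w (wt η)) : ∑' n, ‖ext0 a n‖ * η ^ norm1 n = ‖a‖ := by
  rw [L1w.norm_def, ← tsum_subtype_eq_of_support_subset (s := {n : Z4 | n ≠ 0})]
  · refine tsum_congr fun n => ?_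
    rw [wt, ← ext0_coe a n]
  · intro n hn h
    apply hn
    simp [ext0, h]

/-- The weight is submultiplicative because `|n|₁ ≤ |k|₁ + |n - k|₁`. After the change of indices
`shiftEquiv`, the product of the two norms is the double sum that dominates the convolution. -/
theorem tsum_conv_le {a b : Z4 → ℂ} (ha : ExpSum η a) (hb : ExpSum η b) :
    ∑' n, ‖conv a b n‖ * η ^ norm1 n
      ≤ (∑' n, ‖a n‖ * η ^ norm1 n) * ∑' n, ‖b n‖ * η ^ norm1 n := by
  have hpos : ∀ c : Z4 → ℂ, 0 ≤ fun n => ‖c n‖ * η ^ norm1 n := fun c n =>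
    mul_nonneg (norm_nonneg _) (eta_pow_pos _).le
  have hg := summable_shift ha hb (hpos a) (hpos b)
  have hm := Summable.mul_of_nonneg ha hb (hpos a) (hpos b)
  have key : (∑' n, ‖a n‖ * η ^ norm1 n) * ∑' n, ‖b n‖ * η ^ norm1 n
      = ∑' n, ∑' k, (‖a k‖ * η ^ norm1 k) * (‖b (n - k)‖ * η ^ norm1 (n - k)) := by
    rw [ha.tsum_mul_tsum hb hm, ← hg.tsum_prod, ← shiftEquiv.tsum_eq]
    rfl
  rw [key]
  refine (S_conv ha hb).tsum_le_tsum (fun n => ?_) hg.prod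
  have hnorm : Summable fun k => ‖a k * b (n - k)‖ := (summable_conv ha hb n).norm
  calc ‖conv a b n‖ * η ^ norm1 n ≤ (∑' k, ‖a k * b (n - k)‖) * η ^ norm1 n :=
        mul_le_mul_of_nonneg_right (norm_tsum_le_tsum_norm hnorm) (eta_pow_pos _).le
    _ = ∑' k, ‖a k * b (n - k)‖ * η ^ norm1 n := tsum_mul_right.symm
    _ ≤ _ := by
        refine (hnorm.mul_right _).tsum_le_tsum (fun k => ?_) (hg.prod_factor n)
        have h1 : η ^ norm1 n ≤ η ^ norm1 k * η ^ norm1 (n - k) := by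
          rw [← pow_add]
          refine pow_le_pow_right₀ hη.out.le ?_
          have := norm1_add_le k (n - k)
          rwa [add_sub_cancel] at this
        rw [norm_mul]
        calc ‖a k‖ * ‖b (n - k)‖ * η ^ norm1 n
            ≤ ‖a k‖ * ‖b (n - k)‖ * (η ^ norm1 k * η ^ norm1 (n - k)) :=
              mul_le_mul_of_nonneg_left h1 (mul_nonneg (norm_nonneg _) (norm_nonneg _))
          _ = _ := by ring

theorem ext0_add (a b : L1w (wt η)) (n : Z4) : ext0 (a + b) n = ext0 a n + ext0 b n := by
  unfold ext0; split_ifs <;> simp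

theorem ext0_smul (c : ℂ) (a : L1w (wt η)) (n : Z4) : ext0 (c • a) n = c * ext0 a n := by
  unfold ext0; split_ifs <;> simp

/-- Convolution on `ℓ¹_η`, restricted to the nonzero indices. -/
def convL : L1w (wt η) →L[ℂ] L1w (wt η) →L[ℂ] L1w (wt η) :=
  LinearMap.mkContinuous₂
    (LinearMap.mk₂ ℂ
      (fun a b => L1w.mk (fun n => conv (ext0 a) (ext0 b) n.1)
        (S_restrict (S_conv (S_ext0 a) (S_ext0 b))))
      (fun a a' b => L1w.ext fun n => by
        refine (tsum_congr fun k => ?_).trans ((summable_conv (S_ext0 a) (S_ext0 b) n.1).tsum_add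
          (summable_conv (S_ext0 a') (S_ext0 b) n.1))
        exact (congrArg (· * _) (ext0_add a a' k)).trans (add_mul _ _ _))
      (fun c a b => L1w.ext fun n => by
        refine (tsum_congr fun k => ?_).trans tsum_mul_left
        exact (congrArg (· * _) (ext0_smul c a k)).trans (mul_assoc _ _ _))
      (fun a b b' => L1w.ext fun n => by
        refine (tsum_congr fun k => ?_).trans ((summable_conv (S_ext0 a) (S_ext0 b) n.1).tsum_add
          (summable_conv (S_ext0 a) (S_ext0 b') n.1))
        exact (congrArg (_ * ·) (ext0_add b b' _)).trans (mul_add _ _ _))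
      (fun c a b => L1w.ext fun n => by
        refine (tsum_congr fun k => ?_).trans tsum_mul_left
        exact (congrArg (_ * ·) (ext0_smul c b _)).trans (mul_left_comm _ _ _)))
    1 fun a b => by
    rw [one_mul, ← tsum_ext0 a, ← tsum_ext0 b]
    refine le_trans ?_ (tsum_conv_le (S_ext0 a) (S_ext0 b))
    rw [L1w.norm_def]
    -- The convolution may be nonzero at the index `0`; discarding that coefficient only lowers the
    -- norm.
    exact Summable.tsum_subtype_le (fun n => ‖conv (ext0 a) (ext0 b) n‖ * η ^ norm1 n)
      {n : Z4 | n ≠ 0} (fun n => mul_nonneg (norm_nonneg _) (eta_pow_pos _).le)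
      (S_conv (S_ext0 a) (S_ext0 b))

@[simp] theorem convL_apply (a b : L1w (wt η)) (n : Z4s) :
    convL a b n = conv (ext0 a) (ext0 b) n.1 := rfl

/-! ## The quadratic map `𝓕` -/

theorem wt_bound {d : ℂ} (n : Z4s) (h : ‖d‖ ≤ 1) : ‖d‖ * wt η n ≤ 1 * wt η n :=
  mul_le_mul_of_nonneg_right h (PosWeight.pos n).le

/-- `ω ↦ (Mω)⁽ˡ⁾`. -/
def MopL (l : Fin 3) : XSpace η →L[ℂ] L1w (wt η) :=
  ∑ q, multOp (fun n => Mmat n.1 l q) 1 (fun n => wt_bound n (norm_Mmat_le n.1 l q)) ∘L compL q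

/-- `ω ↦ D_p (Mω)⁽ˡ⁾`. -/
def DMopL (p l : Fin 3) : XSpace η →L[ℂ] L1w (wt η) :=
  ∑ q, multOp (fun n => (til n.1 p : ℂ) * Mmat n.1 l q) 1
    (fun n => wt_bound n (norm_til_Mmat_le n.1 p l q)) ∘L compL q

theorem til_zero : til 0 = 0 := rfl

theorem ext0_MopL (l : Fin 3) (W : XSpace η) : ext0 (MopL l W) = Mop (extV (coeffs W).2) l := by
  funext n
  by_cases h : n = 0
  · subst h
    rw [ext0_zero]
    simp [Mop, Mmat, til_zero]
  · have := ext0_coe (MopL l W) ⟨n, h⟩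
    rw [this]
    simp only [MopL, sum_apply, L1w.sum_apply]
    exact Finset.sum_congr rfl fun q _ =>
      congrArg (Mmat n l q * ·) (ext0_coe (W.snd q) ⟨n, h⟩).symm

theorem ext0_DMopL (p l : Fin 3) (W : XSpace η) :
    ext0 (DMopL p l W) = Dop p (Mop (extV (coeffs W).2) l) := by
  funext n
  by_cases h : n = 0
  · subst h
    rw [ext0_zero]
    simp [Dop, til_zero]
  · have := ext0_coe (DMopL p l W) ⟨n, h⟩
    rw [this]
    simp only [DMopL, sum_apply, L1w.sum_apply]
    refine Eq.trans ?_ (Finset.mul_sum _ _ _).symm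
    refine Finset.sum_congr rfl fun q _ => (mul_assoc _ _ _).trans ?_
    exact congrArg (fun z => (til n p : ℂ) * (Mmat n l q * z)) (ext0_coe (W.snd q) ⟨n, h⟩).symm

/-- The bilinear form `i (Mω ⋆ D̃) ω' - i (ω ⋆ D̃) Mω'` polarizing `Ψ`. -/
def PsiBil (a b : Fin 3 → Z4 → ℂ) : Fin 3 → Z4 → ℂ :=
  fun l n => I * (∑ m, (til n m : ℂ) * conv (Mop a m) (b l) n) - I * advect a (Mop b) l n

/-- In `PsiBil` the derivative of the first term stands outside the convolution, where the weaker
weight of the target absorbs the factor `n_m`. Inside, it would fall on `ω`, whose derivative need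
not be in `ℓ¹_η`. The exchange is allowed because `Mω` is divergence free. -/
theorem Psi_eq {a : Fin 3 → Z4 → ℂ} (h : ∀ l, ExpSum η (a l)) (l : Fin 3) (n : Z4) :
    Psi a l n = PsiBil a a l n := by
  rw [Psi, PsiBil, advect_Mop h]

/-- A multiplier bounded by `max(|ñ|_∞², |n₄|)`, as an operator from `ℓ¹_η` to `ℓ¹_{η,-2,-1}`. -/
def multNeg (d : Z4s → ℂ) (h : ∀ n : Z4s, ‖d n‖ ≤ (max (tilInf n.1 ^ 2) (n.1 3).natAbs : ℕ)) :
    L1w (wt η) →L[ℂ] L1w (wtNeg η) :=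
  multOp d 1 fun n => mul_wtNeg_le n (by rw [one_mul]; exact h n)

@[simp] theorem multNeg_apply (d : Z4s → ℂ)
    (h : ∀ n : Z4s, ‖d n‖ ≤ (max (tilInf n.1 ^ 2) (n.1 3).natAbs : ℕ)) (a : L1w (wt η)) (n : Z4s) :
    multNeg d h a n = d n * a n := rfl

theorem norm_I_mul_til_le (n : Z4s) (m : Fin 3) :
    ‖I * (til n.1 m : ℂ)‖ ≤ (max (tilInf n.1 ^ 2) (n.1 3).natAbs : ℕ) := by
  rw [norm_mul, norm_I, one_mul, Complex.norm_intCast, ← Int.cast_abs, Int.abs_eq_natAbs,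
    Int.cast_natCast]
  exact_mod_cast natAbs_til_le_max n.1 m

theorem norm_I_mul_n4_le (n : Z4s) :
    ‖I * (n.1 3 : ℂ)‖ ≤ (max (tilInf n.1 ^ 2) (n.1 3).natAbs : ℕ) := by
  rw [norm_mul, norm_I, one_mul]
  simpa only [one_mul] using norm_n4_le n

theorem norm_I_le (n : Z4s) : ‖I‖ ≤ (max (tilInf n.1 ^ 2) (n.1 3).natAbs : ℕ) := by
  rw [norm_I]
  exact_mod_cast one_le_max n

/-- The components of `quadPart`. -/
def quadComp (l : Fin 3) : XSpace η →L[ℂ] XSpace η →L[ℂ] L1w (wtNeg η) :=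
  (ContinuousLinearMap.compL ℂ _ _ _ (multNeg (fun n => I * (n.1 3 : ℂ)) norm_I_mul_n4_le)) ∘L
      (ContinuousLinearMap.lsmul ℂ ℂ : ℂ →L[ℂ] L1w (wt η) →L[ℂ] L1w (wt η)).bilinearComp
        fstL (compL l)
    + ∑ m, (ContinuousLinearMap.compL ℂ _ _ _
        (multNeg (fun n => I * (til n.1 m : ℂ)) fun n => norm_I_mul_til_le n m)) ∘L
        convL.bilinearComp (MopL m) (compL l)
    - ∑ m, (ContinuousLinearMap.compL ℂ _ _ _ (multNeg (fun _ => I) norm_I_le)) ∘L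
        convL.bilinearComp (compL m) (DMopL m l)

theorem quadComp_apply (W V : XSpace η) (l : Fin 3) (n : Z4s) :
    quadComp l W V n = I * (n.1 3 : ℂ) * (W.fst * V.snd l n)
      + ∑ m, I * (til n.1 m : ℂ) * conv (ext0 (MopL m W)) (ext0 (V.snd l)) n.1
      - ∑ m, I * conv (ext0 (W.snd m)) (ext0 (DMopL m l V)) n.1 := by
  simp only [quadComp, sub_apply, add_apply, sum_apply, L1w.sub_apply, L1w.add_apply,
    L1w.sum_apply]
  rfl

/-- The quadratic part of `𝓕`, as a bounded bilinear map. -/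
def quadPart : XSpace η →L[ℂ] XSpace η →L[ℂ] YSpace η := mkXBil quadComp

theorem quadPart_snd (W V : XSpace η) (l : Fin 3) (n : Z4s) :
    (quadPart W V).snd l n = I * W.fst * (n.1 3 : ℂ) * V.snd l n
      + PsiBil (extV (coeffs W).2) (extV (coeffs V).2) l n.1 := by
  rw [quadPart, mkXBil_apply, mkX_snd, quadComp_apply, PsiBil, advect, Finset.mul_sum,
    Finset.mul_sum, ← add_sub_assoc]
  congr 2
  · ring
  · refine Finset.sum_congr rfl fun m _ => ?_
    rw [ext0_MopL, mul_assoc]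
    rfl
  · funext m
    rw [ext0_DMopL]
    rfl

/-! ### The linear part and the derivative -/

theorem phase_summable {ωhat : Fin 3 → Z4s → ℂ}
    (h : ∃ C : ℝ, ∀ l n, |(n.1 3 : ℝ)| * ‖ωhat l n‖ ≤ C * wt η n) (l : Fin 3) (a : L1w (wt η)) :
    Summable fun n : Z4s => a n * (n.1 3 : ℂ) * (starRingEnd ℂ) (ωhat l n) := by
  obtain ⟨C, hC⟩ := h
  refine Summable.of_norm_bounded (a.summable.mul_left C) fun n => ?_
  rw [norm_mul, norm_mul, RCLike.norm_conj, Complex.norm_intCast]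
  nlinarith [mul_le_mul_of_nonneg_left (hC l n) (norm_nonneg (a n))]

/-- The summands of the phase condition, as a bounded functional. -/
def phaseComp {ωhat : Fin 3 → Z4s → ℂ}
    (h : ∃ C : ℝ, ∀ l n, |(n.1 3 : ℝ)| * ‖ωhat l n‖ ≤ C * wt η n) (l : Fin 3) :
    L1w (wt η) →L[ℂ] ℂ :=
  LinearMap.mkContinuousOfExistsBound
    { toFun := fun a => ∑' n : Z4s, a n * (n.1 3 : ℂ) * (starRingEnd ℂ) (ωhat l n)
      map_add' := fun a b => by
        rw [← (phase_summable h l a).tsum_add (phase_summable h l b)]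
        exact tsum_congr fun n => by rw [L1w.add_apply]; ring
      map_smul' := fun c a => by
        rw [smul_eq_mul, ← tsum_mul_left]
        exact tsum_congr fun n => by rw [L1w.smul_apply, RingHom.id_apply]; ring }
    (by
      obtain ⟨C, hC⟩ := id h
      refine ⟨C, fun a => ?_⟩
      rw [L1w.norm_def, ← tsum_mul_left]
      refine tsum_of_norm_bounded (a.summable.mul_left C).hasSum fun n => ?_
      rw [norm_mul, norm_mul, RCLike.norm_conj, Complex.norm_intCast]
      nlinarith [mul_le_mul_of_nonneg_left (hC l n) (norm_nonneg (a n))])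

/-- The linear part of `𝓕`. -/
def linPart (P : Problem η) : XSpace η →L[ℂ] YSpace η :=
  mkXL (∑ l, (I • phaseComp P.phase_bdd l) ∘L compL l) fun l =>
    -- The constant is that of `norm_symbol_le` at `Ω = 0`.
    multOp (fun n => (P.ν : ℂ) * (tilSq n.1 : ℂ)) (3 * |P.ν| + ‖(0 : ℂ)‖)
      (fun n => mul_wtNeg_le n (by simpa using norm_symbol_le P.ν 0 n)) ∘L compL l

theorem linPart_fst (P : Problem η) (W : XSpace η) :
    (linPart P W).fst = phase P.ωhat fun l => W.snd l := by
  rw [linPart, mkXL_apply, mkX_fst, sum_apply, phase, Finset.mul_sum]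
  rfl

theorem linPart_snd (P : Problem η) (W : XSpace η) (l : Fin 3) (n : Z4s) :
    (linPart P W).snd l n = (P.ν : ℂ) * (tilSq n.1 : ℂ) * W.snd l n := rfl

/-- The constant part of `𝓕`. -/
def constPart (P : Problem η) : YSpace η :=
  mkX 0 fun l => L1w.mk (fun n => -curlSeq P.f l n.1) ((P.curl_mem l).congr fun n => by
    rw [norm_neg])

theorem calF_eq (P : Problem η) (W : XSpace η) :
    calF P W = constPart P + linPart P W + quadPart W W := by
  refine XW.ext ?_ fun l n => ?_
  · show phase P.ωhat (fun l => W.snd l) = 0 + (linPart P W).fst + 0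
    rw [linPart_fst]; ring
  · show Fseq P.ν P.f W.fst (fun m => W.snd m) l n
      = -curlSeq P.f l n.1 + (linPart P W).snd l n + (quadPart W W).snd l n
    have h := Psi_eq (η := η) (a := extV (coeffs W).2) (fun m => S_ext0 (W.snd m)) l n.1
    rw [quadPart_snd, linPart_snd, ← h, Fseq]
    simp only [coeffs]
    ring

theorem hasFDerivAt_calF (P : Problem η) (W : XSpace η) :
    HasFDerivAt (calF P) (linPart P + (quadPart W + quadPart.flip W)) W := by
  have h1 := (((linPart P).hasFDerivAt (x := W)).const_add (constPart P)).add
    (hasFDerivAt_diagonal quadPart W)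
  exact h1.congr_of_eventuallyEq (Eventually.of_forall fun V => calF_eq P V)

theorem fderiv_calF_apply (P : Problem η) (W V : XSpace η) :
    fderiv ℂ (calF P) W V = linPart P V + (quadPart W V + quadPart V W) := by
  rw [(hasFDerivAt_calF P W).fderiv]
  rfl

/-- For a bilinear `Q` and the midpoint `m` of `U` and `V`, `Q(V,V) - Q(U,U) = Q(m, V-U) + Q(V-U,
m)`. The mean value formula is thus exact, with no integral along the segment. -/
theorem calF_sub_calF (P : Problem η) (U V : XSpace η) :
    calF P V - calF P U = fderiv ℂ (calF P) ((1 / 2 : ℂ) • (U + V)) (V - U) := by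
  rw [fderiv_calF_apply, calF_eq, calF_eq]
  simp only [map_sub, map_add, map_smul, sub_apply, add_apply, smul_apply]
  module

end Convolution

/-! ## A Newton–Kantorovich theorem for quadratic maps -/

section Newton

variable {E G : Type*} [NormedAddCommGroup E] [NormedSpace ℂ E]
  [NormedAddCommGroup G] [NormedSpace ℂ G]

theorem norm_newton_sub_le {F : E → G} {F' : E → E →L[ℂ] G}
    (hF : ∀ U V, F V - F U = F' ((1 / 2 : ℂ) • (U + V)) (V - U)) (A : G →L[ℂ] E) {x₀ : E}
    {Z Z₂ : ℝ} (hZ : ∀ x, ‖ContinuousLinearMap.id ℂ E - A ∘L F' x‖ ≤ Z + Z₂ * ‖x - x₀‖) (U V : E) :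
    ‖(V - A (F V)) - (U - A (F U))‖
      ≤ (Z + Z₂ * ‖(1 / 2 : ℂ) • (U + V) - x₀‖) * ‖V - U‖ := by
  have h : (V - A (F V)) - (U - A (F U))
      = (ContinuousLinearMap.id ℂ E - A ∘L F' ((1 / 2 : ℂ) • (U + V))) (V - U) := by
    have h1 : A (F V) - A (F U) = A (F' ((1 / 2 : ℂ) • (U + V)) (V - U)) := by
      rw [← map_sub, hF]
    rw [sub_apply, ContinuousLinearMap.comp_apply, ← h1, ContinuousLinearMap.id_apply]
    abel
  rw [h]
  exact ContinuousLinearMap.le_of_opNorm_le _ (hZ _) _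

variable [CompleteSpace E]

/-- The midpoint of two points of the ball is within `r` of the centre, which gives the contraction
constant `Z + Z₂ r`. The midpoint of a point and the centre is within `r / 2`, which is why only
half of `Z₂` enters the condition that the ball is preserved. Injectivity of `A` identifies fixed
points with zeros. -/
theorem exists_unique_zero_of_quadratic {F : E → G} {F' : E → E →L[ℂ] G}
    (hF : ∀ U V, F V - F U = F' ((1 / 2 : ℂ) • (U + V)) (V - U)) (A : G →L[ℂ] E)
    (hA : Function.Injective A) {x₀ : E} {Y Z Z₂ r : ℝ} (hY : ‖A (F x₀)‖ ≤ Y)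
    (hZ : ∀ x, ‖ContinuousLinearMap.id ℂ E - A ∘L F' x‖ ≤ Z + Z₂ * ‖x - x₀‖) (hZ0 : 0 ≤ Z)
    (hZ₂ : 0 ≤ Z₂) (hr : 0 ≤ r) (h1 : Z + Z₂ * r < 1) (h2 : Y + (Z + Z₂ * r / 2) * r ≤ r) :
    ∃ x ∈ Metric.closedBall x₀ r, F x = 0 ∧ ∀ y ∈ Metric.closedBall x₀ r, F y = 0 → y = x := by
  set T : E → E := fun x => x - A (F x) with hT
  have hlip : ∀ U ∈ Metric.closedBall x₀ r, ∀ V ∈ Metric.closedBall x₀ r,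
      ‖T V - T U‖ ≤ (Z + Z₂ * r) * ‖V - U‖ := fun U hU V hV => by
    refine (norm_newton_sub_le hF A hZ U V).trans ?_
    have : ‖(1 / 2 : ℂ) • (U + V) - x₀‖ ≤ r := by
      rw [mem_closedBall_iff_norm] at hU hV
      have e : (1 / 2 : ℂ) • (U + V) - x₀ = (1 / 2 : ℂ) • ((U - x₀) + (V - x₀)) := by module
      rw [e, norm_smul]
      have := norm_add_le (U - x₀) (V - x₀)
      norm_num
      linarith
    gcongr
  have hmaps : Set.MapsTo T (Metric.closedBall x₀ r) (Metric.closedBall x₀ r) := fun V hV => by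
    rw [mem_closedBall_iff_norm] at hV ⊢
    have h := norm_newton_sub_le hF A hZ x₀ V
    have e : (1 / 2 : ℂ) • (x₀ + V) - x₀ = (1 / 2 : ℂ) • (V - x₀) := by module
    have e2 : ‖(1 / 2 : ℂ) • (V - x₀)‖ = ‖V - x₀‖ / 2 := by
      rw [norm_smul]; norm_num; ring
    rw [e, e2] at h
    have e3 : T V - x₀ = ((V - A (F V)) - (x₀ - A (F x₀))) - A (F x₀) := by
      simp only [hT]; abel
    have h3 : (Z + Z₂ * (‖V - x₀‖ / 2)) * ‖V - x₀‖ ≤ (Z + Z₂ * r / 2) * r := by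
      have : Z + Z₂ * (‖V - x₀‖ / 2) ≤ Z + Z₂ * r / 2 := by
        nlinarith [mul_le_mul_of_nonneg_left hV hZ₂]
      have hn : 0 ≤ Z + Z₂ * r / 2 := by positivity
      exact mul_le_mul this hV (norm_nonneg _) hn
    rw [e3]
    refine (norm_sub_le _ _).trans ?_
    linarith
  have hfix : ∀ x, F x = 0 ↔ T x = x := fun x => by
    simp only [hT, sub_eq_self]
    exact ⟨fun h => by rw [h, map_zero], fun h => hA (by rw [h, map_zero])⟩
  have hK0 : 0 ≤ Z + Z₂ * r := by positivity
  have hcontr : ContractingWith ⟨Z + Z₂ * r, hK0⟩ (hmaps.restrict T _ _) := by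
    refine ⟨by exact_mod_cast h1, LipschitzWith.of_dist_le_mul fun U V => ?_⟩
    rw [Subtype.dist_eq, Subtype.dist_eq, dist_eq_norm, dist_eq_norm]
    exact hlip V.1 V.2 U.1 U.2
  have hx₀ : x₀ ∈ Metric.closedBall x₀ r := Metric.mem_closedBall_self hr
  obtain ⟨x, hx, hxT, -⟩ := hcontr.exists_fixedPoint' Metric.isClosed_closedBall.isComplete hmaps
    hx₀ (edist_ne_top _ _)
  refine ⟨x, hx, (hfix x).2 hxT, fun y hy hFy => ?_⟩
  have h := hlip x hx y hy
  rw [(hfix y).1 hFy, hxT.eq] at h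
  have : ‖y - x‖ ≤ 0 := by nlinarith [norm_nonneg (y - x)]
  exact sub_eq_zero.1 (norm_le_zero_iff.1 this)

theorem surjective_of_norm_id_sub_lt_one {T : E →L[ℂ] E}
    (h : ‖ContinuousLinearMap.id ℂ E - T‖ < 1) : Function.Surjective T := by
  have hu : IsUnit T := by
    have := isUnit_one_sub_of_norm_lt_one h
    rwa [← ContinuousLinearMap.one_def, sub_sub_cancel] at this
  obtain ⟨u, rfl⟩ := hu
  intro y
  refine ⟨(↑u⁻¹ : E →L[ℂ] E) y, ?_⟩
  rw [← mul_apply_eq_comp, Units.mul_inv, one_apply_eq_self]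

end Newton

/-! ## Injectivity of `A` -/

section Aop

variable {η : ℝ} [hη : Fact (1 < η)] {ν : ℝ} (hν : 0 < ν) {Ω : ℂ} (hΩ : Ω.re ≠ 0) (N : ℕ)
  (B : Coord (calE ν Ω N) →ₗ[ℂ] Coord (calE ν Ω N))

theorem restr_inj {w : Z4s → ℝ} [PosWeight w] {E : Set Z4s} (hE : E.Finite) (v : Coord E) :
    restr E (inj (w := w) hE v) = v := by
  refine Prod.ext rfl (funext fun n => funext fun l => ?_)
  exact dif_pos n.2

open Classical in
theorem restr_Aop (Y : YSpace η) :
    restr (calE ν Ω N) (Aop hν hΩ N B Y) = B (restr (calE ν Ω N) Y) := by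
  have h1 : restr (calE ν Ω N) (tailA η hν hΩ N Y) = 0 := by
    refine Prod.ext (zero_mul _) (funext fun n => funext fun l => ?_)
    show (if n.1 ∈ calE ν Ω N then 0 else 1 / symbol ν Ω n.1) * Y.snd l n.1 = 0
    rw [if_pos n.2, zero_mul]
  show restr (calE ν Ω N) (inj (calE_finite hν hΩ N) (B (restr (calE ν Ω N) Y))
    + tailA η hν hΩ N Y) = _
  rw [map_add, h1, restr_inj, add_zero]

open Classical in
theorem Aop_snd {n : Z4s} (hn : n ∉ calE ν Ω N) (Y : YSpace η) (l : Fin 3) :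
    (Aop hν hΩ N B Y).snd l n = 1 / symbol ν Ω n * Y.snd l n := by
  show (dite (n ∈ calE ν Ω N) _ _ : ℂ)
    + (if n ∈ calE ν Ω N then 0 else 1 / symbol ν Ω n) * Y.snd l n = _
  rw [dif_neg hn, if_neg hn, zero_add]

theorem symbol_ne_zero {n : Z4s} (hn : n ∉ calE ν Ω N) : symbol ν Ω n ≠ 0 := fun h => by
  apply hn
  simp [calE, h]

/-- `A` is block diagonal. Surjectivity passes to the block `B`, where finite dimension turns it
into injectivity; outside the block, `A` multiplies by nonzero numbers. -/
theorem injective_Aop (hA : Function.Surjective (Aop (η := η) hν hΩ N B)) :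
    Function.Injective (Aop (η := η) hν hΩ N B) := by
  have : Finite (calE ν Ω N) := calE_finite hν hΩ N
  have hBs : Function.Surjective B := fun v => by
    obtain ⟨Y, hY⟩ := hA (inj (calE_finite hν hΩ N) v)
    exact ⟨restr _ Y, by rw [← restr_Aop hν hΩ N B, hY, restr_inj]⟩
  have hBi := LinearMap.injective_iff_surjective.2 hBs
  refine (injective_iff_map_eq_zero _).2 fun Y hY => ?_
  have h1 : restr (calE ν Ω N) Y = 0 := hBi (by rw [← restr_Aop hν hΩ N B, hY, map_zero, map_zero])
  refine XW.ext (congrArg Prod.fst h1 : Y.fst = 0) fun l n => ?_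
  by_cases hn : n ∈ calE ν Ω N
  · exact congrFun (congrFun (congrArg Prod.snd h1) ⟨n, hn⟩) l
  · have h2 := Aop_snd hν hΩ N B hn Y l
    rw [hY] at h2
    have h3 : (0 : ℂ) = 1 / symbol ν Ω n * Y.snd l n := h2
    exact (mul_eq_zero.1 h3.symm).resolve_left (one_div_ne_zero (symbol_ne_zero N hn))

/-! ## Control of the frequency -/

/-- The index `(0, 0, 0, k)`. -/
def timeIdx (k : ℕ) (hk : k ≠ 0) : Z4s :=
  ⟨Pi.single 3 (k : ℤ), fun h => hk (by simpa using congrFun h 3)⟩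

theorem til_timeIdx (k : ℕ) (hk : k ≠ 0) : til (timeIdx k hk).1 = 0 := by
  funext j
  fin_cases j <;> simp [til, timeIdx]

theorem timeIdx_three (k : ℕ) (hk : k ≠ 0) : (timeIdx k hk).1 3 = k := by
  simp [timeIdx]

theorem tilSq_of_til_eq_zero {n : Z4} (h : til n = 0) : tilSq n = 0 := by
  simp [tilSq, h]

open Classical in
/-- The sequence with a single nonzero coefficient, equal to one. -/
def L1w.single (n : Z4s) : L1w (wt η) :=
  L1w.mk (Pi.single n 1) (summable_of_ne_finset_zero (s := {n}) fun m hm => by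
    have : m ≠ n := by simpa using hm
    simp [this])

theorem L1w.single_self (n : Z4s) : (L1w.single n : L1w (wt η)) n = 1 := Pi.single_eq_same _ _

theorem L1w.single_ne {n m : Z4s} (h : m ≠ n) : (L1w.single n : L1w (wt η)) m = 0 :=
  Pi.single_eq_of_ne h _

theorem L1w.norm_single (n : Z4s) : ‖(L1w.single n : L1w (wt η))‖ = wt η n := by
  rw [L1w.norm_def, tsum_eq_single n fun m hm => by rw [L1w.single_ne hm, norm_zero, zero_mul],
    L1w.single_self, norm_one, one_mul]

/-- A single mode in the first component of `ω`. -/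
def singleMode (n : Z4s) : XSpace η := mkX 0 (Pi.single 0 (L1w.single n))

theorem norm_singleMode (n : Z4s) : ‖(singleMode n : XSpace η)‖ = wt η n := by
  rw [normX]
  simp [singleMode, Fin.sum_univ_three, L1w.norm_single]

theorem singleMode_ne {n m : Z4s} (h : m ≠ n) (l : Fin 3) :
    (singleMode n : XSpace η).snd l m = 0 := by
  show (Pi.single 0 (L1w.single n) : Fin 3 → L1w (wt η)) l m = 0
  rcases eq_or_ne l 0 with rfl | hl
  · rw [Pi.single_eq_same, L1w.single_ne h]
  · rw [Pi.single_eq_of_ne hl, L1w.zero_apply]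

theorem singleMode_self (n : Z4s) : (singleMode n : XSpace η).snd 0 n = 1 := by
  show (Pi.single 0 (L1w.single n) : Fin 3 → L1w (wt η)) 0 n = 1
  rw [Pi.single_eq_same, L1w.single_self]

/-- The matrix `Mₙ` vanishes when `ñ = 0`, which removes the second term; the first carries the
factor `n_m = 0`. -/
theorem PsiBil_singleMode_right (a : Fin 3 → Z4 → ℂ) {n : Z4s} (hn : til n.1 = 0) (l : Fin 3) :
    PsiBil a (extV (coeffs (singleMode n : XSpace η)).2) l n.1 = 0 := by
  have h : Mop (extV (coeffs (singleMode n : XSpace η)).2) = 0 := by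
    funext l k
    by_cases hk : til k = 0
    · simp [Mop, Mmat, hk]
    · have : ∀ m, extV (coeffs (singleMode n : XSpace η)).2 m k = 0 := fun m => by
        have hk0 : k ≠ 0 := fun h => hk (by rw [h, til_zero])
        have hkn : (⟨k, hk0⟩ : Z4s) ≠ n := fun h => hk (by rw [← hn, ← h])
        exact (ext0_coe _ ⟨k, hk0⟩).trans (singleMode_ne hkn m)
      simp [Mop, this, Matrix.mulVec, dotProduct]
  simp [PsiBil, h, hn, advect, conv, Dop]

/-- The first term again carries the factor `n_m = 0`. In the second, only `k = n` contributes, and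
there the derivative is evaluated at the index `0`, where it vanishes. -/
theorem PsiBil_singleMode_left (b : Fin 3 → Z4 → ℂ) {n : Z4s} (hn : til n.1 = 0) (l : Fin 3) :
    PsiBil (extV (coeffs (singleMode n : XSpace η)).2) b l n.1 = 0 := by
  have h : ∀ m k, extV (coeffs (singleMode n : XSpace η)).2 m k * Dop m (Mop b l) (n.1 - k) = 0 := by
    intro m k
    by_cases hk : k = n.1
    · simp [hk, Dop, til_zero]
    · have : extV (coeffs (singleMode n : XSpace η)).2 m k = 0 := by
        by_cases hk0 : k = 0
        · rw [hk0]; exact ext0_zero _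
        · exact (ext0_coe _ ⟨k, hk0⟩).trans (singleMode_ne (fun h => hk (by rw [← h])) m)
      rw [this, zero_mul]
  simp [PsiBil, hn, advect, conv, h]

/-- The operator is tested on the mode `(0,0,0,k)`, with `k` so large that `A` is diagonal there.
The terms of `PsiBil` vanish at this index, so the difference of derivatives multiplies its
coefficient by `i(Ω - Ω̄)k`, and `A` divides by `iΩ̄k`. Input and output have the same weight, so
the ratio `|Ω - Ω̄| / |Ω̄|` is bounded by the operator norm. -/
theorem norm_fst_sub_le (P : Problem η) {Wbar : XSpace η} (hre : Wbar.fst.re ≠ 0) (N : ℕ)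
    (B : Coord (calE P.ν Wbar.fst N) →ₗ[ℂ] Coord (calE P.ν Wbar.fst N)) (W : XSpace η) :
    ‖W.fst - Wbar.fst‖ ≤ ‖Aop P.ν_pos hre N B ∘L (fderiv ℂ (calF P) W - fderiv ℂ (calF P) Wbar)‖
      * ‖Wbar.fst‖ := by
  have h0 : Wbar.fst ≠ 0 := fun h => hre (by rw [h, zero_re])
  have hpos : 0 < ‖Wbar.fst‖ := norm_pos_iff.2 h0
  -- This choice makes `|iΩ̄k| > N`, so the mode lies outside `calE`.
  obtain ⟨k, hk⟩ := exists_nat_gt ((N : ℝ) / ‖Wbar.fst‖)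
  have hk0 : k ≠ 0 := by
    rintro rfl
    have : (0 : ℝ) ≤ (N : ℝ) / ‖Wbar.fst‖ := by positivity
    simp only [Nat.cast_zero] at hk
    linarith
  have hkC : (k : ℂ) ≠ 0 := by exact_mod_cast hk0
  set n := timeIdx k hk0 with hn
  have hn0 : til n.1 = 0 := til_timeIdx k hk0
  have hsym : symbol P.ν Wbar.fst n = I * Wbar.fst * k := by
    rw [symbol, tilSq_of_til_eq_zero hn0, hn, timeIdx_three]; simp
  have hnE : n ∉ calE P.ν Wbar.fst N := by
    rw [div_lt_iff₀ hpos] at hk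
    simp only [calE, Set.mem_ofPred_eq, hsym, not_le]
    simpa [mul_comm] using hk
  set V : XSpace η := singleMode n with hV
  set D := fderiv ℂ (calF P) W - fderiv ℂ (calF P) Wbar with hD
  have hDV : (D V).snd 0 n = I * (W.fst - Wbar.fst) * k := by
    have e : D V = (quadPart W V + quadPart V W) - (quadPart Wbar V + quadPart V Wbar) := by
      rw [hD, sub_apply, fderiv_calF_apply, fderiv_calF_apply]; abel
    have e2 : (D V).snd 0 n = ((quadPart W V).snd 0 n + (quadPart V W).snd 0 n)
        - ((quadPart Wbar V).snd 0 n + (quadPart V Wbar).snd 0 n) := by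
      rw [e]; rfl
    have hf : V.fst = 0 := rfl
    rw [e2]
    simp only [quadPart_snd, hf]
    rw [hV, PsiBil_singleMode_right _ hn0, PsiBil_singleMode_right _ hn0,
      PsiBil_singleMode_left _ hn0, PsiBil_singleMode_left _ hn0, singleMode_self, hn,
      timeIdx_three]
    push_cast
    ring
  have h1 := (Aop P.ν_pos hre N B ∘L D).le_opNorm V
  rw [hV, norm_singleMode, ← hV] at h1
  set Q := Aop P.ν_pos hre N B (D V) with hQ
  have h2 : ‖Q.snd 0 n‖ * wt η n ≤ ‖Q‖ := by
    refine ((Q.snd 0).le_norm n).trans ?_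
    rw [normX]
    have := Finset.single_le_sum (f := fun l => ‖Q.snd l‖) (fun l _ => norm_nonneg _)
      (Finset.mem_univ (0 : Fin 3))
    have := norm_nonneg Q.fst
    linarith
  have h3 : Q.snd 0 n = (W.fst - Wbar.fst) / Wbar.fst := by
    rw [hQ, Aop_snd P.ν_pos hre N B hnE, hDV, hsym]
    field_simp
  have h4 : ‖Q.snd 0 n‖ ≤ ‖Aop P.ν_pos hre N B ∘L D‖ :=
    le_of_mul_le_mul_right (h2.trans h1) (PosWeight.pos n : 0 < wt η n)
  rw [h3, norm_div, div_le_iff₀ hpos] at h4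
  exact h4

end Aop

/-! ## The conjugation symmetry -/

/-- The conjugation symmetry `(γ_* a)ₙ = conj a₋ₙ` on sequences over all indices. -/
def conjSeq (a : Z4 → ℂ) : Z4 → ℂ := fun n => (starRingEnd ℂ) (a (-n))

theorem til_neg (n : Z4) (m : Fin 3) : til (-n) m = -til n m := rfl

theorem til_neg_eq_zero (n : Z4) : til (-n) = 0 ↔ til n = 0 := by
  simp only [funext_iff, til_neg, Pi.zero_apply, neg_eq_zero]

theorem tilSq_neg (n : Z4) : tilSq (-n) = tilSq n := by simp [tilSq, til_neg]

theorem norm1_neg (n : Z4) : norm1 (-n) = norm1 n := by simp [norm1]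

theorem crossMat_neg (n : Z4) (l m : Fin 3) :
    (starRingEnd ℂ) (crossMat (-n) l m) = -crossMat n l m := by
  fin_cases l <;> fin_cases m <;> simp [crossMat]

theorem Mmat_neg (n : Z4) (l m : Fin 3) : (starRingEnd ℂ) (Mmat (-n) l m) = Mmat n l m := by
  by_cases h : til n = 0
  · simp [Mmat, h, (til_neg_eq_zero n).2 h]
  · have h' : til (-n) ≠ 0 := fun h' => h ((til_neg_eq_zero n).1 h')
    simp only [Mmat, h, h', if_false, Matrix.smul_apply, smul_eq_mul, map_mul, crossMat_neg,
      tilSq_neg, map_div₀, conj_I, map_intCast]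
    ring

theorem Mop_conjSeq (ω : Fin 3 → Z4 → ℂ) (l : Fin 3) :
    Mop (fun m => conjSeq (ω m)) l = conjSeq (Mop ω l) := by
  funext n
  simp [Mop, conjSeq, Matrix.mulVec, dotProduct, Mmat_neg]

theorem Dop_conjSeq (m : Fin 3) (a : Z4 → ℂ) (n : Z4) :
    Dop m (conjSeq a) n = -conjSeq (Dop m a) n := by
  simp [Dop, conjSeq, til_neg]

theorem conv_conjSeq (a b : Z4 → ℂ) (n : Z4) :
    conv (conjSeq a) (conjSeq b) n = conjSeq (conv a b) n := by
  rw [conjSeq, conv, conv, Complex.conj_tsum, ← (Equiv.neg Z4).tsum_eq]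
  refine tsum_congr fun k => ?_
  simp only [conjSeq, Equiv.neg_apply, map_mul, neg_neg]
  congr 3
  abel

theorem advect_conjSeq (a b : Fin 3 → Z4 → ℂ) (l : Fin 3) (n : Z4) :
    advect (fun m => conjSeq (a m)) (fun m => conjSeq (b m)) l n = -conjSeq (advect a b l) n := by
  have h : ∀ m, Dop m (conjSeq (b l)) = conjSeq (fun k => -Dop m (b l) k) := fun m => by
    funext k; rw [Dop_conjSeq]; simp [conjSeq]
  have h2 : ∀ m, conv (a m) (fun k => -Dop m (b l) k) (-n) = -conv (a m) (Dop m (b l)) (-n) :=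
    fun m => by simp [conv, tsum_neg]
  simp only [advect, h, conv_conjSeq]
  simp only [conjSeq, h2, map_neg, map_sum, Finset.sum_neg_distrib, advect]

/-- A derivative changes sign under the symmetry, and so does `i` under conjugation; in each term of
`Psi` the two signs cancel. `Mop` commutes with the symmetry for the same reason. -/
theorem Psi_conjSeq (ω : Fin 3 → Z4 → ℂ) (l : Fin 3) (n : Z4) :
    Psi (fun m => conjSeq (ω m)) l n = conjSeq (Psi ω l) n := by
  have h : Mop (fun m => conjSeq (ω m)) = fun l => conjSeq (Mop ω l) :=
    funext fun l => Mop_conjSeq ω l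
  rw [Psi, h, advect_conjSeq, advect_conjSeq]
  simp only [conjSeq, Psi, map_sub, map_mul, conj_I]
  ring

theorem curlSeq_conj {f : Fin 3 → Z4 → ℂ} (hf : ∀ l n, f l (-n) = (starRingEnd ℂ) (f l n))
    (l : Fin 3) (n : Z4) : (starRingEnd ℂ) (curlSeq f l (-n)) = curlSeq f l n := by
  simp [curlSeq, Matrix.mulVec, dotProduct, crossMat_neg, hf]

theorem extV_gammaSeq (ω : Fin 3 → Z4s → ℂ) : extV (gammaSeq ω) = fun l => conjSeq (extV ω l) := by
  funext l n
  by_cases h : n = 0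
  · subst h
    simp [extV, conjSeq, ext0_zero]
  · have h' : -n ≠ 0 := neg_ne_zero.2 h
    simp [extV, conjSeq, ext0, h, gammaSeq, negIdx]

theorem Fseq_gamma (ν : ℝ) {f : Fin 3 → Z4 → ℂ}
    (hf : ∀ l n, f l (-n) = (starRingEnd ℂ) (f l n)) (Ω : ℂ) (ω : Fin 3 → Z4s → ℂ) (l : Fin 3)
    (n : Z4s) : Fseq ν f ((starRingEnd ℂ) Ω) (gammaSeq ω) l n
      = (starRingEnd ℂ) (Fseq ν f Ω ω l (negIdx n)) := by
  have h1 : (negIdx n).1 = -n.1 := rfl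
  simp only [Fseq, extV_gammaSeq, Psi_conjSeq, map_sub, map_add, map_mul, h1, curlSeq_conj hf,
    conj_I, tilSq_neg, gammaSeq, conjSeq, conj_ofReal, map_intCast, Pi.neg_apply, Int.cast_neg,
    map_neg]
  ring

/-- `n ↦ -n` as a permutation of the nonzero indices. -/
def negEquiv : Z4s ≃ Z4s where
  toFun := negIdx
  invFun := negIdx
  left_inv n := Subtype.ext (neg_neg n.1)
  right_inv n := Subtype.ext (neg_neg n.1)

theorem phase_gamma {ωhat : Fin 3 → Z4s → ℂ} (hhat : gammaSeq ωhat = ωhat)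
    (ω : Fin 3 → Z4s → ℂ) :
    phase ωhat (gammaSeq ω) = (starRingEnd ℂ) (phase ωhat ω) := by
  rw [phase, phase, map_mul, conj_I, map_sum, neg_mul, ← mul_neg, ← Finset.sum_neg_distrib]
  congr 1
  refine Finset.sum_congr rfl fun l _ => ?_
  rw [Complex.conj_tsum, ← tsum_neg, ← negEquiv.tsum_eq]
  refine tsum_congr fun n => ?_
  have h : (starRingEnd ℂ) (ωhat l (negIdx n)) = ωhat l n := congrFun (congrFun hhat l) n
  have h1 : negIdx (negIdx n) = n := negEquiv.left_inv n
  have h2 : (negIdx n).1 3 = -n.1 3 := rfl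
  simp only [negEquiv, Equiv.coe_fn_mk, gammaSeq, h1, h2, h, map_mul, Complex.conj_conj,
    map_intCast, Int.cast_neg]
  ring

theorem wt_negIdx (η : ℝ) (n : Z4s) : wt η (negIdx n) = wt η n := by
  rw [wt, wt, negIdx, norm1_neg]

/-! ### The symmetry as an isometry of `𝒳` that preserves zeros. -/

section

variable {η : ℝ} [hη : Fact (1 < η)]

/-- The conjugation symmetry on `ℓ¹_η`. -/
def L1w.gamma (a : L1w (wt η)) : L1w (wt η) :=
  L1w.mk (fun n => (starRingEnd ℂ) (a (negIdx n)))
    ((negEquiv.summable_iff.2 a.summable).congr fun n => by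
      rw [RCLike.norm_conj]
      exact congrArg (_ * ·) (wt_negIdx η n))

theorem L1w.norm_gamma_sub (a b : L1w (wt η)) : ‖a.gamma - b.gamma‖ = ‖a - b‖ := by
  rw [L1w.norm_def, L1w.norm_def, ← negEquiv.tsum_eq]
  refine tsum_congr fun n => ?_
  have h1 : negIdx (negIdx n) = n := negEquiv.left_inv n
  rw [show negEquiv n = negIdx n from rfl, wt_negIdx]
  simp only [L1w.sub_apply, L1w.gamma, L1w.mk_apply, h1]
  rw [← map_sub, RCLike.norm_conj]

/-- The conjugation symmetry on `𝒳`. -/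
def gammaX (W : XSpace η) : XSpace η := mkX ((starRingEnd ℂ) W.fst) fun l => (W.snd l).gamma

theorem coeffs_gammaX (W : XSpace η) : coeffs (gammaX W) = gammaStar (coeffs W) := rfl

theorem coeffs_injective {U V : XSpace η} (h : coeffs U = coeffs V) : U = V :=
  XW.ext (Prod.ext_iff.1 h).1 fun l n => congrFun (congrFun (Prod.ext_iff.1 h).2 l) n

theorem norm_gammaX_sub (U V : XSpace η) : ‖gammaX U - gammaX V‖ = ‖U - V‖ := by
  rw [normX, normX]
  congr 1
  · show ‖(starRingEnd ℂ) U.fst - (starRingEnd ℂ) V.fst‖ = ‖U.fst - V.fst‖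
    rw [← map_sub, RCLike.norm_conj]
  · exact Finset.sum_congr rfl fun l _ => L1w.norm_gamma_sub _ _

theorem calF_eq_zero_iff (P : Problem η) (W : XSpace η) :
    calF P W = 0 ↔ phase P.ωhat (coeffs W).2 = 0 ∧
      ∀ l n, Fseq P.ν P.f W.fst (coeffs W).2 l n = 0 := by
  constructor
  · intro h
    exact ⟨congrArg (fun Y : YSpace η => Y.fst) h,
      fun l n => congrArg (fun Y : YSpace η => Y.snd l n) h⟩
  · rintro ⟨h1, h2⟩
    exact XW.ext h1 h2

theorem calF_gammaX {P : Problem η} (hf : ∀ l n, P.f l (-n) = (starRingEnd ℂ) (P.f l n))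
    (hhat : gammaSeq P.ωhat = P.ωhat) {W : XSpace η} (hW : calF P W = 0) :
    calF P (gammaX W) = 0 := by
  rw [calF_eq_zero_iff] at hW ⊢
  refine ⟨(phase_gamma hhat (coeffs W).2).trans ?_, fun l n => ?_⟩
  · rw [hW.1, map_zero]
  · refine (Fseq_gamma P.ν hf W.fst (coeffs W).2 l n).trans ?_
    rw [hW.2, map_zero]

/-! ## Existence, uniqueness and symmetry of the zero -/

theorem exists_symmetric_zero (P : Problem η)
    (hf : ∀ l n, P.f l (-n) = (starRingEnd ℂ) (P.f l n)) (hhat : gammaSeq P.ωhat = P.ωhat)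
    {Wbar : XSpace η} (hΩ : Wbar.fst.re ≠ 0) (hreal : gammaStar (coeffs Wbar) = coeffs Wbar)
    {N : ℕ} {B : Coord (calE P.ν Wbar.fst N) →ₗ[ℂ] Coord (calE P.ν Wbar.fst N)}
    {Y₀ Z₀ Z₁ Z₂ : ℝ} (hZ₀ : 0 ≤ Z₀) (hZ₁ : 0 ≤ Z₁) (hZ₂ : 0 ≤ Z₂) (hY₀ : 0 ≤ Y₀)
    (boundY₀ : ‖Aop P.ν_pos hΩ N B (calF P Wbar)‖ ≤ Y₀)
    (boundZ₀ : ‖ContinuousLinearMap.id ℂ (XSpace η) - Aop P.ν_pos hΩ N B ∘L Ahat P Wbar N‖ ≤ Z₀)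
    (boundZ₁ : ‖Aop P.ν_pos hΩ N B ∘L (fderiv ℂ (calF P) Wbar - Ahat P Wbar N)‖ ≤ Z₁)
    (boundZ₂ : ∀ W : XSpace η,
      ‖Aop P.ν_pos hΩ N B ∘L (fderiv ℂ (calF P) W - fderiv ℂ (calF P) Wbar)‖ ≤ Z₂ * ‖W - Wbar‖)
    (cond₁ : Z₀ + Z₁ < 1) (cond₂ : 2 * Y₀ * Z₂ < (1 - (Z₀ + Z₁)) ^ 2) {r : ℝ}
    (hr : r ∈ Set.Ico
        ((1 - (Z₀ + Z₁) - Real.sqrt ((1 - (Z₀ + Z₁)) ^ 2 - 2 * Y₀ * Z₂)) / Z₂)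
        ((1 - (Z₀ + Z₁)) / Z₂)) :
    ∃ W ∈ Metric.closedBall Wbar r, calF P W = 0 ∧
      (∀ V ∈ Metric.closedBall Wbar r, calF P V = 0 → V = W) ∧
      gammaStar (coeffs W) = coeffs W ∧ W.fst.re ≠ 0 := by
  obtain ⟨hr1, hr2⟩ := hr
  -- For `Z₂ = 0` both endpoints are divisions by zero, hence `0`, and the interval is empty.
  have hZpos : 0 < Z₂ := by
    refine lt_of_le_of_ne hZ₂ fun h => ?_
    rw [← h, div_zero] at hr1 hr2
    linarith
  set a := 1 - (Z₀ + Z₁) with ha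
  have ha0 : 0 < a := by linarith
  set s := Real.sqrt (a ^ 2 - 2 * Y₀ * Z₂) with hs
  have hs2 : s ^ 2 = a ^ 2 - 2 * Y₀ * Z₂ := Real.sq_sqrt (by linarith)
  have hs0 : 0 ≤ s := Real.sqrt_nonneg _
  have hsa : s ≤ a := Real.sqrt_le_iff.2 ⟨ha0.le, by nlinarith [mul_nonneg hY₀ hZ₂]⟩
  rw [div_le_iff₀ hZpos] at hr1
  rw [lt_div_iff₀ hZpos] at hr2
  have hr0 : 0 ≤ r := by
    by_contra h
    nlinarith
  have hquad : Y₀ + (Z₀ + Z₁ + Z₂ * r / 2) * r ≤ r := by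
    -- From `a - s ≤ r Z₂ < a` follows `0 ≤ a - r Z₂ ≤ s`. The squared inequality is `Y₀ - a r + Z₂
    -- r² / 2 ≤ 0` multiplied by `2 Z₂`.
    have h1 : (a - r * Z₂) ^ 2 ≤ s ^ 2 := pow_le_pow_left₀ (by linarith) (by linarith) 2
    rw [hs2] at h1
    have h2 : 2 * Z₂ * (Y₀ + (Z₀ + Z₁ + Z₂ * r / 2) * r) ≤ 2 * Z₂ * r := by
      have : Z₀ + Z₁ = 1 - a := by linarith
      rw [this]
      nlinarith
    exact le_of_mul_le_mul_left h2 (by linarith)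
  set A := Aop (η := η) P.ν_pos hΩ N B with hA
  -- `A ∘ Â` is at distance less than one from the identity, hence onto, and so is its outer factor
  -- `A`.
  have hinj : Function.Injective A := by
    have hsurj := surjective_of_norm_id_sub_lt_one (boundZ₀.trans_lt (by linarith : Z₀ < 1))
    refine injective_Aop P.ν_pos hΩ N B fun V => ?_
    obtain ⟨U, hU⟩ := hsurj V
    exact ⟨Ahat P Wbar N U, hU⟩
  have hDF : ∀ W : XSpace η, ‖ContinuousLinearMap.id ℂ (XSpace η) - A ∘L fderiv ℂ (calF P) W‖
      ≤ Z₀ + Z₁ + Z₂ * ‖W - Wbar‖ := fun W => by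
    have e : ContinuousLinearMap.id ℂ (XSpace η) - A ∘L fderiv ℂ (calF P) W
        = (ContinuousLinearMap.id ℂ (XSpace η) - A ∘L Ahat P Wbar N)
          - A ∘L (fderiv ℂ (calF P) Wbar - Ahat P Wbar N)
          - A ∘L (fderiv ℂ (calF P) W - fderiv ℂ (calF P) Wbar) := by
      simp only [ContinuousLinearMap.comp_sub]
      abel
    rw [e]
    refine (norm_sub_le _ _).trans (add_le_add ((norm_sub_le _ _).trans ?_) (boundZ₂ W))
    exact add_le_add boundZ₀ boundZ₁
  obtain ⟨W, hW, hFW, huniq⟩ := exists_unique_zero_of_quadratic (calF_sub_calF P) A hinj boundY₀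
    hDF (by linarith) hZ₂ hr0 (by linarith) hquad
  have hgWbar : gammaX Wbar = Wbar := coeffs_injective hreal
  -- The reflected zero lies in the same ball, because the symmetry is an isometry fixing the
  -- centre; uniqueness identifies the two.
  have hgW : gammaX W = W := by
    refine huniq _ ?_ (calF_gammaX hf hhat hFW)
    rw [mem_closedBall_iff_norm] at hW ⊢
    rw [← hgWbar, norm_gammaX_sub]
    exact hW
  have hsymm : gammaStar (coeffs W) = coeffs W := by rw [← coeffs_gammaX, hgW]
  refine ⟨W, hW, hFW, huniq, hsymm, fun h0 => ?_⟩
  -- The frequency is real, so a vanishing real part means `Ω = 0`. Then `norm_fst_sub_le` gives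
  -- `|Ω̄| ≤ c |Ω̄|` with `c ≤ Z₂ r < 1`, which is impossible as `Ω̄ ≠ 0`.
  have him : W.fst.im = 0 := Complex.conj_eq_iff_im.1 (congrArg Prod.fst hsymm)
  have hW0 : W.fst = 0 := Complex.ext h0 him
  have h1 := norm_fst_sub_le P hΩ N B W
  rw [hW0, zero_sub, norm_neg] at h1
  have hpos : 0 < ‖Wbar.fst‖ := norm_pos_iff.2 fun h => hΩ (by rw [h, zero_re])
  have h2 := boundZ₂ W
  rw [mem_closedBall_iff_norm] at hW
  have h3 : Z₂ * ‖W - Wbar‖ ≤ r * Z₂ := by nlinarith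
  have h4 : ‖A ∘L (fderiv ℂ (calF P) W - fderiv ℂ (calF P) Wbar)‖ < 1 := by linarith
  nlinarith

end

/-! ## Exponentially decaying sequences -/

/-- Sequences of Fourier coefficients of real-analytic periodic functions. -/
def Decay (a : Z4 → ℂ) : Prop := ∃ ρ : ℝ, 1 < ρ ∧ ExpSum ρ a

theorem ExpSum.mono {ρ ρ' : ℝ} (h0 : 0 ≤ ρ') (h : ρ' ≤ ρ) {a : Z4 → ℂ} (ha : ExpSum ρ a) :
    ExpSum ρ' a :=
  Summable.of_nonneg_of_le (fun _ => mul_nonneg (norm_nonneg _) (pow_nonneg h0 _))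
    (fun _ => mul_le_mul_of_nonneg_left (pow_le_pow_left₀ h0 h _) (norm_nonneg _)) ha

namespace Decay

theorem common {a b : Z4 → ℂ} (ha : Decay a) (hb : Decay b) :
    ∃ ρ : ℝ, 1 < ρ ∧ ExpSum ρ a ∧ ExpSum ρ b := by
  obtain ⟨ρ, hρ, ha⟩ := ha
  obtain ⟨σ, hσ, hb⟩ := hb
  have h : 1 < min ρ σ := lt_min hρ hσ
  exact ⟨min ρ σ, h, ha.mono (by linarith) (min_le_left _ _), hb.mono (by linarith) (min_le_right _ _)⟩

theorem summable_norm {a : Z4 → ℂ} (ha : Decay a) : Summable fun n => ‖a n‖ := by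
  obtain ⟨ρ, hρ, ha⟩ := ha
  have : Fact (1 < ρ) := ⟨hρ⟩
  exact S_norm ha

theorem add {a b : Z4 → ℂ} (ha : Decay a) (hb : Decay b) : Decay fun n => a n + b n := by
  obtain ⟨ρ, hρ, ha, hb⟩ := ha.common hb
  refine ⟨ρ, hρ, Summable.of_nonneg_of_le (fun n => ?_) (fun n => ?_) (Summable.add ha hb)⟩
  · positivity
  · rw [← add_mul]
    exact mul_le_mul_of_nonneg_right (norm_add_le _ _) (by positivity)

theorem bounded_mul {a : Z4 → ℂ} (ha : Decay a) (c : Z4 → ℂ) (C : ℝ) (hc : ∀ n, ‖c n‖ ≤ C) :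
    Decay fun n => c n * a n := by
  obtain ⟨ρ, hρ, ha⟩ := ha
  have : Fact (1 < ρ) := ⟨hρ⟩
  exact ⟨ρ, hρ, S_mul ha c C hc⟩

theorem const_mul {a : Z4 → ℂ} (ha : Decay a) (c : ℂ) : Decay fun n => c * a n :=
  ha.bounded_mul (fun _ => c) ‖c‖ fun _ => le_rfl

theorem neg {a : Z4 → ℂ} (ha : Decay a) : Decay fun n => -a n := by
  simpa using ha.const_mul (-1)

theorem sub {a b : Z4 → ℂ} (ha : Decay a) (hb : Decay b) : Decay fun n => a n - b n := by
  simpa [sub_eq_add_neg] using ha.add hb.neg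

theorem zero : Decay fun _ => 0 := ⟨2, by norm_num, by simp [ExpSum, summable_zero]⟩

theorem sum {ι : Type*} (s : Finset ι) {a : ι → Z4 → ℂ} (ha : ∀ i, Decay (a i)) :
    Decay fun n => ∑ i ∈ s, a i n := by
  classical
  induction s using Finset.induction_on with
  | empty => simpa using zero
  | insert i s hi ih => simpa [Finset.sum_insert hi] using (ha i).add ih

/-- Part of the exponential weight pays for the linear factor: with `σ = √ρ`, Bernoulli's inequality
gives `|n|₁ (σ - 1) ≤ σ^{|n|₁}`, and `ρ^{|n|₁}` contains two such powers. -/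
theorem linear_mul {a : Z4 → ℂ} (ha : Decay a) (c : Z4 → ℂ) (C : ℝ)
    (hc : ∀ n, ‖c n‖ ≤ C * norm1 n) : Decay fun n => c n * a n := by
  obtain ⟨ρ, hρ, ha⟩ := ha
  set σ := Real.sqrt ρ with hσ
  have hσ1 : 1 < σ := Real.lt_sqrt_of_sq_lt (by simpa using hρ)
  have hσ2 : σ * σ = ρ := Real.mul_self_sqrt (by linarith)
  -- The bound is tested at an index with `|n|₁ = 1`.
  have hC : 0 ≤ C := by
    have := (norm_nonneg _).trans (hc (Pi.single 0 1))
    simpa [norm1, Fin.sum_univ_four] using this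
  refine ⟨σ, hσ1, Summable.of_nonneg_of_le (fun n => ?_) (fun n => ?_)
    (Summable.mul_left (C / (σ - 1)) ha)⟩
  · positivity
  · have h1 : (norm1 n : ℝ) * (σ - 1) ≤ σ ^ norm1 n := by
      have := one_add_mul_le_pow (a := σ - 1) (by linarith) (norm1 n)
      rw [add_sub_cancel] at this
      linarith
    have h2 : ‖c n‖ ≤ C / (σ - 1) * σ ^ norm1 n := by
      rw [div_mul_eq_mul_div, le_div_iff₀ (by linarith)]
      nlinarith [mul_le_mul_of_nonneg_right (hc n) (sub_nonneg.2 hσ1.le),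
        mul_le_mul_of_nonneg_left h1 hC]
    rw [norm_mul, ← hσ2, mul_pow]
    have h3 : 0 ≤ ‖a n‖ * σ ^ norm1 n := by positivity
    nlinarith [mul_le_mul_of_nonneg_right h2 h3]

theorem til_mul {a : Z4 → ℂ} (ha : Decay a) (m : Fin 3) : Decay fun n => (til n m : ℂ) * a n := by
  refine ha.linear_mul _ 1 fun n => ?_
  rw [Complex.norm_intCast, ← Int.cast_abs, Int.abs_eq_natAbs, Int.cast_natCast, one_mul]
  exact_mod_cast Finset.single_le_sum (f := fun j => (n j).natAbs) (fun _ _ => Nat.zero_le _)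
    (Finset.mem_univ m.castSucc)

theorem time_mul {a : Z4 → ℂ} (ha : Decay a) : Decay fun n => (n 3 : ℂ) * a n := by
  refine ha.linear_mul _ 1 fun n => ?_
  rw [Complex.norm_intCast, ← Int.cast_abs, Int.abs_eq_natAbs, Int.cast_natCast, one_mul]
  exact_mod_cast Finset.single_le_sum (f := fun j => (n j).natAbs) (fun _ _ => Nat.zero_le _)
    (Finset.mem_univ 3)

theorem tilSq_mul {a : Z4 → ℂ} (ha : Decay a) : Decay fun n => (tilSq n : ℂ) * a n := by
  have h := Decay.sum Finset.univ fun m : Fin 3 => (ha.til_mul m).til_mul m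
  have e : (fun n => (tilSq n : ℂ) * a n)
      = fun n => ∑ m : Fin 3, (til n m : ℂ) * ((til n m : ℂ) * a n) := by
    funext n
    rw [tilSq, Int.cast_sum, Finset.sum_mul]
    exact Finset.sum_congr rfl fun m _ => by push_cast; ring
  rwa [e]

theorem conv {a b : Z4 → ℂ} (ha : Decay a) (hb : Decay b) : Decay (conv a b) := by
  obtain ⟨ρ, hρ, ha, hb⟩ := ha.common hb
  have : Fact (1 < ρ) := ⟨hρ⟩
  exact ⟨ρ, hρ, S_conv ha hb⟩

theorem summable_conv {a b : Z4 → ℂ} (ha : Decay a) (hb : Decay b) (n : Z4) :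
    Summable fun k => a k * b (n - k) := by
  obtain ⟨ρ, hρ, ha, hb⟩ := ha.common hb
  have : Fact (1 < ρ) := ⟨hρ⟩
  exact NSPeriodic.summable_conv ha hb n

theorem Mop {ω : Fin 3 → Z4 → ℂ} (h : ∀ l, Decay (ω l)) (l : Fin 3) : Decay (Mop ω l) :=
  Decay.sum Finset.univ fun m => (h m).bounded_mul (fun n => Mmat n l m) 1 fun n =>
    norm_Mmat_le n l m

theorem Dop {a : Z4 → ℂ} (ha : Decay a) (m : Fin 3) : Decay (Dop m a) := ha.til_mul m

theorem advect {a b : Fin 3 → Z4 → ℂ} (ha : ∀ l, Decay (a l)) (hb : ∀ l, Decay (b l)) (l : Fin 3) :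
    Decay (advect a b l) :=
  Decay.sum Finset.univ fun m => (ha m).conv ((hb l).Dop m)

end Decay

/-! ## Vector identities for convolutions -/

/-- The wave vector `ñ` with complex entries. -/
def tilC (n : Z4) : Fin 3 → ℂ := fun j => (til n j : ℂ)

theorem tilC_sub (n k : Z4) : tilC (n - k) = tilC n - tilC k := by
  funext j
  simp [tilC, til]

theorem crossMat_mulVec (n : Z4) (v : Fin 3 → ℂ) :
    (crossMat n).mulVec v = crossProduct (tilC n) v := by
  funext l
  fin_cases l <;> simp [crossMat, Matrix.mulVec, dotProduct, Fin.sum_univ_three, cross_apply, tilC,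
    til] <;> ring

/-- Here `a`, `b` are the velocities and `w`, `z` the vorticities at the wave vectors `k` and `j`.
Transversality reduces `(k + j)·b` to `k·b` and `(k + j)·a` to `j·a`; the stretching terms then
cancel the mixed advection terms `(a·j)(k·z)` and `(b·k)(j·w)`. -/
theorem div_identity (k j a b w z : Fin 3 → ℂ) (ha : a ⬝ᵥ k = 0) (hb : b ⬝ᵥ j = 0) :
    ∑ l, (k + j) l * ((a ⬝ᵥ j) * z l - (w ⬝ᵥ j) * b l)
      + ∑ l, (k + j) l * ((b ⬝ᵥ k) * w l - (z ⬝ᵥ k) * a l)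
      = (a ⬝ᵥ j) * (j ⬝ᵥ z) + (b ⬝ᵥ k) * (k ⬝ᵥ w) := by
  simp only [dotProduct, Fin.sum_univ_three, Pi.add_apply] at *
  linear_combination (-(w 0 * j 0 + w 1 * j 1 + w 2 * j 2)) * hb
    - (z 0 * k 0 + z 1 * k 1 + z 2 * k 2) * ha

/-- This is `∇ × ((u·∇)u) = (u·∇)ω - (ω·∇)u` for the interaction of two wave vectors. It is stated
for the sum over both orderings of the pair. The terms in `j × b` and `k × a` match directly, and
`h` is what remains. -/
theorem curl_identity (k j a b : Fin 3 → ℂ) (ha : a ⬝ᵥ k = 0) (hb : b ⬝ᵥ j = 0) (l : Fin 3) :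
    -((a ⬝ᵥ j) * crossProduct (k + j) b l + (b ⬝ᵥ k) * crossProduct (k + j) a l)
      = -((a ⬝ᵥ j) * crossProduct j b l) + (crossProduct k a ⬝ᵥ j) * b l
        + (-((b ⬝ᵥ k) * crossProduct k a l) + (crossProduct j b ⬝ᵥ k) * a l) := by
  have h : ∀ l : Fin 3, (a ⬝ᵥ j) * crossProduct k b l + (crossProduct k a ⬝ᵥ j) * b l
      + (b ⬝ᵥ k) * crossProduct j a l + (crossProduct j b ⬝ᵥ k) * a l = 0 := fun l => by
    simp only [dotProduct, Fin.sum_univ_three] at *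
    fin_cases l <;> simp [cross_apply]
    · linear_combination (j 1 * b 2 - j 2 * b 1) * ha + (k 1 * a 2 - k 2 * a 1) * hb
    · linear_combination (j 2 * b 0 - j 0 * b 2) * ha + (k 2 * a 0 - k 0 * a 2) * hb
    · linear_combination (j 0 * b 1 - j 1 * b 0) * ha + (k 0 * a 1 - k 1 * a 0) * hb
  have h1 := h l
  simp only [map_add, LinearMap.add_apply, Pi.add_apply]
  linear_combination -h1

theorem hasSum_reflect {g : Z4 → ℂ} {s : ℂ} (h : HasSum g s) (n : Z4) :
    HasSum (fun k => g (n - k)) s :=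
  (Equiv.subLeft n).hasSum_iff.2 h

/-- Sums over `k` are invariant under `k ↦ n - k`, so it suffices to compare the symmetrized
summands. This is how `div_identity` and `curl_identity` become identities between convolutions. -/
theorem hasSum_unique_of_symm {g h : Z4 → ℂ} {s t : ℂ} (hg : HasSum g s) (hh : HasSum h t) (n : Z4)
    (e : ∀ k, g k + g (n - k) = h k + h (n - k)) : s = t := by
  have h1 := hg.add (hasSum_reflect hg n)
  have h2 := hh.add (hasSum_reflect hh n)
  simp only [e] at h1
  linear_combination (1 / 2 : ℂ) * h1.unique h2

/-- The vector of the `n`-th coefficients. -/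
def vec (a : Fin 3 → Z4 → ℂ) (n : Z4) : Fin 3 → ℂ := fun m => a m n

theorem hasSum_advect {a b : Fin 3 → Z4 → ℂ} (ha : ∀ l, Decay (a l)) (hb : ∀ l, Decay (b l))
    (l : Fin 3) (n : Z4) :
    HasSum (fun k => (vec a k ⬝ᵥ tilC (n - k)) * b l (n - k)) (advect a b l n) := by
  have h := hasSum_sum (s := Finset.univ) fun (m : Fin 3) _ =>
    ((ha m).summable_conv ((hb l).Dop m) n).hasSum
  refine h.congr_fun fun k => ?_
  rw [dotProduct, Finset.sum_mul]
  exact Finset.sum_congr rfl fun m _ => mul_assoc _ _ _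

/-- The coefficients of the divergence, up to the factor `i`. -/
def divSeq (ω : Fin 3 → Z4 → ℂ) : Z4 → ℂ := fun n => ∑ m, (til n m : ℂ) * ω m n

theorem Decay.divSeq {ω : Fin 3 → Z4 → ℂ} (h : ∀ l, Decay (ω l)) : Decay (divSeq ω) :=
  Decay.sum Finset.univ fun m => (h m).til_mul m

theorem divSeq_eq (ω : Fin 3 → Z4 → ℂ) (n : Z4) : divSeq ω n = tilC n ⬝ᵥ vec ω n := rfl

theorem vec_Mop_dot (ω : Fin 3 → Z4 → ℂ) (n : Z4) : vec (Mop ω) n ⬝ᵥ tilC n = 0 := by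
  rw [dotProduct_comm]
  exact div_Mop ω n

theorem hasSum_Psi {ω : Fin 3 → Z4 → ℂ} (h : ∀ l, Decay (ω l)) (l : Fin 3) (n : Z4) :
    HasSum (fun k => I * ((vec (Mop ω) k ⬝ᵥ tilC (n - k)) * ω l (n - k)
      - (vec ω k ⬝ᵥ tilC (n - k)) * Mop ω l (n - k))) (Psi ω l n) := by
  rw [Psi, ← mul_sub]
  exact ((hasSum_advect (Decay.Mop h) h l n).sub (hasSum_advect h (Decay.Mop h) l n)).mul_left I

/-- For divergence-free `u`, `∇·((u·∇)ω - (ω·∇)u) = u·∇(∇·ω)`. The scalar `divSeq ω` enters `advect`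
as a constant family, so the component `0` is an arbitrary choice. -/
theorem div_Psi {ω : Fin 3 → Z4 → ℂ} (h : ∀ l, Decay (ω l)) (n : Z4) :
    ∑ l, (til n l : ℂ) * Psi ω l n = I * advect (Mop ω) (fun _ => divSeq ω) 0 n := by
  have h1 := hasSum_sum (s := Finset.univ) fun (l : Fin 3) _ =>
    (hasSum_Psi h l n).mul_left (til n l : ℂ)
  have h2 := (hasSum_advect (Decay.Mop h) (fun _ => Decay.divSeq h) 0 n).mul_left I
  refine hasSum_unique_of_symm h1 h2 n fun k => ?_
  have en : tilC n = tilC k + tilC (n - k) := by rw [tilC_sub]; abel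
  have key := div_identity (tilC k) (tilC (n - k)) (vec (Mop ω) k) (vec (Mop ω) (n - k)) (vec ω k)
    (vec ω (n - k)) (vec_Mop_dot ω k) (vec_Mop_dot ω (n - k))
  rw [← en, ← divSeq_eq, ← divSeq_eq] at key
  rw [sub_sub_cancel]
  have key2 := congrArg (I * ·) key
  simp only [mul_add, Finset.mul_sum] at key2
  refine Eq.trans ?_ key2
  congr 1
  · exact Finset.sum_congr rfl fun l _ => mul_left_comm _ _ _
  · exact Finset.sum_congr rfl fun l _ => mul_left_comm _ _ _

/-- A time-periodic solution of the advection-diffusion equation with real divergence-free drift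
depends on time only. -/
theorem eq_zero_of_advection_diffusion {u : Fin 3 → Z4 → ℂ} {d : Z4 → ℂ} (hu : ∀ l, Decay (u l))
    (hd : Decay d) (hreal : ∀ l, conjSeq (u l) = u l) (hdiv : ∀ n, vec u n ⬝ᵥ tilC n = 0)
    {Ω ν : ℝ} (hν : 0 < ν)
    (heq : ∀ n, I * (Ω : ℂ) * (n 3 : ℂ) * d n + I * advect u (fun _ => d) 0 n
      + (ν : ℂ) * (tilSq n : ℂ) * d n = 0) {n : Z4} (hn : til n ≠ 0) : d n = 0 := by
  -- The terms of the pairing of `d` with its advection by `u`, indexed by the two frequencies of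
  -- `d`.
  set K : Z4 × Z4 → ℂ := fun q =>
    (starRingEnd ℂ) (d q.1) * ((vec u (q.1 - q.2) ⬝ᵥ tilC q.2) * d q.2) with hK
  have hKs : Summable K := by
    have hterm : ∀ m : Fin 3, Summable fun q : Z4 × Z4 =>
        (starRingEnd ℂ) (d q.1) * (u m (q.1 - q.2) * (tilC q.2 m * d q.2)) := fun m => by
      have hp := Summable.mul_of_nonneg hd.summable_norm (hd.til_mul m).summable_norm
        (fun _ => norm_nonneg _) (fun _ => norm_nonneg _)
      refine Summable.of_norm_bounded (hp.mul_left (∑' k, ‖u m k‖)) fun q => ?_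
      have hle := (hu m).summable_norm.le_tsum (q.1 - q.2) fun _ _ => norm_nonneg _
      rw [norm_mul, norm_mul, RCLike.norm_conj]
      have h0 : 0 ≤ ‖d q.1‖ * ‖tilC q.2 m * d q.2‖ := by positivity
      calc _ = ‖u m (q.1 - q.2)‖ * (‖d q.1‖ * ‖tilC q.2 m * d q.2‖) := by ring
        _ ≤ _ := mul_le_mul_of_nonneg_right hle h0
    refine (summable_sum (s := Finset.univ) fun m _ => hterm m).congr fun q => ?_
    simp only [hK, dotProduct, Finset.sum_mul, Finset.mul_sum, vec, mul_assoc]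
  -- Reality of `u` turns the conjugate of `u` at `n - j` into `u` at `j - n`, and the divergence
  -- condition lets the derivative be taken at either frequency. The kernel is therefore Hermitian
  -- and its total sum is real.
  have hsymm : ∀ q, (starRingEnd ℂ) (K q) = K q.swap := fun q => by
    have h1 : ∀ m, (starRingEnd ℂ) (u m (q.1 - q.2)) = u m (q.2 - q.1) := fun m => by
      rw [← neg_sub q.1 q.2]
      conv_rhs => rw [← hreal m]
      simp [conjSeq]
    have h2 := hdiv (q.2 - q.1)
    rw [tilC_sub, dotProduct_sub, sub_eq_zero] at h2
    have h3 : (starRingEnd ℂ) (vec u (q.1 - q.2) ⬝ᵥ tilC q.2) = vec u (q.2 - q.1) ⬝ᵥ tilC q.2 := by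
      simp [dotProduct, vec, h1, tilC]
    simp only [hK, map_mul, h3, h2, Complex.conj_conj, Prod.fst_swap, Prod.snd_swap]
    ring
  have him : (∑' q, K q).im = 0 := by
    rw [← Complex.conj_eq_iff_im, Complex.conj_tsum, ← (Equiv.prodComm Z4 Z4).tsum_eq]
    refine tsum_congr fun q => ?_
    rw [hsymm]
    rfl
  have hinner : ∀ n, HasSum (fun j => K (n, j)) ((starRingEnd ℂ) (d n) * advect u (fun _ => d) 0 n) :=
    fun n => by
      have h := (hasSum_reflect (hasSum_advect hu (fun _ => hd) 0 n) n).mul_left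
        ((starRingEnd ℂ) (d n))
      refine h.congr_fun fun j => ?_
      rw [sub_sub_cancel]
  have hsum := hKs.hasSum.prod_fiberwise hinner
  -- The equation is multiplied by the conjugate of `d n`. The time derivative contributes a purely
  -- imaginary number, so the real part matches the imaginary part of the pairing with the
  -- dissipation.
  have hterm : ∀ n, ((starRingEnd ℂ) (d n) * advect u (fun _ => d) 0 n).im
      = ν * (tilSq n : ℝ) * ‖d n‖ ^ 2 := fun n => by
    have h1 : (starRingEnd ℂ) (d n) * d n = ((‖d n‖ ^ 2 : ℝ) : ℂ) := by
      rw [Complex.conj_mul']; push_cast; rfl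
    have h2 : I * ((starRingEnd ℂ) (d n) * advect u (fun _ => d) 0 n)
        = -(I * ((Ω * (n 3 : ℝ) * ‖d n‖ ^ 2 : ℝ) : ℂ) + ((ν * (tilSq n : ℝ) * ‖d n‖ ^ 2 : ℝ) : ℂ)) := by
      have := congrArg ((starRingEnd ℂ) (d n) * ·) (heq n)
      push_cast at h1 ⊢
      linear_combination this - (I * Ω * n 3 + ν * tilSq n) * h1
    have h3 := congrArg Complex.re h2
    rw [Complex.I_mul_re, neg_re, add_re, Complex.I_mul_re, ofReal_im, ofReal_re] at h3
    linarith
  have hre := Complex.hasSum_im hsum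
  rw [him] at hre
  simp only [hterm] at hre
  have hT : ∀ n, (0 : ℝ) ≤ (tilSq n : ℝ) := fun n => by
    exact_mod_cast (Finset.sum_nonneg fun _ _ => sq_nonneg _ : 0 ≤ tilSq n)
  -- The dissipation terms are nonnegative and sum to zero, so each of them vanishes.
  have hz := congrFun ((hasSum_zero_iff_of_nonneg fun n => by
    have := hT n
    show (0 : ℝ) ≤ _
    positivity).1 hre) n
  have hpos : (0 : ℝ) < (tilSq n : ℝ) := by exact_mod_cast tilSq_pos hn
  simpa [hν.ne', hpos.ne'] using hz

/-! ## The zeros of `𝓕` in Fourier space -/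

/-- When `ñ = 0`, the index `n - k` has spatial part opposite to that of `k`, so every summand
contains the divergence of `Mω` or of `ω` at `k`. -/
theorem Psi_eq_zero_of_til_eq_zero {ω : Fin 3 → Z4 → ℂ} (h : ∀ l, Decay (ω l))
    (hdiv : ∀ n, divSeq ω n = 0) {n : Z4} (hn : til n = 0) (l : Fin 3) : Psi ω l n = 0 := by
  have hc : tilC n = 0 := by
    funext j
    simp [tilC, hn]
  refine (hasSum_Psi h l n).unique (hasSum_zero.congr_fun fun k => ?_)
  have h1 : vec ω k ⬝ᵥ tilC k = 0 := by rw [dotProduct_comm, ← divSeq_eq, hdiv]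
  rw [tilC_sub, hc, zero_sub, dotProduct_neg, dotProduct_neg, vec_Mop_dot, h1]
  simp

theorem curlSeq_eq (f : Fin 3 → Z4 → ℂ) (l : Fin 3) (n : Z4) :
    curlSeq f l n = I * crossProduct (tilC n) (vec f n) l := by
  rw [curlSeq, crossMat_mulVec]
  rfl

theorem div_curlSeq (f : Fin 3 → Z4 → ℂ) (n : Z4) : divSeq (curlSeq f) n = 0 := by
  have h : vec (curlSeq f) n = I • crossProduct (tilC n) (vec f n) :=
    funext fun l => curlSeq_eq f l n
  rw [divSeq_eq, h, dotProduct_smul, dot_self_cross, smul_zero]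

theorem curlSeq_of_til_eq_zero (f : Fin 3 → Z4 → ℂ) {n : Z4} (hn : til n = 0) (l : Fin 3) :
    curlSeq f l n = 0 := by
  have hc : tilC n = 0 := by
    funext j
    simp [tilC, hn]
  simp [curlSeq_eq, hc]

theorem cross_cross_self (k v : Fin 3 → ℂ) (l : Fin 3) :
    crossProduct k (crossProduct k v) l = (k ⬝ᵥ v) * k l - (k ⬝ᵥ k) * v l := by
  fin_cases l <;> simp [cross_apply, dotProduct, Fin.sum_univ_three] <;> ring

theorem tilC_dot_self (n : Z4) : tilC n ⬝ᵥ tilC n = (tilSq n : ℂ) := by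
  simp [dotProduct, tilC, tilSq, sq]

theorem tilSq_ne_zero {n : Z4} (hn : til n ≠ 0) : (tilSq n : ℂ) ≠ 0 := by
  exact_mod_cast (tilSq_pos hn).ne'

theorem vec_Mop {n : Z4} (hn : til n ≠ 0) (ω : Fin 3 → Z4 → ℂ) :
    vec (Mop ω) n = (I / (tilSq n : ℂ)) • crossProduct (tilC n) (vec ω n) := by
  funext l
  show (Mmat n).mulVec (vec ω n) l = _
  rw [Mmat, if_neg hn, Matrix.smul_mulVec, crossMat_mulVec]

/-- Biot–Savart: for transversal `v`, `ñ × (ñ × v) = -ñ² v`. Modes with `ñ = 0` are annihilated by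
`Mop`, so they must be absent from `ω`. -/
theorem curlSeq_Mop {ω : Fin 3 → Z4 → ℂ} (hdiv : ∀ n, divSeq ω n = 0)
    (hmean : ∀ l n, til n = 0 → ω l n = 0) (l : Fin 3) (n : Z4) : curlSeq (Mop ω) l n = ω l n := by
  by_cases hn : til n = 0
  · rw [hmean l n hn, curlSeq_of_til_eq_zero _ hn]
  · have h := tilSq_ne_zero hn
    rw [curlSeq_eq, vec_Mop hn, map_smul, Pi.smul_apply, cross_cross_self, ← divSeq_eq, hdiv,
      tilC_dot_self, smul_eq_mul, vec]
    field_simp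
    rw [I_sq]
    ring

/-- `∇ × ((u·∇) u) = (u·∇) ω - (ω·∇) u` for `ω = ∇ × u`, `∇·u = 0`. -/
theorem curlSeq_advect {ω : Fin 3 → Z4 → ℂ} (h : ∀ l, Decay (ω l))
    (hcurl : ∀ l n, curlSeq (Mop ω) l n = ω l n) (l : Fin 3) (n : Z4) :
    curlSeq (fun l n => I * advect (Mop ω) (Mop ω) l n) l n = Psi ω l n := by
  have hvec : ∀ k, vec ω k = I • crossProduct (tilC k) (vec (Mop ω) k) := fun k =>
    funext fun l => by rw [vec, ← hcurl l k, curlSeq_eq]; rfl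
  have hM := Decay.Mop h
  -- The minus sign is `i · i`, one factor from the curl and one from the derivative in the
  -- advection.
  have h1 : HasSum (fun k => -((vec (Mop ω) k ⬝ᵥ tilC (n - k))
      * crossProduct (tilC n) (vec (Mop ω) (n - k)) l))
      (curlSeq (fun l n => I * advect (Mop ω) (Mop ω) l n) l n) := by
    have hs := (hasSum_sum (s := Finset.univ) fun (m : Fin 3) _ =>
      (hasSum_advect hM hM m n).mul_left (crossMat n l m)).neg
    have e : curlSeq (fun l n => I * advect (Mop ω) (Mop ω) l n) l n
        = -∑ m, crossMat n l m * advect (Mop ω) (Mop ω) m n := by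
      simp only [curlSeq, Matrix.mulVec, dotProduct, Finset.mul_sum, ← Finset.sum_neg_distrib]
      refine Finset.sum_congr rfl fun m _ => ?_
      linear_combination (crossMat n l m * advect (Mop ω) (Mop ω) m n) * I_mul_I
    rw [e]
    refine hs.congr_fun fun k => ?_
    rw [← crossMat_mulVec]
    show -(_ * ∑ m, crossMat n l m * Mop ω m (n - k)) = _
    rw [Finset.mul_sum]
    congr 1
    exact Finset.sum_congr rfl fun m _ => mul_left_comm _ _ _
  refine hasSum_unique_of_symm h1 (hasSum_Psi h l n) n fun k => ?_
  have en : tilC n = tilC k + tilC (n - k) := by rw [tilC_sub]; abel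
  have key := curl_identity (tilC k) (tilC (n - k)) (vec (Mop ω) k) (vec (Mop ω) (n - k))
    (vec_Mop_dot ω k) (vec_Mop_dot ω (n - k)) l
  rw [← en] at key
  have hω : ∀ k, ω l k = I * crossProduct (tilC k) (vec (Mop ω) k) l := fun k =>
    congrFun (hvec k) l
  have hu : ∀ k, Mop ω l k = vec (Mop ω) k l := fun _ => rfl
  rw [sub_sub_cancel, hω, hω, hvec, hvec, smul_dotProduct, smul_dotProduct, smul_eq_mul,
    smul_eq_mul, hu, hu]
  linear_combination key - ((vec (Mop ω) k ⬝ᵥ tilC (n - k))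
    * crossProduct (tilC (n - k)) (vec (Mop ω) (n - k)) l
    - (crossProduct (tilC k) (vec (Mop ω) k) ⬝ᵥ tilC (n - k)) * vec (Mop ω) (n - k) l
    + (vec (Mop ω) (n - k) ⬝ᵥ tilC k) * crossProduct (tilC k) (vec (Mop ω) k) l
    - (crossProduct (tilC (n - k)) (vec (Mop ω) (n - k)) ⬝ᵥ tilC k) * vec (Mop ω) k l) * I_mul_I

/-! ### Recovery of velocity and pressure from the vorticity equation. -/

section FourierSolution

variable {ω f : Fin 3 → Z4 → ℂ} {Ω ν : ℝ}

/-- By `div_Psi`, and since a curl has no divergence, the divergence of the vorticity equation is a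
homogeneous advection-diffusion equation with drift `Mω`. -/
theorem divSeq_eq_zero (hω : ∀ l, Decay (ω l)) (hreal : ∀ l, conjSeq (ω l) = ω l) (hν : 0 < ν)
    (heq : ∀ l n, n ≠ 0 → I * (Ω : ℂ) * (n 3 : ℂ) * ω l n + Psi ω l n
      + (ν : ℂ) * (tilSq n : ℂ) * ω l n - curlSeq f l n = 0) (n : Z4) : divSeq ω n = 0 := by
  by_cases hn : til n = 0
  · simp [divSeq, hn]
  refine eq_zero_of_advection_diffusion (u := Mop ω) (Ω := Ω) (Decay.Mop hω) (Decay.divSeq hω)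
    (fun l => ?_) (vec_Mop_dot ω) hν (fun n => ?_) hn
  · rw [← Mop_conjSeq]
    simp only [hreal]
  · have h1 : ∑ l, (til n l : ℂ) * (I * (Ω : ℂ) * (n 3 : ℂ) * ω l n + Psi ω l n
        + (ν : ℂ) * (tilSq n : ℂ) * ω l n - curlSeq f l n) = 0 := by
      refine Finset.sum_eq_zero fun l _ => ?_
      -- The equation is not imposed at `n = 0`, but the factors `n_l` vanish there.
      by_cases h0 : n = 0
      · simp [h0, til_zero]
      · rw [heq l n h0, mul_zero]
    have h2 := div_Psi hω n
    have h3 := div_curlSeq f n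
    rw [← h2]
    simp only [divSeq, Fin.sum_univ_three] at h1 h3 ⊢
    linear_combination h1 + h3

/-- For `ñ = 0` nonlinearity, diffusion and forcing all disappear, leaving `iΩ n₄ ωₙ = 0`. This is
where a nonzero frequency is needed. -/
theorem eq_zero_of_til_eq_zero (hω : ∀ l, Decay (ω l)) (hω0 : ∀ l, ω l 0 = 0)
    (hdiv : ∀ n, divSeq ω n = 0) (hΩ : Ω ≠ 0)
    (heq : ∀ l n, n ≠ 0 → I * (Ω : ℂ) * (n 3 : ℂ) * ω l n + Psi ω l n
      + (ν : ℂ) * (tilSq n : ℂ) * ω l n - curlSeq f l n = 0) (l : Fin 3) (n : Z4)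
    (hn : til n = 0) : ω l n = 0 := by
  by_cases h0 : n = 0
  · rw [h0, hω0]
  have h := heq l n h0
  rw [Psi_eq_zero_of_til_eq_zero hω hdiv hn, curlSeq_of_til_eq_zero f hn,
    tilSq_of_til_eq_zero hn] at h
  have hn4 : n 3 ≠ 0 := fun h4 => h0 (by
    funext j
    exact Fin.lastCases h4 (fun i => congrFun hn i) j)
  have hn4' : (n 3 : ℂ) ≠ 0 := by exact_mod_cast hn4
  have hΩ' : (Ω : ℂ) ≠ 0 := by exact_mod_cast hΩ
  simpa [hn4', hΩ'] using h

/-- The coefficients of `∂ₜu + (u·∇)u - νΔu - f` for `u = Mω`. -/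
def residual (Ω ν : ℝ) (ω f : Fin 3 → Z4 → ℂ) : Fin 3 → Z4 → ℂ := fun l n =>
  I * (Ω : ℂ) * (n 3 : ℂ) * Mop ω l n + I * advect (Mop ω) (Mop ω) l n
    + (ν : ℂ) * (tilSq n : ℂ) * Mop ω l n - f l n

/-- The coefficients of the pressure. -/
def pressure (Ω ν : ℝ) (ω f : Fin 3 → Z4 → ℂ) : Z4 → ℂ := fun n =>
  ∑ m, I * ((til n m : ℂ) / (tilSq n : ℂ)) * residual Ω ν ω f m n

theorem Decay.residual (hω : ∀ l, Decay (ω l)) (hf : ∀ l, Decay (f l)) (l : Fin 3) :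
    Decay (residual Ω ν ω f l) := by
  have hM := Decay.Mop hω
  refine ((Decay.add ?_ ((Decay.advect hM hM l).const_mul I)).add ?_).sub (hf l)
  · simpa only [mul_assoc] using ((hM l).time_mul.const_mul (Ω : ℂ)).const_mul I
  · simpa only [mul_assoc] using (hM l).tilSq_mul.const_mul (ν : ℂ)

theorem norm_til_div_tilSq_le (n : Z4) (m : Fin 3) :
    ‖I * ((til n m : ℂ) / (tilSq n : ℂ))‖ ≤ 1 := by
  by_cases hn : til n = 0
  · simp [hn]
  · have hp := tilSq_pos hn
    have hpR : (0 : ℝ) < (tilSq n : ℝ) := by exact_mod_cast hp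
    rw [norm_mul, norm_I, one_mul, norm_div, Complex.norm_intCast, Complex.norm_intCast,
      abs_of_pos hpR, div_le_one hpR]
    have h1 := abs_til_mul_le n m m
    have h2 : |til n m| ≤ |til n m * til n m| := by
      rw [abs_mul]
      rcases eq_or_ne (til n m) 0 with h | h
      · simp [h]
      · nlinarith [Int.one_le_abs h]
    exact_mod_cast h2.trans h1

theorem Decay.pressure (hω : ∀ l, Decay (ω l)) (hf : ∀ l, Decay (f l)) :
    Decay (pressure Ω ν ω f) :=
  Decay.sum Finset.univ fun m => (Decay.residual hω hf m).bounded_mul _ 1 fun n =>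
    norm_til_div_tilSq_le n m

theorem advect_Mop_of_til_eq_zero (hω : ∀ l, Decay (ω l)) {n : Z4} (hn : til n = 0) (l : Fin 3) :
    advect (Mop ω) (Mop ω) l n = 0 := by
  have hc : tilC n = 0 := by
    funext j
    simp [tilC, hn]
  refine (hasSum_advect (Decay.Mop hω) (Decay.Mop hω) l n).unique
    (hasSum_zero.congr_fun fun k => ?_)
  rw [tilC_sub, hc, zero_sub, dotProduct_neg, vec_Mop_dot, neg_zero, zero_mul]

/-- The momentum equation in Fourier space. -/
theorem residual_add_pressure (hω : ∀ l, Decay (ω l)) (hω0 : ∀ l, ω l 0 = 0)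
    (hdiv : ∀ n, divSeq ω n = 0) (hΩ : Ω ≠ 0) (hfmean : ∀ l n, til n = 0 → f l n = 0)
    (heq : ∀ l n, n ≠ 0 → I * (Ω : ℂ) * (n 3 : ℂ) * ω l n + Psi ω l n
      + (ν : ℂ) * (tilSq n : ℂ) * ω l n - curlSeq f l n = 0) (l : Fin 3) (n : Z4) :
    residual Ω ν ω f l n + I * (til n l : ℂ) * pressure Ω ν ω f n = 0 := by
  by_cases hn : til n = 0
  -- On these modes the velocity, the advection term and the forcing vanish separately.
  · have hM : Mop ω l n = 0 := by simp [Mop, Mmat, hn]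
    simp [residual, hM, advect_Mop_of_til_eq_zero hω hn, hfmean l n hn, hn]
  have hn0 : n ≠ 0 := fun h => hn (by rw [h, til_zero])
  have hmean := eq_zero_of_til_eq_zero hω hω0 hdiv hΩ heq
  have hcurl := curlSeq_Mop hdiv hmean
  -- By `curlSeq_advect` and `ω = ∇ × Mω`, the curl of the momentum residual is the vorticity
  -- equation.
  have hcr : ∀ l, curlSeq (residual Ω ν ω f) l n = 0 := fun l => by
    have h1 := heq l n hn0
    rw [← curlSeq_advect hω hcurl l n, ← hcurl l n] at h1
    rw [← h1]
    simp only [curlSeq, residual, Matrix.mulVec, dotProduct, Fin.sum_univ_three]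
    ring
  have hT := tilSq_ne_zero hn
  have hc0 : crossProduct (tilC n) (vec (residual Ω ν ω f) n) = 0 := by
    funext l
    have h := hcr l
    rw [curlSeq_eq] at h
    exact (mul_eq_zero.1 h).resolve_left I_ne_zero
  -- A vector `v` with `ñ × v = 0` satisfies `ñ² v = (ñ·v) ñ`, so the residual is parallel to `ñ`,
  -- hence a gradient.
  have h2 := cross_cross_self (tilC n) (vec (residual Ω ν ω f) n) l
  rw [hc0, map_zero, tilC_dot_self] at h2
  have h3 : pressure Ω ν ω f n = I / (tilSq n : ℂ) * (tilC n ⬝ᵥ vec (residual Ω ν ω f) n) := by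
    rw [pressure, dotProduct, Finset.mul_sum]
    refine Finset.sum_congr rfl fun m _ => ?_
    rw [tilC, vec]
    ring
  have h4 : (tilC n ⬝ᵥ vec (residual Ω ν ω f) n) * (til n l : ℂ)
      = (tilSq n : ℂ) * residual Ω ν ω f l n := by
    have h5 : (0 : ℂ) = (tilC n ⬝ᵥ vec (residual Ω ν ω f) n) * (til n l : ℂ)
      - (tilSq n : ℂ) * residual Ω ν ω f l n := h2
    linear_combination -h5
  rw [h3]
  field_simp
  linear_combination (tilC n ⬝ᵥ vec (residual Ω ν ω f) n) * (til n l : ℂ) * I_sq - h4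

end FourierSolution

/-! ## Analyticity of exponential sums -/

section ExponentialSums

variable {ι E : Type*} [NormedAddCommGroup E] [NormedSpace ℝ E] {c : ι → ℂ} {ψ : ι → E →L[ℝ] ℂ}
  {r : ℝ}

theorem norm_coeff_mul_exp (hψ : ∀ i q, (ψ i q).re = 0) (i : ι) (q : E) :
    ‖c i * exp (ψ i q)‖ = ‖c i‖ := by
  rw [norm_mul, Complex.norm_exp, hψ, Real.exp_zero, mul_one]

theorem summable_mul_norm (hr : 0 < r) (hs : Summable fun i => ‖c i‖ * Real.exp (r * ‖ψ i‖)) :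
    Summable fun i => ‖c i‖ * ‖ψ i‖ := by
  refine Summable.of_nonneg_of_le (fun i => by positivity) (fun i => ?_) (hs.mul_left r⁻¹)
  have h1 : r * ‖ψ i‖ ≤ Real.exp (r * ‖ψ i‖) := by
    linarith [Real.add_one_le_exp (r * ‖ψ i‖)]
  rw [inv_mul_eq_div, le_div_iff₀ hr]
  nlinarith [mul_le_mul_of_nonneg_left h1 (norm_nonneg (c i))]

theorem summable_coeff (hr : 0 < r) (hs : Summable fun i => ‖c i‖ * Real.exp (r * ‖ψ i‖)) :
    Summable fun i => ‖c i‖ :=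
  Summable.of_nonneg_of_le (fun i => norm_nonneg _)
    (fun i => le_mul_of_one_le_right (norm_nonneg _) (Real.one_le_exp (by positivity))) hs

theorem summable_smul_clm (hψ : ∀ i q, (ψ i q).re = 0) (hr : 0 < r)
    (hs : Summable fun i => ‖c i‖ * Real.exp (r * ‖ψ i‖)) (x : E) :
    Summable fun i => (c i * exp (ψ i x)) • ψ i :=
  Summable.of_norm_bounded (summable_mul_norm hr hs) fun i => by
    rw [norm_smul, norm_coeff_mul_exp hψ]

theorem hasFDerivAt_expSum (hψ : ∀ i q, (ψ i q).re = 0) (hr : 0 < r)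
    (hs : Summable fun i => ‖c i‖ * Real.exp (r * ‖ψ i‖)) (x : E) :
    HasFDerivAt (fun q => ∑' i, c i * exp (ψ i q)) (∑' i, (c i * exp (ψ i x)) • ψ i) x := by
  refine hasFDerivAt_tsum (𝕜 := ℝ) (x₀ := (0 : E)) (f := fun i q => c i * exp (ψ i q))
    (f' := fun i q => (c i * exp (ψ i q)) • ψ i) (summable_mul_norm hr hs) (fun i q => ?_) (fun i q => ?_)
    ?_ x
  · have := ((ψ i).hasFDerivAt (x := q)).cexp.const_mul (c i)
    rwa [smul_smul] at this
  · rw [norm_smul, norm_coeff_mul_exp hψ]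
  · exact Summable.of_norm_bounded (summable_coeff hr hs) fun i => (norm_coeff_mul_exp hψ i 0).le

/-- The terms of the Taylor expansion of `c exp(ψ q)` at `x`. -/
def expTerm (c : ι → ℂ) (ψ : ι → E →L[ℝ] ℂ) (x : E) (k : ℕ) (i : ι) :
    ContinuousMultilinearMap ℝ (fun _ : Fin k => E) ℂ :=
  (c i * exp (ψ i x) / (k.factorial : ℂ)) •
    (ContinuousMultilinearMap.mkPiAlgebraFin ℝ k ℂ).compContinuousLinearMap fun _ => ψ i

theorem expTerm_apply (x y : E) (k : ℕ) (i : ι) :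
    expTerm c ψ x k i (fun _ => y)
      = c i * exp (ψ i x) * ((ψ i y) ^ k / (k.factorial : ℂ)) := by
  simp [expTerm]
  ring

theorem norm_expTerm_le (hψ : ∀ i q, (ψ i q).re = 0) (x : E) (k : ℕ) (i : ι) :
    ‖expTerm c ψ x k i‖ ≤ ‖c i‖ * (‖ψ i‖ ^ k / k.factorial) := by
  rw [expTerm, norm_smul, norm_div, norm_coeff_mul_exp hψ, Complex.norm_natCast, div_mul_eq_mul_div,
    mul_div_assoc]
  refine mul_le_mul_of_nonneg_left ?_ (norm_nonneg _)
  refine div_le_div_of_nonneg_right ?_ (by positivity)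
  refine (ContinuousMultilinearMap.norm_compContinuousLinearMap_le _ _).trans ?_
  rw [ContinuousMultilinearMap.norm_mkPiAlgebraFin, one_mul, Finset.prod_const, Finset.card_univ,
    Fintype.card_fin]

theorem norm_expTerm_mul_pow_le (hψ : ∀ i q, (ψ i q).re = 0) (hr : 0 < r) (x : E) (k : ℕ) (i : ι) :
    ‖expTerm c ψ x k i‖ * r ^ k ≤ ‖c i‖ * ((r * ‖ψ i‖) ^ k / k.factorial) := by
  refine (mul_le_mul_of_nonneg_right (norm_expTerm_le hψ x k i) (by positivity)).trans (le_of_eq ?_)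
  rw [mul_pow]
  ring

theorem norm_expTerm_mul_pow_le_exp (hψ : ∀ i q, (ψ i q).re = 0) (hr : 0 < r) (x : E) (k : ℕ)
    (i : ι) : ‖expTerm c ψ x k i‖ * r ^ k ≤ ‖c i‖ * Real.exp (r * ‖ψ i‖) :=
  (norm_expTerm_mul_pow_le hψ hr x k i).trans (mul_le_mul_of_nonneg_left
    (Real.pow_div_factorial_le_exp _ (by positivity) _) (norm_nonneg _))

theorem summable_expTerm (hψ : ∀ i q, (ψ i q).re = 0) (hr : 0 < r)
    (hs : Summable fun i => ‖c i‖ * Real.exp (r * ‖ψ i‖)) (x : E) (k : ℕ) :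
    Summable fun i => ‖expTerm c ψ x k i‖ := by
  refine (summable_mul_right_iff (pow_pos hr k).ne').1 ?_
  exact Summable.of_nonneg_of_le (fun i => by positivity)
    (norm_expTerm_mul_pow_le_exp hψ hr x k) hs

theorem hasSum_rexp (z : ℝ) : HasSum (fun k : ℕ => z ^ k / k.factorial) (Real.exp z) := by
  rw [Real.exp_eq_exp_ℝ]
  exact NormedSpace.expSeries_div_hasSum_exp z

theorem hasSum_cexp (z : ℂ) : HasSum (fun k : ℕ => z ^ k / k.factorial) (exp z) := by
  rw [Complex.exp_eq_exp_ℂ]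
  exact NormedSpace.expSeries_div_hasSum_exp z

theorem summable_prod_exp (hr : 0 < r) (hs : Summable fun i => ‖c i‖ * Real.exp (r * ‖ψ i‖)) :
    Summable fun q : ι × ℕ => ‖c q.1‖ * ((r * ‖ψ q.1‖) ^ q.2 / q.2.factorial) := by
  have h0 : (0 : ι × ℕ → ℝ) ≤ fun q => ‖c q.1‖ * ((r * ‖ψ q.1‖) ^ q.2 / q.2.factorial) :=
    fun q => mul_nonneg (norm_nonneg _) (by positivity)
  have h1 : ∀ i, HasSum (fun k : ℕ => ‖c i‖ * ((r * ‖ψ i‖) ^ k / k.factorial))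
      (‖c i‖ * Real.exp (r * ‖ψ i‖)) := fun i => (hasSum_rexp _).mul_left _
  refine (summable_prod_of_nonneg h0).2 ⟨fun i => (h1 i).summable, ?_⟩
  exact hs.congr fun i => (h1 i).tsum_eq.symm

/-- Each exponential is expanded at `x`. The double series is dominated by `∑ ‖c i‖ exp(r ‖ψ i‖)`,
so for `‖y‖ < r` the order of summation can be exchanged. The radius does not depend on `x`, because
`ψ i` takes imaginary values and `|exp(ψ i x)| = 1`. -/
theorem hasFPowerSeriesOnBall_expSum (hψ : ∀ i q, (ψ i q).re = 0) (hr : 0 < r)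
    (hs : Summable fun i => ‖c i‖ * Real.exp (r * ‖ψ i‖)) (x : E) :
    HasFPowerSeriesOnBall (fun q => ∑' i, c i * exp (ψ i q)) (fun k => ∑' i, expTerm c ψ x k i) x
      (ENNReal.ofReal r) where
  r_le := by
    refine FormalMultilinearSeries.le_radius_of_bound _ (∑' i, ‖c i‖ * Real.exp (r * ‖ψ i‖))
      fun k => ?_
    have h1 := summable_expTerm hψ hr hs x k
    rw [Real.coe_toNNReal _ hr.le]
    refine (mul_le_mul_of_nonneg_right (norm_tsum_le_tsum_norm h1) (by positivity)).trans ?_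
    rw [← tsum_mul_right]
    exact (h1.mul_right _).tsum_le_tsum (norm_expTerm_mul_pow_le_exp hψ hr x k) hs
  r_pos := ENNReal.ofReal_pos.2 hr
  hasSum := by
    intro y hy
    have hyr : ‖y‖ < r := by
      rw [ENNReal.ofReal, Metric.eball_coe, mem_ball_zero_iff, Real.coe_toNNReal _ hr.le] at hy
      exact hy
    set F : ι × ℕ → ℂ := fun q => c q.1 * exp (ψ q.1 x) * ((ψ q.1 y) ^ q.2 / (q.2.factorial : ℂ))
      with hF
    have hG := summable_prod_exp hr hs
    have hFs : Summable F := Summable.of_norm_bounded hG fun q => by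
      simp only [hF]
      rw [norm_mul, norm_coeff_mul_exp hψ, norm_div, norm_pow, Complex.norm_natCast]
      have : ‖ψ q.1 y‖ ≤ r * ‖ψ q.1‖ := by
        refine ((ψ q.1).le_opNorm y).trans ?_
        rw [mul_comm]
        exact mul_le_mul_of_nonneg_right hyr.le (norm_nonneg _)
      gcongr
    have h1 := hFs.hasSum.prod_fiberwise fun i => (hasSum_cexp (ψ i y)).mul_left (c i * exp (ψ i x))
    have h2 : ∑' q, F q = ∑' i, c i * exp (ψ i (x + y)) := by
      rw [← h1.tsum_eq]
      refine tsum_congr fun i => ?_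
      rw [map_add, Complex.exp_add, mul_assoc]
    rw [← h2]
    -- The same double sum, now grouped by the degree `k`.
    refine ((Equiv.prodComm ℕ ι).hasSum_iff.2 hFs.hasSum).prod_fiberwise fun k => ?_
    have h3 := (summable_expTerm hψ hr hs x k).of_norm.hasSum
    have h4 := h3.mapL (ContinuousMultilinearMap.apply ℝ (fun _ : Fin k => E) ℂ fun _ => y)
    refine h4.congr_fun fun i => ?_
    exact (expTerm_apply x y k i).symm

theorem analyticAt_expSum (hψ : ∀ i q, (ψ i q).re = 0) (hr : 0 < r)
    (hs : Summable fun i => ‖c i‖ * Real.exp (r * ‖ψ i‖)) (x : E) :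
    AnalyticAt ℝ (fun q => ∑' i, c i * exp (ψ i q)) x :=
  (hasFPowerSeriesOnBall_expSum hψ hr hs x).analyticAt

end ExponentialSums

/-! ## Fourier series in physical space -/

/-- The linear functional `(x, t) ↦ ñ·x + n₄ Ω t`. -/
def phaseR (Ω : ℝ) (n : Z4) : (Fin 3 → ℝ) × ℝ →L[ℝ] ℝ :=
  ∑ j, (til n j : ℝ) • (ContinuousLinearMap.proj (R := ℝ) (φ := fun _ : Fin 3 => ℝ) j ∘L
    ContinuousLinearMap.fst ℝ (Fin 3 → ℝ) ℝ)
    + ((n 3 : ℝ) * Ω) • ContinuousLinearMap.snd ℝ (Fin 3 → ℝ) ℝ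

theorem phaseR_apply (Ω : ℝ) (n : Z4) (q : (Fin 3 → ℝ) × ℝ) :
    phaseR Ω n q = ∑ j, (til n j : ℝ) * q.1 j + (n 3 : ℝ) * Ω * q.2 := by
  simp [phaseR]

/-- The linear functional `(x, t) ↦ i (ñ·x + n₄ Ω t)`. -/
def phaseL (Ω : ℝ) (n : Z4) : (Fin 3 → ℝ) × ℝ →L[ℝ] ℂ := I • (ofRealCLM ∘L phaseR Ω n)

theorem phaseL_apply (Ω : ℝ) (n : Z4) (q : (Fin 3 → ℝ) × ℝ) :
    phaseL Ω n q = I * (phaseR Ω n q : ℂ) := rfl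

theorem phaseL_re (Ω : ℝ) (n : Z4) (q : (Fin 3 → ℝ) × ℝ) : (phaseL Ω n q).re = 0 := by
  simp [phaseL_apply]

theorem mode_eq (Ω : ℝ) (n : Z4) (x : Fin 3 → ℝ) (t : ℝ) : mode Ω n x t = exp (phaseL Ω n (x, t)) := by
  rw [mode, phaseL_apply, phaseR_apply]

theorem norm_phaseL_le (Ω : ℝ) (n : Z4) : ‖phaseL Ω n‖ ≤ (1 + |Ω|) * norm1 n := by
  refine ContinuousLinearMap.opNorm_le_bound _ (by positivity) fun q => ?_
  rw [phaseL_apply, norm_mul, norm_I, one_mul, Complex.norm_real, phaseR_apply]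
  have hq1 : ∀ j, |q.1 j| ≤ ‖q‖ := fun j => (norm_le_pi_norm q.1 j).trans (norm_fst_le q)
  have hq2 : |q.2| ≤ ‖q‖ := norm_snd_le q
  have h1 : ∀ j : Fin 3, |(til n j : ℝ) * q.1 j| ≤ ((til n j).natAbs : ℝ) * ‖q‖ := fun j => by
    rw [abs_mul, Nat.cast_natAbs, Int.cast_abs]
    exact mul_le_mul_of_nonneg_left (hq1 j) (abs_nonneg _)
  have h2 : |(n 3 : ℝ) * Ω * q.2| ≤ |Ω| * ((n 3).natAbs : ℝ) * ‖q‖ := by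
    rw [abs_mul, abs_mul, Nat.cast_natAbs, Int.cast_abs, mul_comm |Ω|]
    exact mul_le_mul_of_nonneg_left hq2 (by positivity)
  have h3 : (norm1 n : ℝ) = ∑ j : Fin 3, ((til n j).natAbs : ℝ) + ((n 3).natAbs : ℝ) := by
    rw [norm1, Fin.sum_univ_castSucc]
    push_cast
    rfl
  have h4 : (0 : ℝ) ≤ ∑ j : Fin 3, ((til n j).natAbs : ℝ) := Finset.sum_nonneg fun _ _ => by
    positivity
  rw [Real.norm_eq_abs]
  refine (abs_add_le _ _).trans ((add_le_add ((Finset.abs_sum_le_sum_abs _ _).trans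
    (Finset.sum_le_sum fun j _ => h1 j)) h2).trans ?_)
  rw [← Finset.sum_mul, h3]
  have h5 : 0 ≤ |Ω| * (∑ j : Fin 3, ((til n j).natAbs : ℝ)) * ‖q‖ := by positivity
  have h6 : 0 ≤ ((n 3).natAbs : ℝ) * ‖q‖ := by positivity
  nlinarith

/-- Since `‖phaseL Ω n‖ ≤ (1 + |Ω|) |n|₁`, the choice `r = log ρ / (1 + |Ω|)` gives `exp(r ‖phaseL Ω
n‖) ≤ ρ^{|n|₁}`. -/
theorem Decay.exists_exp {a : Z4 → ℂ} (ha : Decay a) (Ω : ℝ) :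
    ∃ r : ℝ, 0 < r ∧ Summable fun n => ‖a n‖ * Real.exp (r * ‖phaseL Ω n‖) := by
  obtain ⟨ρ, hρ, ha⟩ := ha
  have hl : 0 < Real.log ρ := Real.log_pos hρ
  have hc : 0 < 1 + |Ω| := by positivity
  refine ⟨Real.log ρ / (1 + |Ω|), by positivity, Summable.of_nonneg_of_le (fun n => by positivity)
    (fun n => mul_le_mul_of_nonneg_left ?_ (norm_nonneg _)) ha⟩
  have h1 : Real.log ρ / (1 + |Ω|) * ‖phaseL Ω n‖ ≤ norm1 n * Real.log ρ := by
    rw [div_mul_eq_mul_div, div_le_iff₀ hc]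
    nlinarith [mul_le_mul_of_nonneg_left (norm_phaseL_le Ω n) hl.le]
  calc Real.exp _ ≤ Real.exp (norm1 n * Real.log ρ) := Real.exp_le_exp.2 h1
    _ = ρ ^ norm1 n := by
      rw [Real.exp_nat_mul, Real.exp_log (by linarith)]

/-- The complex Fourier series with coefficients `a`. -/
def fourierC (Ω : ℝ) (a : Z4 → ℂ) (q : (Fin 3 → ℝ) × ℝ) : ℂ := ∑' n, a n * exp (phaseL Ω n q)

/-- The real part of the Fourier series with coefficients `a`. -/
def fourierR (Ω : ℝ) (a : Z4 → ℂ) (x : Fin 3 → ℝ) (t : ℝ) : ℝ := (fourierC Ω a (x, t)).re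

section

variable {Ω : ℝ} {a b : Z4 → ℂ}

theorem Decay.summable_mode (ha : Decay a) (Ω : ℝ) (q : (Fin 3 → ℝ) × ℝ) :
    Summable fun n => a n * exp (phaseL Ω n q) :=
  Summable.of_norm_bounded ha.summable_norm fun n => (norm_coeff_mul_exp (phaseL_re Ω) n q).le

theorem fourierC_conj (ha : conjSeq a = a) (q : (Fin 3 → ℝ) × ℝ) :
    (starRingEnd ℂ) (fourierC Ω a q) = fourierC Ω a q := by
  rw [fourierC, Complex.conj_tsum, ← (Equiv.neg Z4).tsum_eq]
  refine tsum_congr fun n => ?_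
  have h1 : (starRingEnd ℂ) (a (-n)) = a n := congrFun ha n
  have h2 : phaseR Ω (-n) q = -phaseR Ω n q := by
    simp only [phaseR_apply, til_neg, Pi.neg_apply, Int.cast_neg, neg_mul, Finset.sum_neg_distrib]
    ring
  rw [Equiv.neg_apply, map_mul, h1, ← Complex.exp_conj, phaseL_apply, phaseL_apply, map_mul, conj_I,
    conj_ofReal, h2, ofReal_neg, neg_mul_neg]

theorem fourierC_eq (ha : conjSeq a = a) (x : Fin 3 → ℝ) (t : ℝ) :
    fourierC Ω a (x, t) = (fourierR Ω a x t : ℂ) :=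
  (Complex.conj_eq_iff_re.1 (fourierC_conj ha (x, t))).symm

theorem hasSum_fourierR (hd : Decay a) (ha : conjSeq a = a) (x : Fin 3 → ℝ) (t : ℝ) :
    HasSum (fun n => a n * mode Ω n x t) ((fourierR Ω a x t : ℝ) : ℂ) := by
  rw [← fourierC_eq ha]
  simp only [mode_eq]
  exact (hd.summable_mode Ω (x, t)).hasSum

theorem fourierC_add (ha : Decay a) (hb : Decay b) (q : (Fin 3 → ℝ) × ℝ) :
    fourierC Ω (fun n => a n + b n) q = fourierC Ω a q + fourierC Ω b q := by
  rw [fourierC, fourierC, fourierC, ← (ha.summable_mode Ω q).tsum_add (hb.summable_mode Ω q)]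
  exact tsum_congr fun n => add_mul _ _ _

theorem fourierC_const_mul (c : ℂ) (q : (Fin 3 → ℝ) × ℝ) :
    fourierC Ω (fun n => c * a n) q = c * fourierC Ω a q := by
  rw [fourierC, fourierC, ← tsum_mul_left]
  exact tsum_congr fun n => mul_assoc _ _ _

theorem fourierR_add (ha : Decay a) (hb : Decay b) (x : Fin 3 → ℝ) (t : ℝ) :
    fourierR Ω (fun n => a n + b n) x t = fourierR Ω a x t + fourierR Ω b x t := by
  rw [fourierR, fourierC_add ha hb, add_re]
  rfl

theorem fourierR_real_mul (c : ℝ) (x : Fin 3 → ℝ) (t : ℝ) :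
    fourierR Ω (fun n => (c : ℂ) * a n) x t = c * fourierR Ω a x t := by
  rw [fourierR, fourierC_const_mul, Complex.re_ofReal_mul]
  rfl

theorem fourierR_zero (x : Fin 3 → ℝ) (t : ℝ) : fourierR Ω (fun _ => 0) x t = 0 := by
  simp [fourierR, fourierC]

theorem fourierR_sum {ι : Type*} (s : Finset ι) {a : ι → Z4 → ℂ} (ha : ∀ i, Decay (a i))
    (x : Fin 3 → ℝ) (t : ℝ) :
    fourierR Ω (fun n => ∑ i ∈ s, a i n) x t = ∑ i ∈ s, fourierR Ω (a i) x t := by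
  classical
  induction s using Finset.induction_on with
  | empty => simpa using fourierR_zero x t
  | insert i s hi ih =>
    simp only [Finset.sum_insert hi]
    rw [fourierR_add (ha i) (Decay.sum s ha), ih]

/-- The absolutely convergent product is regrouped by the total frequency `n` through `shiftEquiv`.
-/
theorem fourierC_mul (ha : Decay a) (hb : Decay b) (q : (Fin 3 → ℝ) × ℝ) :
    fourierC Ω a q * fourierC Ω b q = fourierC Ω (conv a b) q := by
  have h1 : ∀ {a : Z4 → ℂ}, Decay a → Summable fun n => ‖a n * exp (phaseL Ω n q)‖ := fun ha => by
    simpa only [norm_coeff_mul_exp (phaseL_re Ω)] using ha.summable_norm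
  have hs := summable_mul_of_summable_norm (h1 ha) (h1 hb)
  have hs' := shiftEquiv.summable_iff.2 hs
  rw [fourierC, fourierC, tsum_mul_tsum_of_summable_norm (h1 ha) (h1 hb), ← shiftEquiv.tsum_eq]
  refine hs'.tsum_prod.trans (tsum_congr fun n => ?_)
  rw [conv, ← tsum_mul_right]
  refine tsum_congr fun k => ?_
  have h2 : phaseL Ω n q = phaseL Ω k q + phaseL Ω (n - k) q := by
    simp only [phaseL_apply, phaseR_apply, til, Pi.sub_apply, Int.cast_sub, sub_mul,
      Finset.sum_sub_distrib]
    push_cast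
    ring
  simp only [shiftEquiv, Function.comp_apply, Equiv.coe_fn_mk]
  rw [h2, Complex.exp_add]
  ring

theorem fourierR_mul (ha : Decay a) (hb : Decay b) (ha' : conjSeq a = a) (hb' : conjSeq b = b)
    (x : Fin 3 → ℝ) (t : ℝ) :
    fourierR Ω a x t * fourierR Ω b x t = fourierR Ω (conv a b) x t := by
  have h := fourierC_mul (Ω := Ω) ha hb (x, t)
  rw [fourierC_eq ha', fourierC_eq hb', ← ofReal_mul] at h
  exact congrArg Complex.re h

theorem analyticAt_fourierR (ha : Decay a) (q : (Fin 3 → ℝ) × ℝ) :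
    AnalyticAt ℝ (fun q : (Fin 3 → ℝ) × ℝ => fourierR Ω a q.1 q.2) q := by
  obtain ⟨r, hr, hs⟩ := ha.exists_exp Ω
  exact (reCLM.analyticAt _).comp (analyticAt_expSum (phaseL_re Ω) hr hs q)

/-- Time and space derivatives are both obtained from this joint derivative by choosing the
direction `v`. -/
theorem exists_hasFDerivAt_fourierC (ha : Decay a) (q : (Fin 3 → ℝ) × ℝ) :
    ∃ D : (Fin 3 → ℝ) × ℝ →L[ℝ] ℂ, HasFDerivAt (fourierC Ω a) D q ∧
      ∀ v, D v = fourierC Ω (fun n => phaseL Ω n v * a n) q := by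
  obtain ⟨r, hr, hs⟩ := ha.exists_exp Ω
  refine ⟨_, hasFDerivAt_expSum (phaseL_re Ω) hr hs q, fun v => ?_⟩
  have h := (summable_smul_clm (phaseL_re Ω) hr hs q).hasSum.mapL
    (ContinuousLinearMap.apply ℝ ℂ v)
  refine h.tsum_eq.symm.trans (tsum_congr fun n => ?_)
  show a n * exp (phaseL Ω n q) * phaseL Ω n v = _
  ring

theorem deriv_fourierR (ha : Decay a) (x : Fin 3 → ℝ) (t : ℝ) :
    deriv (fun s => fourierR Ω a x s) t
      = fourierR Ω (fun n => I * (Ω : ℂ) * (n 3 : ℂ) * a n) x t := by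
  obtain ⟨D, hD, hv⟩ := exists_hasFDerivAt_fourierC (Ω := Ω) ha (x, t)
  have h1 := (hD.comp t (hasFDerivAt_prodMk_right x t))
  have h2 := (reCLM.hasFDerivAt.comp t h1).hasDerivAt.deriv
  refine Eq.trans h2 ?_
  show (D (0, 1)).re = _
  rw [hv, fourierR]
  congr 2
  funext n
  rw [phaseL_apply, phaseR_apply]
  simp only [Pi.zero_apply, mul_zero, Finset.sum_const_zero, zero_add, mul_one]
  push_cast
  ring

theorem pd_fourierR (ha : Decay a) (j : Fin 3) (x : Fin 3 → ℝ) (t : ℝ) :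
    pd j (fun y => fourierR Ω a y t) x = fourierR Ω (fun n => I * (til n j : ℂ) * a n) x t := by
  obtain ⟨D, hD, hv⟩ := exists_hasFDerivAt_fourierC (Ω := Ω) ha (x, t)
  have h1 := HasFDerivAt.comp (g := fourierC Ω a) (f := fun y => (y, t)) x hD
    (hasFDerivAt_prodMk_left x t)
  have h2 := (reCLM.hasFDerivAt.comp x h1).fderiv
  rw [pd]
  refine Eq.trans (congrArg (fun T : (Fin 3 → ℝ) →L[ℝ] ℝ => T (Pi.single j 1)) h2) ?_
  show (D (Pi.single j 1, 0)).re = _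
  rw [hv, fourierR]
  congr 2
  funext n
  rw [phaseL_apply, phaseR_apply]
  simp [Pi.single_apply]

theorem fourierR_periodic (hΩ : Ω ≠ 0) : IsPeriodic (2 * Real.pi / Ω) (fourierR Ω a) := by
  constructor
  · intro x t j
    rw [fourierR, fourierR, fourierC, fourierC]
    congr 2
    funext n
    have h : phaseR Ω n (x + Pi.single j (2 * Real.pi), t)
        = phaseR Ω n (x, t) + (til n j : ℝ) * (2 * Real.pi) := by
      simp only [phaseR_apply, Pi.add_apply, mul_add, Finset.sum_add_distrib]
      simp [Pi.single_apply]
      ring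
    rw [phaseL_apply, phaseL_apply, h]
    congr 1
    refine Complex.exp_eq_exp_iff_exists_int.2 ⟨til n j, ?_⟩
    push_cast
    ring
  · intro x t
    rw [fourierR, fourierR, fourierC, fourierC]
    congr 2
    funext n
    have h : phaseR Ω n (x, t + 2 * Real.pi / Ω)
        = phaseR Ω n (x, t) + (n 3 : ℝ) * (2 * Real.pi) := by
      simp only [phaseR_apply]
      field_simp
      ring
    rw [phaseL_apply, phaseL_apply, h]
    congr 1
    refine Complex.exp_eq_exp_iff_exists_int.2 ⟨n 3, ?_⟩
    push_cast
    ring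

end

/-! ## The Navier–Stokes equations -/

theorem conjSeq_til_mul {a : Z4 → ℂ} (ha : conjSeq a = a) (j : Fin 3) :
    conjSeq (fun n => I * (til n j : ℂ) * a n) = fun n => I * (til n j : ℂ) * a n := by
  funext n
  have h : (starRingEnd ℂ) (a (-n)) = a n := congrFun ha n
  simp only [conjSeq, map_mul, conj_I, map_intCast, til_neg, Int.cast_neg, map_neg, h]
  ring

theorem Decay.I_til_mul {a : Z4 → ℂ} (ha : Decay a) (j : Fin 3) :
    Decay fun n => I * (til n j : ℂ) * a n := by
  simpa only [mul_assoc] using (ha.til_mul j).const_mul I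

/-- The factor `i` is moved next to `n_m`, so that each convolution involves the coefficients of
real functions, as `fourierR_mul` requires. -/
theorem I_advect_eq (a b : Fin 3 → Z4 → ℂ) (l : Fin 3) (n : Z4) :
    I * advect a b l n = ∑ m, conv (a m) (fun n => I * (til n m : ℂ) * b l n) n := by
  rw [advect, Finset.mul_sum]
  refine Finset.sum_congr rfl fun m _ => ?_
  rw [conv, conv, ← tsum_mul_left]
  exact tsum_congr fun k => by rw [Dop]; ring

theorem solvesNS_fourierR {u f : Fin 3 → Z4 → ℂ} {p : Z4 → ℂ} {Ω ν : ℝ} (hu : ∀ l, Decay (u l))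
    (hp : Decay p) (hur : ∀ l, conjSeq (u l) = u l)
    (hdiv : ∀ n, ∑ m, (til n m : ℂ) * u m n = 0)
    (heq : ∀ l n, I * (Ω : ℂ) * (n 3 : ℂ) * u l n + I * advect u u l n
      + (ν : ℂ) * (tilSq n : ℂ) * u l n - f l n + I * (til n l : ℂ) * p n = 0) :
    SolvesNS ν (fun x t l => fourierR Ω (f l) x t) (fun x t l => fourierR Ω (u l) x t)
      (fourierR Ω p) := by
  intro x t
  refine ⟨fun l => ?_, ?_⟩
  · have hadv : ∑ m, fourierR Ω (u m) x t * pd m (fun y => fourierR Ω (u l) y t) x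
        = fourierR Ω (fun n => I * advect u u l n) x t := by
      simp only [I_advect_eq]
      rw [fourierR_sum _ fun m => (hu m).conv ((hu l).I_til_mul m)]
      refine Finset.sum_congr rfl fun m _ => ?_
      rw [pd_fourierR (hu l), fourierR_mul (hu m) ((hu l).I_til_mul m) (hur m)
        (conjSeq_til_mul (hur l) m)]
    have hlap : ∑ m, pd m (pd m fun y => fourierR Ω (u l) y t) x
        = -fourierR Ω (fun n => (tilSq n : ℂ) * u l n) x t := by
      have h1 : ∀ m, pd m (pd m fun y => fourierR Ω (u l) y t) x
          = fourierR Ω (fun n => I * (til n m : ℂ) * (I * (til n m : ℂ) * u l n)) x t := fun m => by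
        have : (pd m fun y => fourierR Ω (u l) y t)
            = fun y => fourierR Ω (fun n => I * (til n m : ℂ) * u l n) y t :=
          funext fun y => pd_fourierR (hu l) m y t
        rw [this, pd_fourierR ((hu l).I_til_mul m)]
      simp only [h1]
      rw [← fourierR_sum _ fun m => ((hu l).I_til_mul m).I_til_mul m, ← neg_one_mul]
      have h2 := fourierR_real_mul (Ω := Ω) (a := fun n => (tilSq n : ℂ) * u l n) (-1) x t
      rw [← h2]
      congr 1
      funext n
      rw [tilSq, Int.cast_sum, Finset.sum_mul, Finset.mul_sum]
      refine Finset.sum_congr rfl fun m _ => ?_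
      push_cast
      linear_combination (til n m : ℂ) * (til n m : ℂ) * u l n * I_mul_I
    have d1 : Decay fun n => I * (Ω : ℂ) * (n 3 : ℂ) * u l n := by
      simpa only [mul_assoc] using ((hu l).time_mul.const_mul (Ω : ℂ)).const_mul I
    have d2 : Decay fun n => I * advect u u l n := (Decay.advect hu hu l).const_mul I
    have d3 : Decay fun n => (ν : ℂ) * ((tilSq n : ℂ) * u l n) := (hu l).tilSq_mul.const_mul _
    -- Solving the equation for `f` leaves only sequences already known to decay.
    have hf : f l = fun n => I * (Ω : ℂ) * (n 3 : ℂ) * u l n + I * advect u u l n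
        + (ν : ℂ) * ((tilSq n : ℂ) * u l n) + I * (til n l : ℂ) * p n := by
      funext n
      linear_combination -heq l n
    simp only [hadv, hlap]
    rw [deriv_fourierR (hu l), pd_fourierR hp, hf, fourierR_add ((d1.add d2).add d3) (hp.I_til_mul l),
      fourierR_add (d1.add d2) d3, fourierR_add d1 d2, fourierR_real_mul]
    ring
  · refine (Finset.sum_congr rfl fun m _ => pd_fourierR (hu m) m x t).trans ?_
    rw [← fourierR_sum _ fun m => (hu m).I_til_mul m, ← fourierR_zero (Ω := Ω) x t]
    congr 1
    funext n
    have h := hdiv n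
    simp only [mul_assoc, ← Finset.mul_sum, h, mul_zero]

/-! ### From a zero of `calF` to a solution of the Navier–Stokes equations. -/

section

variable {η : ℝ} [hη : Fact (1 < η)]

theorem Fseq_extV {P : Problem η} {W : XSpace η} (hW : calF P W = 0)
    {Ω : ℝ} (hΩ : W.fst = (Ω : ℂ)) (l : Fin 3) (n : Z4) (hn : n ≠ 0) :
    I * (Ω : ℂ) * (n 3 : ℂ) * extV (coeffs W).2 l n + Psi (extV (coeffs W).2) l n
      + (P.ν : ℂ) * (tilSq n : ℂ) * extV (coeffs W).2 l n - curlSeq P.f l n = 0 := by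
  have h := ((calF_eq_zero_iff P W).1 hW).2 l ⟨n, hn⟩
  have e : extV (coeffs W).2 l n = (coeffs W).2 l ⟨n, hn⟩ := ext0_coe _ ⟨n, hn⟩
  rw [e, ← hΩ]
  exact h

/-- Membership in `ℓ¹_η` with `η > 1` is already exponential decay, so analyticity needs no
regularity argument. Symmetry of the zero supplies the real frequency and the real-valued fields. -/
theorem exists_navierStokes_solution {P : Problem η} (hfd : ∀ l, Decay (P.f l))
    (hfr : ∀ l n, P.f l (-n) = (starRingEnd ℂ) (P.f l n))
    (hfm : ∀ l n, til n = 0 → P.f l n = 0) {W : XSpace η} (hW : calF P W = 0)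
    (hsymm : gammaStar (coeffs W) = coeffs W) (hre : W.fst.re ≠ 0) :
    IsDivFree W ∧ ∃ (f u : (Fin 3 → ℝ) → ℝ → Fin 3 → ℝ) (p : (Fin 3 → ℝ) → ℝ → ℝ),
      HasFourier W.fst.re P.f f ∧
      HasFourier W.fst.re (Mop (extV (coeffs W).2)) u ∧
      AnalyticOnNhd ℝ (fun q : (Fin 3 → ℝ) × ℝ => u q.1 q.2) Set.univ ∧
      AnalyticOnNhd ℝ (fun q : (Fin 3 → ℝ) × ℝ => p q.1 q.2) Set.univ ∧
      IsPeriodic (2 * Real.pi / W.fst.re) u ∧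
      IsPeriodic (2 * Real.pi / W.fst.re) p ∧
      SolvesNS P.ν f u p := by
  set Ω := W.fst.re with hΩdef
  have hΩ : W.fst = (Ω : ℂ) :=
    (Complex.conj_eq_iff_re.1 (congrArg Prod.fst hsymm : (starRingEnd ℂ) W.fst = W.fst)).symm
  set ω := extV (coeffs W).2 with hω
  have hωd : ∀ l, Decay (ω l) := fun l => ⟨η, hη.out, S_ext0 (W.snd l)⟩
  have hω0 : ∀ l, ω l 0 = 0 := fun l => ext0_zero _
  have hωr : ∀ l, conjSeq (ω l) = ω l := fun l => by
    have h1 : gammaSeq (coeffs W).2 = (coeffs W).2 := congrArg Prod.snd hsymm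
    have h2 := congrFun (extV_gammaSeq (coeffs W).2) l
    rw [h1] at h2
    exact h2.symm
  have hfr' : ∀ l, conjSeq (P.f l) = P.f l := fun l => by
    funext n
    rw [conjSeq, hfr, Complex.conj_conj]
  have heq := Fseq_extV hW hΩ
  have hdiv := divSeq_eq_zero hωd hωr P.ν_pos heq
  have hMd := Decay.Mop hωd
  have hMr : ∀ l, conjSeq (Mop ω l) = Mop ω l := fun l => by
    rw [← Mop_conjSeq]
    simp only [hωr]
  have hpd : Decay (pressure Ω P.ν ω P.f) := Decay.pressure hωd hfd
  refine ⟨fun n => ?_, fun x t l => fourierR Ω (P.f l) x t, fun x t l => fourierR Ω (Mop ω l) x t,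
    fourierR Ω (pressure Ω P.ν ω P.f), fun x t l => hasSum_fourierR (hfd l) (hfr' l) x t,
    fun x t l => hasSum_fourierR (hMd l) (hMr l) x t, fun q _ => ?_,
    fun q _ => analyticAt_fourierR hpd q, ?_, fourierR_periodic hre, ?_⟩
  · have h := hdiv n.1
    refine Eq.trans (Finset.sum_congr rfl fun m _ => ?_) h
    exact congrArg ((til n.1 m : ℂ) * ·) (ext0_coe (W.snd m) n).symm
  · exact AnalyticAt.pi fun l => analyticAt_fourierR (hMd l) q
  · exact ⟨fun x t j => funext fun l => (fourierR_periodic hre).1 x t j,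
      fun x t => funext fun l => (fourierR_periodic hre).2 x t⟩
  · exact solvesNS_fourierR hMd hpd hMr (div_Mop ω)
      (residual_add_pressure hωd hω0 hdiv hre hfm heq)

end

end NSPeriodic

end

theorem mainTheorem4 {η : ℝ} [Fact (1 < η)]
    -- viscosity, forcing and reference orbit
    (P : Problem η)
    -- the forcing is analytic, real valued, time independent, and has space average zero
    (hf_analytic : ∃ ρ : ℝ, 1 < ρ ∧ ∀ l, ExpSum ρ (P.f l))
    (hf_real : ∀ l n, P.f l (-n) = (starRingEnd ℂ) (P.f l n))
    (hf_time : ∀ l n, n 3 ≠ 0 → P.f l n = 0)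
    (hf_mean : ∀ l n, til n = 0 → P.f l n = 0)
    -- the approximate zero, with its nonzero frequency
    (Wbar : XSpace η) (hΩ : Wbar.fst.re ≠ 0)
    (hdiv : IsDivFree Wbar)
    (hreal : gammaStar (coeffs Wbar) = coeffs Wbar)
    (hhat : gammaSeq P.ωhat = P.ωhat)
    -- the truncation parameter, the finite block of `A`, and `A` itself
    (N : ℕ) (hN : 0 < N)
    (B : Coord (calE P.ν Wbar.fst N) →ₗ[ℂ] Coord (calE P.ν Wbar.fst N))
    (A : YSpace η →L[ℂ] XSpace η) (hA : A = Aop P.ν_pos hΩ N B)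
    -- the bounds
    (Y₀ Z₀ Z₁ Z₂ : ℝ) (hY₀ : 0 ≤ Y₀) (hZ₀ : 0 ≤ Z₀) (hZ₁ : 0 ≤ Z₁) (hZ₂ : 0 ≤ Z₂)
    (boundY₀ : ‖A (calF P Wbar)‖ ≤ Y₀)
    (boundZ₀ : ‖ContinuousLinearMap.id ℂ (XSpace η) - A ∘L Ahat P Wbar N‖ ≤ Z₀)
    (boundZ₁ : ‖A ∘L (fderiv ℂ (calF P) Wbar - Ahat P Wbar N)‖ ≤ Z₁)
    (boundZ₂ : ∀ W : XSpace η,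
      ‖A ∘L (fderiv ℂ (calF P) W - fderiv ℂ (calF P) Wbar)‖ ≤ Z₂ * ‖W - Wbar‖)
    (cond₁ : Z₀ + Z₁ < 1)
    (cond₂ : 2 * Y₀ * Z₂ < (1 - (Z₀ + Z₁)) ^ 2) :
    ∀ r ∈ Set.Ico
        ((1 - (Z₀ + Z₁) - Real.sqrt ((1 - (Z₀ + Z₁)) ^ 2 - 2 * Y₀ * Z₂)) / Z₂)
        ((1 - (Z₀ + Z₁)) / Z₂),
      ∃ W : XSpace η,
        -- existence and uniqueness in the closed ball
        W ∈ Metric.closedBall Wbar r ∧ calF P W = 0 ∧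
        (∀ V ∈ Metric.closedBall Wbar r, calF P V = 0 → V = W) ∧
        -- the zero is divergence free and real, with a nonzero frequency
        IsDivFree W ∧ gammaStar (coeffs W) = coeffs W ∧ W.fst.re ≠ 0 ∧
        -- it gives an analytic periodic solution of the Navier-Stokes equations
        ∃ (f u : (Fin 3 → ℝ) → ℝ → Fin 3 → ℝ) (p : (Fin 3 → ℝ) → ℝ → ℝ),
          HasFourier W.fst.re P.f f ∧
          HasFourier W.fst.re (Mop (extV (coeffs W).2)) u ∧
          AnalyticOnNhd ℝ (fun q : (Fin 3 → ℝ) × ℝ => u q.1 q.2) Set.univ ∧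
          AnalyticOnNhd ℝ (fun q : (Fin 3 → ℝ) × ℝ => p q.1 q.2) Set.univ ∧
          IsPeriodic (2 * Real.pi / W.fst.re) u ∧
          IsPeriodic (2 * Real.pi / W.fst.re) p ∧
          SolvesNS P.ν f u p := by
  subst hA
  intro r hr
  obtain ⟨W, hW, hFW, huniq, hsymm, hre⟩ := exists_symmetric_zero P hf_real hhat hΩ hreal hZ₀ hZ₁
    hZ₂ hY₀ boundY₀ boundZ₀ boundZ₁ boundZ₂ cond₁ cond₂ hr
  obtain ⟨ρ, hρ, hf⟩ := hf_analytic
  obtain ⟨hWdiv, hNS⟩ := exists_navierStokes_solution (fun l => ⟨ρ, hρ, hf l⟩) hf_real hf_mean hFW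
    hsymm hre
  exact ⟨W, hW, hFW, huniq, hWdiv, hsymm, hre, hNS⟩
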